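/- Let $\mathcal X\subset\{0,1\}^{\mathbb N}$ be the golden mean shift, i.e. the space of one-sided infinite sequences without two consecutive $1$'s. For $i\in\{0,1,2\}$ let $a_i,b_i,c_i,d_i$ be the transformations of $\mathcal X$, written as right actions, defined recursively by $$(00w)\cdot s_0=10w,\quad (10w)\cdot s_0=00w\quad (s\in\{a,b,c\}),\qquad (00w)\cdot d_0=00w,\quad (10w)\cdot d_0=10w,$$ $$(010w)\cdot a_0=010w,\quad (010w)\cdot b_0=010(w\cdot c_0),\quad (010w)\cdot c_0=010(w\cdot d_0),\quad (010w)\cdot d_0=010(w\cdot b_0),$$ $$(0w)\cdot s_1=0(w\cdot s_0),\quad (10w)\cdot s_1=10w,\quad (0w)\cdot s_2=0w,\quad (10w)\cdot s_2=10(w\cdot s_0)\qquad(s\in\{a,b,c,d\}).$$ They are involutions. Let $S$ be the set of these twelve generators, $G$ the group they generate, $|g|$ the word length of $g\in G$ with respect to $S$, and $\gamma(R)=\#\{g\in G:|g|\le R\}$. For $\xi\in\mathcal X$ let $G_\xi$ be its stabilizer and $G_{(\xi)}$ the group of elements of $G$ acting trivially on a neighbourhood of $\xi$; the point $\xi$ is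 singular if $G_\xi\ne G_{(\xi)}$. The graph of germs of $\xi$ is the graph of the action of $S$ on the right cosets of $G_{(\xi)}$ in $G$, equivalently on the germs at $\xi$ of the elements of $G$. Put $\xi_0=(010)^\infty$, $\xi_1=(001)^\infty$, $\xi_2=(100)^\infty$. For $m=3k+i$ with $i\in\{0,1,2\}$ let $e_m$ be a multiple edge labeled by $b_i,c_i$ if $k\equiv0$, by $b_i,d_i$ if $k\equiv1$, and by $c_i,d_i$ if $k\equiv2\pmod 3$, and additionally by $a_i$ if $k=0$. Let $I_0=I_1$ be the segment of length $0$ and $I_n=I_{n-2}^{-1}e_{n-2}I_{n-1}^{-1}$ for $n\ge2$. For $n=3k+i$ and $h\in\{1,b_i,c_i,d_i\}$, the copy of $I_n$ labeled $h$ in the graph of germs of $\xi_i$ is obtained by starting in the germ of $h$ at $\xi_i$ and following the consecutive edges of $I_n$. The union of these four copies is the central part of level $n$; its internal vertices are all its vertices other than the far endpoints of the four copies. Let $w=s_1\cdots s_\ell$ be a word in $S$ and $|w|=\ell$. For $n=3k+i$ and $h\in\{b_i,c_i,d_i\}$ let $T_{n,h}$ be the number of intervals $[p,q]\subseteq[1,\ell]$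 such that the path labeled $s_p\cdots s_q$ that starts in the far endpoint of the copy of $I_n$ labeled $1$ ends in the far endpoint of the copy labeled $h$, and has only internal vertices of the central part of level $n$ in between. Let $$F_i(t)=\sum_{k=0}^\infty\ \sum_{h\in\{b_i,c_i,d_i\}}T_{3k+i,h}\,t^{3k+i}\quad(i\in\{0,1,2\}),\qquad F(t)=F_0(t)+F_1(t)+F_2(t).$$ Then: 1. A point of $\mathcal X$ is singular if and only if it belongs to the $G$-orbit of one of $\xi_0,\xi_1,\xi_2$, and these three orbits are pairwise different. 2. For every word $w$ only finitely many of the numbers $T_{n,h}$ are non-zero, and there are real polynomials $C_0,C_1,C_2$, independent of $w$, such that for $C=C_0+C_1+C_2$, for all words $w$ and all real $t>0$ $$(t^{-8}+t^{-5}+t^{-2})\,(F_i(t)-C_i(t)\,|w|)\le 2F_{i-2}(t)\quad\text{for } i\in\{0,1,2\}\ (\text{indices modulo }3),$$ $$(t^{-8}+t^{-5}+t^{-2})\,(F(t)-C(t)\,|w|)\le 2F(t).$$ 3. $\gamma(R)\preceq\exp(R^{0.9181})$, i.e. there is a constant $C\ge1$ with $\gamma(R)\le\exp\big((CR)^{0.9181}\big)$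 for all $R\ge1$. -/

import Mathlib

open Filter Topology

namespace GoldenMean

/-! ### The golden mean shift and the twelve generators -/

/-- A sequence over `{0, 1}` (`false` is `0`, `true` is `1`) without two consecutive `1`s. -/
def Admissible (x : ℕ → Bool) : Prop := ∀ n, ¬(x n = true ∧ x (n + 1) = true)

/-- The golden mean shift, with the topology of pointwise convergence. -/
abbrev Shift : Type := {x : ℕ → Bool // Admissible x}

/-- The sequence `sx`: the letter `s` followed by the sequence `x`. -/
def cons (s : Bool) (x : ℕ → Bool) : ℕ → Bool
  | 0 => s
  | n + 1 => x n

/-- The sequence `x` with its first `k` letters deleted. -/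
def dropFirst (k : ℕ) (x : ℕ → Bool) : ℕ → Bool := fun n => x (n + k)

/-- The four kinds of generators. -/
inductive Kind
  | a | b | c | d
  deriving DecidableEq

/-- The transformations `a₀, b₀, c₀, d₀`. On sequences starting with `00` or `10`, the first letter
is changed by `a₀, b₀, c₀` and kept by `d₀`; on `010w` the transformation `a₀` is the identity, and
`b₀, c₀, d₀` act on `w` as `c₀, d₀, b₀` respectively. -/
def act₀ : Kind → (ℕ → Bool) → ℕ → Bool
  | .d, x, 0 => x 0
  | _, x, 0 => if x 0 = false ∧ x 1 = true then x 0 else !(x 0)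
  | _, x, 1 => x 1
  | _, x, 2 => x 2
  | .a, x, n + 3 => x (n + 3)
  | .b, x, n + 3 => if x 0 = false ∧ x 1 = true then act₀ .c (dropFirst 3 x) n else x (n + 3)
  | .c, x, n + 3 => if x 0 = false ∧ x 1 = true then act₀ .d (dropFirst 3 x) n else x (n + 3)
  | .d, x, n + 3 => if x 0 = false ∧ x 1 = true then act₀ .b (dropFirst 3 x) n else x (n + 3)

/-- A generator `(s, i)` stands for `s_i`, e.g. `(Kind.b, 2)` for `b₂`. -/
abbrev Gen : Type := Kind × Fin 3

/-- The transformation `s_i`: `s₁` maps `0w` to `0(w·s₀)` and fixes `10w`; `s₂` maps `10w` to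
`10(w·s₀)` and fixes `0w`. -/
def act : Gen → (ℕ → Bool) → ℕ → Bool
  | (s, 0), x => act₀ s x
  | (s, 1), x => if x 0 = false then cons (x 0) (act₀ s (dropFirst 1 x)) else x
  | (s, 2), x => if x 0 = false then x else cons (x 0) (cons (x 1) (act₀ s (dropFirst 2 x)))

/-! The defining recursion. -/

theorem act₀_swap (s : Kind) (hs : s ≠ .d) (t : Bool) (w : ℕ → Bool) :
    act₀ s (cons t (cons false w)) = cons (!t) (cons false w) := by
  funext n
  rcases n with _ | _ | _ | n <;> cases s <;> simp_all [act₀, cons]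

theorem act₀_d_fix (t : Bool) (w : ℕ → Bool) :
    act₀ .d (cons t (cons false w)) = cons t (cons false w) := by
  funext n
  rcases n with _ | _ | _ | n <;> simp [act₀, cons]

theorem act₀_a_fix (w : ℕ → Bool) :
    act₀ .a (cons false (cons true (cons false w))) = cons false (cons true (cons false w)) := by
  funext n
  rcases n with _ | _ | _ | n <;> simp [act₀, cons]

theorem act₀_b_rec (w : ℕ → Bool) :
    act₀ .b (cons false (cons true (cons false w))) =
      cons false (cons true (cons false (act₀ .c w))) := by
  funext n
  rcases n with _ | _ | _ | n <;> (simp [act₀, cons]; try rfl)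

theorem act₀_c_rec (w : ℕ → Bool) :
    act₀ .c (cons false (cons true (cons false w))) =
      cons false (cons true (cons false (act₀ .d w))) := by
  funext n
  rcases n with _ | _ | _ | n <;> (simp [act₀, cons]; try rfl)

theorem act₀_d_rec (w : ℕ → Bool) :
    act₀ .d (cons false (cons true (cons false w))) =
      cons false (cons true (cons false (act₀ .b w))) := by
  funext n
  rcases n with _ | _ | _ | n <;> (simp [act₀, cons]; try rfl)

theorem act_one_zero (s : Kind) (w : ℕ → Bool) :
    act (s, 1) (cons false w) = cons false (act₀ s w) := by
  simp [act, cons]; rfl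

theorem act_one_one (s : Kind) (w : ℕ → Bool) :
    act (s, 1) (cons true w) = cons true w := by
  simp [act, cons]

theorem act_two_zero (s : Kind) (w : ℕ → Bool) :
    act (s, 2) (cons false w) = cons false w := by
  simp [act, cons]

theorem act_two_one (s : Kind) (w : ℕ → Bool) :
    act (s, 2) (cons true (cons false w)) = cons true (cons false (act₀ s w)) := by
  simp [act, cons]; rfl

/-! The generators are involutions of the golden mean shift. -/

theorem Admissible.dropFirst {x : ℕ → Bool} (hx : Admissible x) (k : ℕ) :
    Admissible (dropFirst k x) := by
  intro n
  have := hx (n + k)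
  simpa [GoldenMean.dropFirst, Nat.add_right_comm] using this

theorem act₀_head (s : Kind) {x : ℕ → Bool} (hx : Admissible x) (h : act₀ s x 0 = true) :
    act₀ s x 1 = false := by
  have h0 := hx 0
  cases s <;> simp [act₀] at h ⊢ <;> grind

theorem admissible_act₀ (s : Kind) {x : ℕ → Bool} (hx : Admissible x) :
    Admissible (act₀ s x) := by
  intro n
  induction n using Nat.strong_induction_on generalizing s x with
  | _ n ih =>
    have h0 := hx 0
    have h1 := hx 1
    have h2 := hx 2
    rcases n with _ | _ | _ | n
    · have := act₀_head s hx
      grind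
    · cases s <;> simpa [act₀] using h1
    · cases s <;> simp [act₀] <;> grind
    · have hn := hx (n + 3)
      have hb := ih n (by omega) .b (hx.dropFirst 3)
      have hc := ih n (by omega) .c (hx.dropFirst 3)
      have hd := ih n (by omega) .d (hx.dropFirst 3)
      cases s <;> simp [act₀] <;> grind

theorem act₀_act₀ (s : Kind) (x : ℕ → Bool) (n : ℕ) (hx : Admissible x) :
    act₀ s (act₀ s x) n = x n := by
  induction n using Nat.strong_induction_on generalizing s x with
  | _ n ih =>
    have h0 := hx 0
    rcases n with _ | _ | _ | n
    · cases s <;> cases e0 : x 0 <;> cases e1 : x 1 <;> simp_all [act₀]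
    · cases s <;> simp [act₀]
    · cases s <;> simp [act₀]
    · have key : ∀ t, dropFirst 3 (act₀ s x) = act₀ t (dropFirst 3 x) →
          act₀ t (dropFirst 3 (act₀ s x)) n = x (n + 3) := by
        intro t ht
        rw [ht]
        exact ih n (by omega) t _ (hx.dropFirst 3)
      by_cases hp : x 0 = false ∧ x 1 = true
      · have hp0 : act₀ s x 0 = false := by cases s <;> simp [act₀, hp]
        have hp1 : act₀ s x 1 = true := by cases s <;> simp [act₀, hp]
        cases s
        · simp [act₀]
        · rw [act₀, if_pos ⟨hp0, hp1⟩]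
          exact key .c (by funext m; simp only [dropFirst, act₀, if_pos hp])
        · rw [act₀, if_pos ⟨hp0, hp1⟩]
          exact key .d (by funext m; simp only [dropFirst, act₀, if_pos hp])
        · rw [act₀, if_pos ⟨hp0, hp1⟩]
          exact key .b (by funext m; simp only [dropFirst, act₀, if_pos hp])
      · have hq : ¬(act₀ s x 0 = false ∧ act₀ s x 1 = true) := by
          cases s <;> simp [act₀] <;> grind
        cases s <;> simp only [act₀, if_neg hp] at hq ⊢ <;> simp_all

theorem admissible_cons {s : Bool} {x : ℕ → Bool} (hx : Admissible x)
    (h : ¬(s = true ∧ x 0 = true)) : Admissible (cons s x) := by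
  rintro (_ | n)
  · exact h
  · exact hx n

theorem admissible_act (g : Gen) {x : ℕ → Bool} (hx : Admissible x) : Admissible (act g x) := by
  have h0 := hx 0
  obtain ⟨s, i⟩ := g
  fin_cases i
  · exact admissible_act₀ s hx
  · simp only [act]
    split_ifs with h
    · exact admissible_cons (admissible_act₀ s (hx.dropFirst 1)) (by simp [h])
    · exact hx
  · simp only [act]
    split_ifs with h
    · exact hx
    · have h1 : x 1 = false := by grind
      exact admissible_cons (admissible_cons (admissible_act₀ s (hx.dropFirst 2)) (by simp [h1]))
        (by simp [cons, h1])

theorem act_act (g : Gen) {x : ℕ → Bool} (hx : Admissible x) : act g (act g x) = x := by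
  obtain ⟨s, i⟩ := g
  have e1 : ∀ (t : Bool) (y : ℕ → Bool), dropFirst 1 (cons t y) = y := fun _ _ => rfl
  have e2 : ∀ (t t' : Bool) (y : ℕ → Bool), dropFirst 2 (cons t (cons t' y)) = y :=
    fun _ _ _ => rfl
  fin_cases i
  · funext n
    exact act₀_act₀ s x n hx
  · by_cases h : x 0 = false
    · have : act (s, 1) x = cons (x 0) (act₀ s (dropFirst 1 x)) := by simp [act, h]
      change act (s, 1) (act (s, 1) x) = x
      rw [this, act, if_pos (by simpa [cons] using h), e1]
      funext n
      rcases n with _ | n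
      · rfl
      · exact act₀_act₀ s _ n (hx.dropFirst 1)
    · have : act (s, 1) x = x := by simp [act, h]
      change act (s, 1) (act (s, 1) x) = x
      rw [this, this]
  · by_cases h : x 0 = false
    · have : act (s, 2) x = x := by simp [act, h]
      change act (s, 2) (act (s, 2) x) = x
      rw [this, this]
    · have : act (s, 2) x = cons (x 0) (cons (x 1) (act₀ s (dropFirst 2 x))) := by simp [act, h]
      change act (s, 2) (act (s, 2) x) = x
      rw [this, act, if_neg (by simpa [cons] using h), e2]
      funext n
      rcases n with _ | _ | n
      · rfl
      · rfl
      · exact act₀_act₀ s _ n (hx.dropFirst 2)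

/-- The generator `g` as a permutation of the golden mean shift. -/
def gen (g : Gen) : Equiv.Perm Shift :=
  Function.Involutive.toPerm (fun x : Shift => ⟨act g x.1, admissible_act g x.2⟩)
    (fun x => Subtype.ext (act_act g x.2))

/-! ### The group and its growth -/

/-- The permutation `x ↦ x · s₁ s₂ ⋯ s_ℓ = (⋯((x · s₁) · s₂) ⋯) · s_ℓ` given by a word in the
generators, read from left to right (right action). -/
def wordPerm : List Gen → Equiv.Perm Shift
  | [] => Equiv.refl Shift
  | s :: w => (gen s).trans (wordPerm w)

/-- The fragmentation of the golden mean dihedral group: the group generated by the twelve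
involutions `a_i, b_i, c_i, d_i`. -/
def G : Subgroup (Equiv.Perm Shift) := Subgroup.closure (Set.range gen)

theorem wordPerm_append (u v : List Gen) : wordPerm (u ++ v) = wordPerm v * wordPerm u := by
  induction u with
  | nil => rfl
  | cons s u ih => rw [List.cons_append, wordPerm, ih]; rfl

theorem mem_G_iff (g : Equiv.Perm Shift) : g ∈ G ↔ ∃ w, wordPerm w = g := by
  constructor
  · intro hg
    induction hg using Subgroup.closure_induction with
    | mem g hg =>
      obtain ⟨s, rfl⟩ := hg
      exact ⟨[s], rfl⟩
    | one => exact ⟨[], rfl⟩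
    | mul g h _ _ ihg ihh =>
      obtain ⟨u, rfl⟩ := ihg
      obtain ⟨v, rfl⟩ := ihh
      exact ⟨v ++ u, wordPerm_append v u⟩
    | inv g _ ih =>
      obtain ⟨u, hu⟩ := ih
      subst hu
      refine ⟨u.reverse, ?_⟩
      rename_i hu
      clear hu
      rw [eq_inv_iff_mul_eq_one, ← wordPerm_append]
      induction u with
      | nil => rfl
      | cons s u ih =>
        have h : wordPerm (s :: (u ++ u.reverse) ++ [s]) = 1 := by
          rw [List.cons_append, wordPerm, wordPerm_append, ih]
          ext x
          exact congrArg (fun y : Shift => y.1 _) ((gen s).left_inv x)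
        simpa using h
  · rintro ⟨w, rfl⟩
    induction w with
    | nil => exact one_mem G
    | cons s w ih => exact mul_mem ih (Subgroup.subset_closure ⟨s, rfl⟩)

/-- The length `|g|`: the least `ℓ` such that `g` is a product of `ℓ` generators. (The generators
are involutions, so that the generating set is symmetric and every `g ∈ G` is such a product.) -/
noncomputable def wordLength (g : G) : ℕ :=
  sInf {l | ∃ w : List Gen, w.length = l ∧ wordPerm w = g}

/-- The growth function `γ(R)`: the number of elements of `G` of length at most `R`. -/
noncomputable def growth (R : ℝ) : ℕ := Set.ncard {g : G | (wordLength g : ℝ) ≤ R}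

/-- `f₁ ⪯ f₂`: there is `C ≥ 1` such that `f₁(R) ≤ f₂(CR)` for all `R ≥ 1`. -/
def GrowthLE (f₁ f₂ : ℝ → ℝ) : Prop :=
  ∃ C : ℝ, 1 ≤ C ∧ ∀ R : ℝ, 1 ≤ R → f₁ R ≤ f₂ (C * R)

/-! ### Singular points and graphs of germs -/

/-- The point `x` is singular: some element of `G` fixes `x` without being trivial near `x`. -/
def IsSingular (x : Shift) : Prop := ∃ g ∈ G, g x = x ∧ ¬ ∀ᶠ y in 𝓝 x, g y = y

/-- `x` and `y` lie in the same orbit of `G`. -/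
def SameOrbit (x y : Shift) : Prop := ∃ g ∈ G, g x = y

/-- The points `ξ₀ = (010)^∞`, `ξ₁ = (001)^∞`, `ξ₂ = (100)^∞`: the letter number `n` (counted from
`0`) of `ξ_i` is `1` exactly when `n ≡ i + 1` modulo `3`. -/
def xi (i : Fin 3) : Shift :=
  ⟨fun n => decide (n % 3 = (i.val + 1) % 3), by intro n; simp only [decide_eq_true_eq]; omega⟩

/-- The germ at `ξ_i` of the element of `G` given by a word. These germs are the vertices of the
graph of germs of `ξ_i`: two elements of `G` have the same germ exactly when they lie in the same
right coset of the group of elements that are trivial near `ξ_i`. -/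
def germ (i : Fin 3) (u : List Gen) : (𝓝 (xi i)).Germ Shift := ↑(wordPerm u : Shift → Shift)

/-- The end `v · s₁⋯s_ℓ` of the path in the graph of germs that starts in `v` and is labeled by the
word `s₁⋯s_ℓ`. -/
def walk {i : Fin 3} (v : (𝓝 (xi i)).Germ Shift) (u : List Gen) : (𝓝 (xi i)).Germ Shift :=
  v.map (wordPerm u)

/-! ### The segments `I_n` and the central parts of the graphs of germs -/

/-- `IsLabel m s`: the generator `s` is one of the labels of the multiple edge `e_m`. For
`m = 3k + i` these are `b_i, c_i` if `k ≡ 0`, `b_i, d_i` if `k ≡ 1` and `c_i, d_i` if `k ≡ 2`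
modulo `3`, and additionally `a_i` if `k = 0`. -/
def IsLabel (m : ℕ) (s : Gen) : Prop :=
  s.2.val = m % 3 ∧
    match s.1 with
    | .a => m / 3 = 0
    | .b => m / 3 % 3 ≠ 2
    | .c => m / 3 % 3 ≠ 1
    | .d => m / 3 % 3 ≠ 0

/-- The segment `I_n`, as the list of the indices `m` of its consecutive edges `e_m`:
`I₀` and `I₁` have length `0`, and `I_n = I_{n-2}⁻¹ e_{n-2} I_{n-1}⁻¹`. -/
def segment : ℕ → List ℕ
  | 0 => []
  | 1 => []
  | n + 2 => (segment n).reverse ++ n :: (segment (n + 1)).reverse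

/-- The residue `i` of `n = 3k + i` modulo `3`: the segment `I_n` sits at the left end of the
orbital graph of `ξ_i`. -/
def residue (n : ℕ) : Fin 3 := ⟨n % 3, Nat.mod_lt n (by norm_num)⟩

/-- The four copies of `I_n` in the graph of germs, labeled by `1, b_i, c_i, d_i`. -/
inductive Branch
  | one | b | c | d

/-- The element `1, b_i, c_i, d_i` labeling a branch, as a word. -/
def Branch.word (i : Fin 3) : Branch → List Gen
  | .one => []
  | .b => [(.b, i)]
  | .c => [(.c, i)]
  | .d => [(.d, i)]

/-- The vertices of the graph of germs of `ξ_i`, `i = n mod 3`, that are reached from the germ of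
`h ∈ {1, b_i, c_i, d_i}` along the edges listed in `p`, each of them under any of its labels. -/
def along (n : ℕ) (h : Branch) (p : List ℕ) : Set ((𝓝 (xi (residue n))).Germ Shift) :=
  {v | ∃ u : List Gen, List.Forall₂ IsLabel p u ∧ v = walk (germ (residue n) (h.word (residue n))) u}

/-- The vertices of the copy of `I_n` labeled `h`, attached by its left end to the germ of `h`. -/
def copyVertices (n : ℕ) (h : Branch) : Set ((𝓝 (xi (residue n))).Germ Shift) :=
  {v | ∃ p : List ℕ, p <+: segment n ∧ v ∈ along n h p}

/-- The far endpoint of the copy of `I_n` labeled `h` (a set with one element, as all labels of an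
edge of the segment lead to the same vertex). -/
def copyEnd (n : ℕ) (h : Branch) : Set ((𝓝 (xi (residue n))).Germ Shift) := along n h (segment n)

/-- The internal vertices of the central part of the graph of germs that is formed by the four
copies of `I_n`: all its vertices but the four far endpoints. -/
def internal (n : ℕ) : Set ((𝓝 (xi (residue n))).Germ Shift) :=
  (⋃ h, copyVertices n h) \ ⋃ h, copyEnd n h

/-! ### Traverses -/

/-- The word `u` leads from the far endpoint of the copy of `I_n` labeled `1` to the far endpoint of
the copy labeled `h`, and all vertices strictly between are internal vertices of the central part. -/
def IsTraverse (n : ℕ) (h : Branch) (u : List Gen) : Prop :=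
  ∃ v ∈ copyEnd n .one,
    (∀ q : List Gen, q <+: u → q ≠ [] → q ≠ u → walk v q ∈ internal n) ∧ walk v u ∈ copyEnd n h

/-- The number `T_{n,h}` of traverses for the word `w = s₁⋯s_ℓ`. A pair `p` with
`p.1 < p.2 ≤ ℓ` stands for the interval `[p.1 + 1, p.2]` of positions of `w`. -/
noncomputable def T (n : ℕ) (h : Branch) (w : List Gen) : ℕ :=
  Set.ncard {p : ℕ × ℕ | p.1 < p.2 ∧ p.2 ≤ w.length ∧
    IsTraverse n h ((w.drop p.1).take (p.2 - p.1))}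

/-- The number of traverses with exit in any of the branches `b_i, c_i, d_i`. -/
noncomputable def Ttotal (n : ℕ) (w : List Gen) : ℕ := T n .b w + T n .c w + T n .d w

/-- The generating function `F_i(t) = ∑_k (T_{3k+i,b_i} + T_{3k+i,c_i} + T_{3k+i,d_i}) t^{3k+i}`
of the word `w` (a sum with finitely many non-zero terms). -/
noncomputable def F (w : List Gen) (i : Fin 3) (t : ℝ) : ℝ :=
  ∑ᶠ k : ℕ, (Ttotal (3 * k + i.val) w : ℝ) * t ^ (3 * k + i.val)

end GoldenMean

namespace GoldenMean

/-! ### Prefixes of the singular points -/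

/-! Write `lpre m` for prefixing the first `m` letters of the singular point with residue `m % 3`.
The edge `e_m` joins `lpre m (00w)` to `lpre m (10w)`. Every point lies in the support of only two
of the three classes of generators, so orbital graphs look like lines in which the segments `I_n`
appear; `vert` is the coordinate along `I_n`. At `ξ_i` the germs of `1, b_i, c_i, d_i` form a Klein
four-group, and four copies of one infinite ray are attached to it. This graph is modelled by `Kind
× ℕ` with the step `mstep`, and `isTraverse_iff` turns traverses into the combinatorial condition
`Crosses`.

Generating functions. For `3 ≤ n ≤ m` with `m ≡ n` modulo 3, the segment `I_{m+2}` contains `I_n⁻¹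
e_m I_n`. Inside, this segment is the image of the central part of level `n` under a folding that
sends a branch to one side or the other according to a homomorphism from the four-group to `ℤ/2`
(`Bubble.step_proj`). A traverse of level `m + 2` with a nontrivial exit must reach the end of the
ray, so it crosses this segment, and the crossing lifts to a traverse of level `n` whose exit lies
outside the kernel. This assignment is injective, since words act on the model by permutations. For
`m = n, n + 3, n + 6` each of the three kernels occurs once, and a nontrivial element is outside
exactly two of them, whence `T_{n+2} + T_{n+5} + T_{n+8} ≤ 2 T_n` for the total numbers of traverses
(`Ttotal_add_le`). Multiplying by `t^n` and summing gives the inequality; the finitely many terms of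
low level are at most `|w|` times powers of `t` and go into the `C_i`.

Growth. At `t = 1.08` the factor exceeds 2, so `T_n = O(|w| / 1.08^n)`. Along orbits of points with
finitely many ones, stations `lpre n (0z)` mark the ends of copies of `I_{n+1}⁻¹ e I_{n+1}`. Regions
around them have length `O(2^n)` and finitely many types. Leaving a region from its central station
forces a traverse of level `n + 1` ending at that time. Hence a word of given length is determined
by a table of `O(2^n + T_{n+1})` runs, whose entries come from a set of size polynomial in `R`.
Balancing `2^n` against `R / 1.08^n` gives a table size `O(R^0.91)`, and the logarithm of the number
of possible entries is absorbed by the larger exponent.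

Singular points. Off the three orbits, a word changes only boundedly many initial letters near the
point, so if it fixes the point it is trivial nearby. At `ξ_i` the germ of `b_i` is nontrivial. All
of `G` preserves tails, and the three `ξ_i` have different tails. -/

theorem cons_succ (t : Bool) (w : ℕ → Bool) (n : ℕ) : cons t w (n + 1) = w n := rfl

/-- The sequence `010w`. -/
def block (w : ℕ → Bool) : ℕ → Bool := cons false (cons true (cons false w))

/-- The sequence `w` preceded by the first `n` letters of `ξ_{n mod 3}`. -/
def lpre : ℕ → (ℕ → Bool) → (ℕ → Bool)
  | 0, w => w
  | 1, w => cons false w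
  | 2, w => cons true (cons false w)
  | n + 3, w => lpre n (block w)

theorem lpre_apply_add (n : ℕ) (w : ℕ → Bool) (k : ℕ) : lpre n w (k + n) = w k := by
  induction n using Nat.strong_induction_on generalizing w k with
  | _ n ih =>
    rcases n with _ | _ | _ | n
    · rfl
    · rfl
    · rfl
    · have := ih n (by omega) (block w) (k + 3)
      rw [lpre, show k + (n + 3) = k + 3 + n by omega, this]
      rfl

theorem lpre_apply_lt (n : ℕ) (w : ℕ → Bool) (k : ℕ) (hk : k < n) :
    lpre n w k = decide (k % 3 = (n % 3 + 1) % 3) := by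
  induction n using Nat.strong_induction_on generalizing w k with
  | _ n ih =>
    rcases n with _ | _ | _ | n
    · omega
    · obtain rfl : k = 0 := by omega
      rfl
    · obtain rfl | rfl : k = 0 ∨ k = 1 := by omega
      · rfl
      · rfl
    · rw [lpre]
      by_cases h : k < n
      · rw [ih n (by omega) _ _ h, decide_eq_decide]
        omega
      · obtain ⟨j, rfl⟩ : ∃ j, k = j + n := ⟨k - n, by omega⟩
        rw [lpre_apply_add]
        obtain rfl | rfl | rfl : j = 0 ∨ j = 1 ∨ j = 2 := by omega
        · simp only [block, cons]; symm; rw [decide_eq_false_iff_not]; omega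
        · simp only [block, cons]; symm; rw [decide_eq_true_iff]; omega
        · simp only [block, cons]; symm; rw [decide_eq_false_iff_not]; omega

theorem dropFirst_lpre (n : ℕ) (w : ℕ → Bool) : dropFirst n (lpre n w) = w := by
  funext k
  exact lpre_apply_add n w k

theorem lpre_injective {n : ℕ} {w w' : ℕ → Bool} (h : lpre n w = lpre n w') : w = w' := by
  rw [← dropFirst_lpre n w, h, dropFirst_lpre]

theorem eq_lpre_of_agree {n : ℕ} {x : ℕ → Bool} (h : ∀ k < n, x k = decide (k % 3 = (n % 3 + 1) % 3)) :
    x = lpre n (dropFirst n x) := by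
  funext k
  by_cases hk : k < n
  · rw [lpre_apply_lt _ _ _ hk, h k hk]
  · obtain ⟨j, rfl⟩ : ∃ j, k = j + n := ⟨k - n, by omega⟩
    rw [lpre_apply_add]
    rfl

theorem admissible_block {w : ℕ → Bool} (hw : Admissible w) : Admissible (block w) :=
  admissible_cons (admissible_cons (admissible_cons hw (by simp)) (by simp [cons])) (by simp)

theorem admissible_lpre (n : ℕ) {w : ℕ → Bool} (hw : Admissible w) : Admissible (lpre n w) := by
  induction n using Nat.strong_induction_on generalizing w with
  | _ n ih =>
    rcases n with _ | _ | _ | n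
    · exact hw
    · exact admissible_cons hw (by simp)
    · exact admissible_cons (admissible_cons hw (by simp)) (by simp [cons])
    · exact ih n (by omega) (admissible_block hw)

/-- Blocks are inserted at the inner end of the prefix. Splitting off a multiple of three lets them
be peeled from the outside instead, which is how the recursion of the generators reads them. -/
theorem lpre_add_mul (n k : ℕ) (w : ℕ → Bool) : lpre (n + 3 * k) w = lpre n (lpre (3 * k) w) := by
  induction k generalizing w with
  | zero => rfl
  | succ k ih =>
    rw [show n + 3 * (k + 1) = n + 3 * k + 3 by ring, show 3 * (k + 1) = 3 * k + 3 by ring,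
      lpre, lpre, ih]

theorem lpre_three_mul_succ (k : ℕ) (w : ℕ → Bool) :
    lpre (3 * (k + 1)) w = block (lpre (3 * k) w) := by
  rw [show 3 * (k + 1) = 3 + 3 * k by ring, lpre_add_mul]
  rfl

/-! ### The Klein four-group `{1, b, c, d}`, with `a` in the role of the identity -/

/-- The product in the four-group, where `Kind.a` stands for the identity. -/
def kmul : Kind → Kind → Kind
  | .a, s => s
  | s, .a => s
  | .b, .b => .a
  | .c, .c => .a
  | .d, .d => .a
  | .b, .c => .d
  | .c, .b => .d
  | .b, .d => .c
  | .d, .b => .c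
  | .c, .d => .b
  | .d, .c => .b

/-- The cyclic rotation `b ↦ c ↦ d ↦ b`. -/
def rot : Kind → Kind
  | .a => .a
  | .b => .c
  | .c => .d
  | .d => .b

/-- Whether the element `h` of the four-group is not in the kernel of the `r`-th homomorphism to
`ℤ/2`; the kernels for `r = 0, 1, 2` are generated by `d, c, b`. -/
def lab : ℕ → Kind → Bool
  | _, .a => false
  | r, .b => r ≠ 2
  | r, .c => r ≠ 1
  | r, .d => r ≠ 0

theorem kmul_assoc (g h k : Kind) : kmul (kmul g h) k = kmul g (kmul h k) := by
  cases g <;> cases h <;> cases k <;> rfl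

theorem kmul_self (g : Kind) : kmul g g = .a := by cases g <;> rfl

theorem kmul_a (g : Kind) : kmul g .a = g := by cases g <;> rfl

theorem a_kmul (g : Kind) : kmul .a g = g := by cases g <;> rfl

theorem rot_kmul (g h : Kind) : rot (kmul g h) = kmul (rot g) (rot h) := by
  cases g <;> cases h <;> rfl

theorem rot_iterate_kmul (k : ℕ) (g h : Kind) :
    rot^[k] (kmul g h) = kmul (rot^[k] g) (rot^[k] h) := by
  induction k generalizing g h with
  | zero => rfl
  | succ k ih => simp only [Function.iterate_succ, Function.comp, rot_kmul, ih]

theorem rot_injective : Function.Injective rot := by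
  intro g h
  cases g <;> cases h <;> simp [rot]

theorem lab_kmul {r : ℕ} (hr : r < 3) (g h : Kind) :
    lab r (kmul g h) = xor (lab r g) (lab r h) := by
  interval_cases r <;> cases g <;> cases h <;> rfl

/-- Each block rotates the kind once, and `b`, `c` are the kinds that toggle the first letter of
`t0w`. This is why the labels of `e_m` have period 3 in `m / 3`. -/
theorem rot_iterate_toggles (k : ℕ) (s : Kind) :
    (rot^[k] s = .b ∨ rot^[k] s = .c) ↔ lab (k % 3) s = true := by
  induction k generalizing s with
  | zero => cases s <;> simp [lab]
  | succ k ih =>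
    rw [Function.iterate_succ, Function.comp, ih]
    have : k % 3 = 0 ∧ (k + 1) % 3 = 1 ∨ k % 3 = 1 ∧ (k + 1) % 3 = 2 ∨
      k % 3 = 2 ∧ (k + 1) % 3 = 0 := by omega
    rcases this with ⟨h, h'⟩ | ⟨h, h'⟩ | ⟨h, h'⟩ <;> rw [h, h'] <;> cases s <;> simp [lab, rot]

/-- The action of the four-group: `a` acts trivially, `b, c, d` act as `b₀, c₀, d₀`. -/
def vact : Kind → (ℕ → Bool) → (ℕ → Bool)
  | .a, x => x
  | s, x => act₀ s x

theorem vact_block (s : Kind) (w : ℕ → Bool) : vact s (block w) = block (vact (rot s) w) := by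
  cases s
  · rfl
  · exact act₀_b_rec w
  · exact act₀_c_rec w
  · exact act₀_d_rec w

theorem act₀_block (s : Kind) (w : ℕ → Bool) : act₀ s (block w) = vact s (block w) := by
  cases s
  · exact act₀_a_fix w
  all_goals rfl

theorem vact_lpre (s : Kind) (k : ℕ) (w : ℕ → Bool) :
    vact s (lpre (3 * k) w) = lpre (3 * k) (vact (rot^[k] s) w) := by
  induction k generalizing s with
  | zero => rfl
  | succ k ih =>
    rw [lpre_three_mul_succ, lpre_three_mul_succ, vact_block, ih, Function.iterate_succ,
      Function.comp]

theorem vact_cons_false (s : Kind) (t : Bool) (w : ℕ → Bool) :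
    vact s (cons t (cons false w)) =
      if s = .b ∨ s = .c then cons (!t) (cons false w) else cons t (cons false w) := by
  cases s
  · rfl
  · exact act₀_swap .b (by decide) t w
  · exact act₀_swap .c (by decide) t w
  · exact act₀_d_fix t w

/-! ### Regular points -/

theorem exists_eq_cons_cons {x : ℕ → Bool} (hx : Admissible x)
    (h : ¬(x 0 = false ∧ x 1 = true)) :
    x = cons (x 0) (cons false (dropFirst 2 x)) := by
  have h0 := hx 0
  funext n
  rcases n with _ | _ | n
  · rfl
  · simp only [cons]
    grind
  · rfl

theorem exists_eq_block {x : ℕ → Bool} (hx : Admissible x) (h : x 0 = false ∧ x 1 = true) :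
    x = block (dropFirst 3 x) := by
  have h1 := hx 1
  funext n
  rcases n with _ | _ | _ | n
  · exact h.1
  · exact h.2
  · simp only [block, cons]
    grind
  · rfl

theorem exists_eq_lpre_of_not {x : ℕ → Bool} (hx : Admissible x) {k : ℕ}
    (h : ¬(x (3 * k) = false ∧ x (3 * k + 1) = true)) :
    ∃ k t w, x = lpre (3 * k) (cons t (cons false w)) := by
  induction k generalizing x with
  | zero => exact ⟨0, x 0, _, exists_eq_cons_cons hx h⟩
  | succ k ih =>
    by_cases h0 : x 0 = false ∧ x 1 = true
    · obtain ⟨k', t, w, hw⟩ := ih (hx.dropFirst 3) (by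
        simpa [GoldenMean.dropFirst, mul_add, Nat.add_right_comm] using h)
      refine ⟨k' + 1, t, w, ?_⟩
      rw [lpre_three_mul_succ, ← hw]
      exact exists_eq_block hx h0
    · exact ⟨0, x 0, _, exists_eq_cons_cons hx h0⟩

/-- Strip blocks `010` until this is impossible; only `ξ_0` allows it forever. On the first
alternative the four-group toggles a single letter, on the second it acts trivially. -/
theorem exists_eq_lpre_or_eq_xi {x : ℕ → Bool} (hx : Admissible x) :
    (∃ k t w, x = lpre (3 * k) (cons t (cons false w))) ∨ x = (xi 0).1 := by
  by_cases h : ∃ k, ¬(x (3 * k) = false ∧ x (3 * k + 1) = true)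
  · exact Or.inl (exists_eq_lpre_of_not hx h.choose_spec)
  · right
    push Not at h
    funext n
    obtain ⟨k, r, hr, rfl⟩ : ∃ k r, r < 3 ∧ n = 3 * k + r :=
      ⟨n / 3, n % 3, Nat.mod_lt _ (by norm_num), by omega⟩
    have hk := h k
    have := hx (3 * k + 1)
    interval_cases r
    · simp [xi, hk]
    · simp only [xi, hk]; symm; rw [decide_eq_true_iff]; simp
    · simp only [xi]
      have : x (3 * k + 2) = false := by grind
      rw [this]; symm; rw [decide_eq_false_iff_not]; simp

theorem lpre_dropFirst_xi (i : Fin 3) (n : ℕ) (hn : n % 3 = i) :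
    lpre n (dropFirst n (xi i).1) = (xi i).1 := by
  symm
  apply eq_lpre_of_agree
  intro k _
  simp [xi, hn]

theorem dropFirst_xi (i : Fin 3) (n : ℕ) (hn : n % 3 = i) : dropFirst n (xi i).1 = (xi 0).1 := by
  funext k
  simp only [dropFirst, xi, decide_eq_decide]
  simp
  omega

theorem lpre_xi_zero (i : Fin 3) (n : ℕ) (hn : n % 3 = i) : lpre n (xi 0).1 = (xi i).1 := by
  rw [← dropFirst_xi i n hn, lpre_dropFirst_xi i n hn]

/-- The first `n + 1` blocks cover the letter `n`, and the action passes through them to the tail.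
-/
theorem vact_xi (s : Kind) : vact s (xi 0).1 = (xi 0).1 := by
  funext n
  have h := lpre_xi_zero 0 (3 * (n + 1)) (by simp)
  rw [← h, vact_lpre, lpre_apply_lt _ _ _ (by omega), lpre_apply_lt _ _ _ (by omega)]

/-- Outside `ξ_0` each element toggles or keeps the same letter, so the group law can be checked on
one letter after rotation of the kinds. -/
theorem vact_vact (s h : Kind) {x : ℕ → Bool} (hx : Admissible x) :
    vact s (vact h x) = vact (kmul h s) x := by
  rcases exists_eq_lpre_or_eq_xi hx with ⟨k, t, w, rfl⟩ | rfl
  · simp only [vact_lpre, rot_iterate_kmul]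
    congr 1
    generalize rot^[k] s = s
    generalize rot^[k] h = h
    cases s <;> cases h <;> simp [vact_cons_false, kmul]
  · simp only [vact_xi]

/-! ### Edges of the orbital graphs -/

theorem act_lpre_fin (s : Kind) (i : Fin 3) (x : ℕ → Bool) :
    act (s, i) (lpre i x) = lpre i (act₀ s x) := by
  fin_cases i
  · rfl
  · exact act_one_zero s x
  · exact act_two_one s x

theorem lpre_decomp (n : ℕ) (w : ℕ → Bool) : lpre n w = lpre (n % 3) (lpre (3 * (n / 3)) w) := by
  rw [← lpre_add_mul, Nat.mod_add_div]

/-- The bound `3 ≤ n` supplies one block, on which `a` is trivial; therefore `a` may play the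
identity of the four-group from there on. -/
theorem act_lpre (s : Gen) {n : ℕ} (hn : 3 ≤ n) (hs : s.2.val = n % 3) (w : ℕ → Bool) :
    act s (lpre n w) = lpre n (vact (rot^[n / 3] s.1) w) := by
  obtain ⟨s, i⟩ := s
  simp only at hs
  rw [lpre_decomp n w, ← hs, act_lpre_fin, lpre_decomp n, ← hs, ← vact_lpre]
  obtain ⟨k, hk⟩ : ∃ k, n / 3 = k + 1 := ⟨n / 3 - 1, by omega⟩
  rw [hk, lpre_three_mul_succ, act₀_block]

theorem isLabel_iff {m : ℕ} (hm : 3 ≤ m) (s : Gen) :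
    IsLabel m s ↔ s.2.val = m % 3 ∧ lab (m / 3 % 3) s.1 = true := by
  obtain ⟨s, i⟩ := s
  have : m / 3 ≠ 0 := by omega
  cases s <;> simp [IsLabel, lab]
  omega

-- For `m < 3` no block precedes the toggled letter, so `a` toggles it too. This is the source of
-- the additional label of the first three edges.
open Classical in
theorem act_lpre_cons (s : Gen) {m : ℕ} (hs : s.2.val = m % 3) (t : Bool) (w : ℕ → Bool) :
    act s (lpre m (cons t (cons false w))) =
      if IsLabel m s then lpre m (cons (!t) (cons false w))
      else lpre m (cons t (cons false w)) := by
  by_cases hm : 3 ≤ m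
  · rw [act_lpre s hm hs, vact_cons_false]
    simp only [rot_iterate_toggles, isLabel_iff hm, hs, true_and]
    split_ifs <;> rfl
  · obtain ⟨s, i⟩ := s
    simp only at hs
    have hm' : m = i := by omega
    subst hm'
    rw [act_lpre_fin]
    have h3 : (i : ℕ) / 3 = 0 := by omega
    cases s
    case d => simp [IsLabel, h3, act₀_d_fix]
    all_goals rw [act₀_swap _ (by decide)]; simp [IsLabel, h3]; omega

/-- The edge `e_m` connects `x` and `y`. -/
def Edge (m : ℕ) (x y : ℕ → Bool) : Prop :=
  ∃ t w, x = lpre m (cons t (cons false w)) ∧ y = lpre m (cons (!t) (cons false w))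

theorem Edge.symm {m : ℕ} {x y : ℕ → Bool} (h : Edge m x y) : Edge m y x := by
  obtain ⟨t, w, rfl, rfl⟩ := h
  exact ⟨!t, w, rfl, by simp⟩

theorem Edge.act_of_isLabel {m : ℕ} {x y : ℕ → Bool} (h : Edge m x y) {s : Gen}
    (hs : IsLabel m s) : act s x = y := by
  obtain ⟨t, w, rfl, rfl⟩ := h
  rw [act_lpre_cons s hs.1, if_pos hs]

theorem Edge.act_of_not_isLabel {m : ℕ} {x y : ℕ → Bool} (h : Edge m x y) {s : Gen}
    (hs : s.2.val = m % 3) (hs' : ¬IsLabel m s) : act s x = x := by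
  obtain ⟨t, w, rfl, rfl⟩ := h
  rw [act_lpre_cons s hs, if_neg hs']

/-- The point `x` is in the support of the generators with index `i`. -/
def InClass (i : ℕ) (x : ℕ → Bool) : Prop := (i = 1 → x 0 = false) ∧ (i = 2 → x 0 = true)

theorem inClass_lpre (n : ℕ) (w : ℕ → Bool) : InClass (n % 3) (lpre n w) := by
  constructor
  · intro h
    rw [lpre_apply_lt _ _ _ (by omega), h]
    rfl
  · intro h
    rw [lpre_apply_lt _ _ _ (by omega), h]
    rfl

theorem Edge.inClass {m : ℕ} {x y : ℕ → Bool} (h : Edge m x y) : InClass (m % 3) x := by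
  obtain ⟨t, w, rfl, rfl⟩ := h
  exact inClass_lpre m _

theorem act_of_not_inClass {s : Gen} {x : ℕ → Bool} (h : ¬InClass s.2.val x) : act s x = x := by
  obtain ⟨s, i⟩ := s
  fin_cases i
  · exact (h ⟨by simp, by simp⟩).elim
  · have : ¬ (x 0 = false) := fun h0 => h ⟨fun _ => h0, by simp⟩
    simp [act, this]
  · have : x 0 = false := by
      by_contra h0
      exact h ⟨by simp, fun _ => by simpa using h0⟩
    simp [act, this]

/-- Class 0 contains every point, and classes 1 and 2 are complementary. A point is thus in exactly
two classes, and the edges of these classes describe the whole action of the generators there. -/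
theorem act_of_inClass_of_ne {s : Gen} {x : ℕ → Bool} {i j : ℕ} (hi : InClass i x)
    (hj : InClass j x) (hij : i ≠ j) (hi3 : i < 3) (hj3 : j < 3) (hsi : s.2.val ≠ i)
    (hsj : s.2.val ≠ j) : act s x = x := by
  apply act_of_not_inClass
  intro hs
  have := s.2.isLt
  unfold InClass at *
  generalize s.2.val = k at *
  interval_cases i <;> interval_cases j <;> interval_cases k <;> simp_all

/-- The word `u` acts on sequences from the right. -/
def wact (u : List Gen) (x : ℕ → Bool) : ℕ → Bool := u.foldl (fun y s => act s y) x

theorem wact_append (u v : List Gen) (x : ℕ → Bool) : wact (u ++ v) x = wact v (wact u x) :=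
  List.foldl_append

theorem wordPerm_apply (u : List Gen) (x : Shift) : (wordPerm u x).1 = wact u x.1 := by
  induction u generalizing x with
  | nil => rfl
  | cons s u ih => exact ih (gen s x)

/-! ### The segments `I_n` and their vertices -/

/-- The number of edges of the segment `I_n`. -/
def len (n : ℕ) : ℕ := (segment n).length

/-- The index of the edge number `j` of the segment `I_n`. -/
def sg (n j : ℕ) : ℕ := (segment n).getD j 0

theorem len_add_two (n : ℕ) : len (n + 2) = len n + 1 + len (n + 1) := by
  simp [len, segment]
  omega

theorem len_le_succ (n : ℕ) : len n ≤ len (n + 1) := by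
  rcases n with _ | n
  · simp [len, segment]
  · rw [len_add_two]
    omega

theorem len_mono : Monotone len := monotone_nat_of_le_succ len_le_succ

theorem le_len_add_one (n : ℕ) : n ≤ len n + 1 := by
  induction n using Nat.strong_induction_on with
  | _ n ih =>
    rcases n with _ | _ | n
    · omega
    · omega
    · have := ih (n + 1) (by omega)
      rw [len_add_two]
      omega

theorem len_lt_two_pow (n : ℕ) : len n < 2 ^ n := by
  induction n using Nat.strong_induction_on with
  | _ n ih =>
    rcases n with _ | _ | n
    · simp [len, segment]
    · simp [len, segment]
    · have h1 := ih (n + 1) (by omega)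
      have h0 := ih n (by omega)
      rw [len_add_two]
      have : 2 ^ (n + 1) = 2 * 2 ^ n := by ring
      have : 2 ^ (n + 2) = 4 * 2 ^ n := by ring
      omega

theorem sg_add_two_of_lt {n j : ℕ} (hj : j < len n) : sg (n + 2) j = sg n (len n - 1 - j) := by
  have : j < (segment n).reverse.length := by simpa [len] using hj
  have h2 : (segment n).length - 1 - j < (segment n).length := by simp [len] at *; omega
  simp only [sg, segment, len] at *
  rw [List.getD_append _ _ _ _ this, List.getD_eq_getElem _ _ this, List.getElem_reverse,
    List.getD_eq_getElem _ _ h2]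

theorem sg_add_two_len (n : ℕ) : sg (n + 2) (len n) = n := by
  simp [sg, segment, len]

theorem sg_add_two_of_gt {n k : ℕ} (hk : k < len (n + 1)) :
    sg (n + 2) (len n + 1 + k) = sg (n + 1) (len (n + 1) - 1 - k) := by
  have : k < (segment (n + 1)).reverse.length := by simpa [len] using hk
  have h2 : (segment (n + 1)).length - 1 - k < (segment (n + 1)).length := by
    simp only [len] at hk; omega
  simp only [sg, segment, len] at *
  rw [List.getD_append_right _ _ _ _ (by simp; omega),
    show (segment n).length + 1 + k - (segment n).reverse.length = k + 1 by simp; omega,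
    List.getD_cons_succ, List.getD_eq_getElem _ _ this, List.getElem_reverse,
    List.getD_eq_getElem _ _ h2]

theorem sg_cases {n j : ℕ} (hj : j < len (n + 2)) :
    j < len n ∨ j = len n ∨ ∃ k < len (n + 1), j = len n + 1 + k := by
  rw [len_add_two] at hj
  rcases lt_trichotomy j (len n) with h | h | h
  · exact Or.inl h
  · exact Or.inr (Or.inl h)
  · exact Or.inr (Or.inr ⟨j - len n - 1, by omega, by omega⟩)

/-- The excluded residues belong to the edges that prolong `I_n`: class `n` at the near end and
`e_{n-1}` at the far end. The reversals in the recursion carry one condition into the other. -/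
theorem sg_ends (n : ℕ) (hn : 0 < len n) :
    sg n 0 % 3 ≠ n % 3 ∧ sg n (len n - 1) % 3 ≠ (n + 2) % 3 := by
  induction n using Nat.strong_induction_on with
  | _ n ih =>
    rcases n with _ | _ | n
    · simp [len, segment] at hn
    · simp [len, segment] at hn
    constructor
    · by_cases h : 0 < len n
      · rw [sg_add_two_of_lt h]
        exact (ih n (by omega) h).2
      · have := sg_add_two_len n
        rw [show len n = 0 by omega] at this
        rw [this]
        omega
    · by_cases h : 0 < len (n + 1)
      · rw [show len (n + 2) - 1 = len n + 1 + (len (n + 1) - 1) by rw [len_add_two]; omega,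
          sg_add_two_of_gt (by omega), Nat.sub_self]
        have := (ih (n + 1) (by omega) h).1
        omega
      · rw [show len (n + 2) - 1 = len n by rw [len_add_two]; omega, sg_add_two_len]
        omega

theorem sg_succ_ne {n j : ℕ} (hj : j + 1 < len n) : sg n j % 3 ≠ sg n (j + 1) % 3 := by
  induction n using Nat.strong_induction_on generalizing j with
  | _ n ih =>
    rcases n with _ | _ | n
    · simp [len, segment] at hj
    · simp [len, segment] at hj
    have hj0 : j < len (n + 2) := Nat.lt_of_succ_lt hj
    rcases sg_cases hj0 with h | h | ⟨k, hk, rfl⟩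
    · rw [sg_add_two_of_lt h]
      by_cases h' : j + 1 < len n
      · rw [sg_add_two_of_lt h']
        have := ih n (by omega) (j := len n - 1 - (j + 1)) (by omega)
        rw [show len n - 1 - (j + 1) + 1 = len n - 1 - j by omega] at this
        exact this.symm
      · rw [show j + 1 = len n by omega, sg_add_two_len, show len n - 1 - j = 0 by omega]
        exact (sg_ends n (by omega)).1
    · subst h
      rw [sg_add_two_len]
      rw [len_add_two] at hj
      have := sg_add_two_of_gt (n := n) (k := 0) (by omega)
      rw [add_zero, Nat.sub_zero] at this
      rw [this]
      have := (sg_ends (n + 1) (by omega)).2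
      omega
    · rw [len_add_two] at hj
      rw [sg_add_two_of_gt hk, show len n + 1 + k + 1 = len n + 1 + (k + 1) by ring,
        sg_add_two_of_gt (by omega)]
      have := ih (n + 1) (by omega) (j := len (n + 1) - 1 - (k + 1)) (by omega)
      rw [show len (n + 1) - 1 - (k + 1) + 1 = len (n + 1) - 1 - k by omega] at this
      exact this.symm

/-- Reversing twice shows that `I_{n+3}` starts with `I_n`, which makes the segments of one residue
converge to an infinite ray. -/
theorem sg_add_three {n j : ℕ} (hj : j < len n) : sg (n + 3) j = sg n j := by
  rcases n with _ | n
  · simp [len, segment] at hj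
  have h : len (n + 1 + 1) = len n + 1 + len (n + 1) := len_add_two n
  rw [sg_add_two_of_lt (n := n + 1 + 1) (by omega),
    show len (n + 1 + 1) - 1 - j = len n + 1 + (len (n + 1) - 1 - j) by omega,
    sg_add_two_of_gt (by omega)]
  congr 1
  omega

theorem sg_add_mul {n j : ℕ} (k : ℕ) (hj : j < len n) : sg (n + 3 * k) j = sg n j := by
  induction k with
  | zero => rfl
  | succ k ih =>
    rw [show n + 3 * (k + 1) = n + 3 * k + 3 by ring,
      sg_add_three (hj.trans_le (len_mono (by omega))), ih]

theorem sg_eq_of_mod {n m j : ℕ} (h : n % 3 = m % 3) (hn : j < len n) (hm : j < len m) :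
    sg n j = sg m j := by
  rcases le_total n m with h' | h'
  · obtain ⟨k, rfl⟩ : ∃ k, m = n + 3 * k := ⟨(m - n) / 3, by omega⟩
    rw [sg_add_mul k hn]
  · obtain ⟨k, rfl⟩ : ∃ k, n = m + 3 * k := ⟨(n - m) / 3, by omega⟩
    rw [sg_add_mul k hm]

/-- The index of the edge number `j` of the infinite ray that starts in `ξ_i`. -/
def lam (i j : ℕ) : ℕ := sg (i + 3 * (j + 1)) j

/-- The level in the definition of `lam` is large enough to contain the edge `j`, so the default
value of `getD` is never used, and nested segments carry the same labels. -/
theorem lam_mod {n j : ℕ} (hj : j < len n) : lam (n % 3) j = sg n j := by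
  have := le_len_add_one (n % 3 + 3 * (j + 1))
  exact sg_eq_of_mod (by omega) (by omega) hj

theorem lam_zero_ne (n : ℕ) : lam (n % 3) 0 % 3 ≠ n % 3 := by
  have := (sg_ends (n % 3 + 3 * (0 + 1)) (by
    have := le_len_add_one (n % 3 + 3 * (0 + 1)); omega)).1
  rw [lam]
  omega

theorem lam_succ_ne (n j : ℕ) : lam (n % 3) j % 3 ≠ lam (n % 3) (j + 1) % 3 := by
  have h := le_len_add_one (n % 3 + 3 * (j + 2))
  have h1 : (n % 3 + 3 * (j + 2)) % 3 = n % 3 := by omega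
  have := sg_succ_ne (n := n % 3 + 3 * (j + 2)) (j := j) (by omega)
  rwa [← lam_mod (by omega), ← lam_mod (by omega), h1] at this

/-- The piece after `e_m` in `I_{m+2}` is `I_{m+1}⁻¹`, which itself starts with `I_m`. Together with
`I_m⁻¹` before `e_m` this makes both sides of `e_m` look like the beginning of a ray. -/
theorem sg_bubble_right {n m k : ℕ} (hn : 1 ≤ n) (hnm : n ≤ m) (h : m % 3 = n % 3)
    (hk : k < len n) : sg (m + 2) (len m + 1 + k) = lam (n % 3) k := by
  obtain ⟨m, rfl⟩ : ∃ m', m = m' + 1 := ⟨m - 1, by omega⟩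
  have hl := len_mono hnm
  have h2 : len (m + 1 + 1) = len m + 1 + len (m + 1) := len_add_two m
  rw [sg_add_two_of_gt (by rw [h2]; omega),
    show len (m + 1 + 1) - 1 - k = len m + 1 + (len (m + 1) - 1 - k) by rw [h2]; omega,
    sg_add_two_of_gt (by omega), show len (m + 1) - 1 - (len (m + 1) - 1 - k) = k by omega,
    ← lam_mod (by omega), h]

theorem sg_bubble_left {n m k : ℕ} (hnm : n ≤ m) (h : m % 3 = n % 3)
    (hk : k < len n) : sg (m + 2) (len m - 1 - k) = lam (n % 3) k := by
  have hl := len_mono hnm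
  rw [sg_add_two_of_lt (by omega), show len m - 1 - (len m - 1 - k) = k by omega,
    ← lam_mod (by omega), h]

/-! The vertices of the segments -/

/-- The vertex number `j` of the segment `I_n`, with tail `w`. -/
def vert : ℕ → ℕ → (ℕ → Bool) → (ℕ → Bool)
  | 0, _, w => w
  | 1, _, w => cons false w
  | n + 2, j, w =>
    if j ≤ len n then vert n (len n - j) (cons true (cons false w))
    else vert (n + 1) (len (n + 1) - (j - len n - 1)) (cons false w)

theorem vert_ends (n : ℕ) (w : ℕ → Bool) :
    vert n 0 w = lpre n w ∧ vert (n + 1) (len (n + 1)) w = lpre n (cons false w) := by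
  induction n using Nat.strong_induction_on generalizing w with
  | _ n ih =>
    rcases n with _ | _ | n
    · exact ⟨rfl, rfl⟩
    · refine ⟨rfl, ?_⟩
      rw [vert, if_neg (by rw [len_add_two]; omega)]
      rfl
    · constructor
      · rw [vert, if_pos (Nat.zero_le _)]
        rcases n with _ | n
        · rfl
        · exact (ih n (by omega) _).2
      · rw [vert, if_neg (by rw [len_add_two (n + 1)]; omega),
          show len (n + 1 + 1) - (len (n + 1 + 2) - len (n + 1) - 1) = 0 by
            rw [len_add_two (n + 1)]; omega, vert, if_pos (Nat.zero_le _)]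
        rcases n with _ | n
        · rfl
        · exact (ih n (by omega) _).2

theorem vert_zero (n : ℕ) (w : ℕ → Bool) : vert n 0 w = lpre n w := (vert_ends n w).1

theorem vert_len (n : ℕ) (w : ℕ → Bool) :
    vert (n + 1) (len (n + 1)) w = lpre n (cons false w) := (vert_ends n w).2

theorem vert_add_two_left {n j : ℕ} (hj : j ≤ len n) (w : ℕ → Bool) :
    vert (n + 2) j w = vert n (len n - j) (cons true (cons false w)) := by
  rw [vert, if_pos hj]

theorem vert_add_two_right {n k : ℕ} (w : ℕ → Bool) :
    vert (n + 2) (len n + 1 + k) w = vert (n + 1) (len (n + 1) - k) (cons false w) := by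
  rw [vert, if_neg (by omega)]
  congr 1
  omega

/-- Where the two reversed pieces meet, the vertices are `lpre n (10w)` and `lpre n (00w)`, the ends
of `e_n`; elsewhere the edges are inherited from the pieces. -/
theorem edge_vert {n j : ℕ} (hj : j < len n) (w : ℕ → Bool) :
    Edge (sg n j) (vert n j w) (vert n (j + 1) w) := by
  induction n using Nat.strong_induction_on generalizing j w with
  | _ n ih =>
    rcases n with _ | _ | n
    · simp [len, segment] at hj
    · simp [len, segment] at hj
    rcases sg_cases hj with h | h | ⟨k, hk, rfl⟩
    · rw [sg_add_two_of_lt h, vert_add_two_left h.le, vert_add_two_left (by omega)]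
      have := (ih n (by omega) (j := len n - 1 - j) (by omega) (cons true (cons false w))).symm
      rw [show len n - 1 - j + 1 = len n - j by omega] at this
      rwa [show len n - (j + 1) = len n - 1 - j by omega]
    · subst h
      rw [sg_add_two_len, vert_add_two_left le_rfl, Nat.sub_self, vert_zero]
      have := vert_add_two_right (n := n) (k := 0) w
      rw [add_zero, Nat.sub_zero, vert_len] at this
      rw [this]
      exact ⟨true, w, rfl, rfl⟩
    · rw [sg_add_two_of_gt hk, show len n + 1 + k + 1 = len n + 1 + (k + 1) by ring,
        vert_add_two_right, vert_add_two_right]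
      have := (ih (n + 1) (by omega) (j := len (n + 1) - 1 - k) (by omega) (cons false w)).symm
      rw [show len (n + 1) - 1 - k + 1 = len (n + 1) - k by omega] at this
      rwa [show len (n + 1) - (k + 1) = len (n + 1) - 1 - k by omega]

theorem vert_apply_add (n j : ℕ) (w : ℕ → Bool) (k : ℕ) : vert n j w (k + n) = w k := by
  induction n using Nat.strong_induction_on generalizing j w k with
  | _ n ih =>
    rcases n with _ | _ | n
    · rfl
    · rfl
    · rw [vert]
      split_ifs
      · rw [show k + (n + 2) = k + 2 + n by ring, ih n (by omega)]
        rfl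
      · rw [show k + (n + 2) = k + 1 + (n + 1) by ring, ih (n + 1) (by omega)]
        rfl

theorem vert_apply_pred (n j : ℕ) (w : ℕ → Bool) : vert (n + 1) j w n = false := by
  rcases n with _ | n
  · rfl
  · rw [vert]
    split_ifs
    · have := vert_apply_add n (len n - j) (cons true (cons false w)) 1
      rw [add_comm n 1, this]
      rfl
    · have := vert_apply_add (n + 1) (len (n + 1) - (j - len n - 1)) (cons false w) 0
      rw [zero_add] at this
      rw [this]
      rfl

/-- The letter number `n` of a vertex of `I_{n+2}` tells which of the two pieces contains it. -/
theorem vert_left_injective {n j j' : ℕ} {w : ℕ → Bool} (hj : j ≤ len n) (hj' : j' ≤ len n)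
    (h : vert n j w = vert n j' w) : j = j' := by
  induction n using Nat.strong_induction_on generalizing j j' w with
  | _ n ih =>
    rcases n with _ | _ | n
    · simp [len, segment] at hj hj'
      omega
    · simp [len, segment] at hj hj'
      omega
    have hl (i : ℕ) : i ≤ len n → vert (n + 2) i w n = true := by
      intro hi
      rw [vert_add_two_left hi]
      have := vert_apply_add n (len n - i) (cons true (cons false w)) 0
      rwa [zero_add] at this
    have hr (i : ℕ) : ¬i ≤ len n → vert (n + 2) i w n = false := by
      intro hi
      rw [vert, if_neg hi, vert_apply_pred]
    rw [len_add_two] at hj hj'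
    by_cases h1 : j ≤ len n <;> by_cases h2 : j' ≤ len n
    · rw [vert_add_two_left h1, vert_add_two_left h2] at h
      have := ih n (by omega) (by omega) (by omega) h
      omega
    · have := hr j' h2
      rw [← h, hl j h1] at this
      exact absurd this (by simp)
    · have := hr j h1
      rw [h, hl j' h2] at this
      exact absurd this (by simp)
    · rw [vert, if_neg h1, vert, if_neg h2] at h
      have := ih (n + 1) (by omega) (by omega) (by omega) h
      omega

/-- The letter before the final `0` of the prefix selects the piece of the segment, so the vertices
of `I_{n+1}` exhaust the admissible prefixes ending in `0`. -/
theorem exists_vert {n : ℕ} {x : ℕ → Bool} (hx : Admissible x) (h : x n = false) :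
    ∃ j ≤ len (n + 1), x = vert (n + 1) j (dropFirst (n + 1) x) := by
  induction n using Nat.strong_induction_on with
  | _ n ih =>
    rcases n with _ | n
    · refine ⟨0, Nat.zero_le _, ?_⟩
      funext k
      rcases k with _ | k
      · exact h
      · rfl
    by_cases h1 : x n = false
    · obtain ⟨j, hj, hxj⟩ := ih n (by omega) h1
      refine ⟨len n + 1 + (len (n + 1) - j), by rw [len_add_two]; omega, ?_⟩
      rw [vert_add_two_right, show len (n + 1) - (len (n + 1) - j) = j by omega]
      have e : cons false (dropFirst (n + 1 + 1) x) = dropFirst (n + 1) x := by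
        funext k
        rcases k with _ | k
        · simp [cons, dropFirst, h]
        · simp only [cons, dropFirst]
          congr 1
          omega
      rw [e]
      exact hxj
    · have ht : x n = true := by simpa using h1
      have e : cons true (cons false (dropFirst (n + 1 + 1) x)) = dropFirst n x := by
        funext k
        rcases k with _ | _ | k
        · simp [cons, dropFirst, ht]
        · simp [cons, dropFirst, Nat.add_comm 1 n, h]
        · simp only [cons, dropFirst]
          congr 1
          omega
      rcases n with _ | n
      · refine ⟨0, Nat.zero_le _, ?_⟩
        rw [vert_add_two_left (Nat.zero_le _), e]
        rfl
      · have h2 : x n = false := by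
          have := hx n
          grind
        obtain ⟨j, hj, hxj⟩ := ih n (by omega) h2
        refine ⟨len (n + 1) - j, by rw [len_add_two]; omega, ?_⟩
        rw [vert_add_two_left (by omega), e, show len (n + 1) - (len (n + 1) - j) = j by omega]
        exact hxj

/-! ### Walks on labelled lines and in the graphs of germs -/

open Classical in
/-- A step from the position `j` of a line, whose edge from `j` to `j + 1` has the index `f j`. -/
noncomputable def step (f : ℕ → ℕ) (s : Gen) (j : ℕ) : ℕ :=
  if IsLabel (f j) s then j + 1 else if 0 < j ∧ IsLabel (f (j - 1)) s then j - 1 else j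

/-- A step in the graph of germs of `ξ_i`, whose vertices are described by an element of the
four-group and a position on the ray. -/
noncomputable def mstep (i : ℕ) (s : Gen) (σ : Kind × ℕ) : Kind × ℕ :=
  if σ.2 = 0 ∧ s.2.val = i then (kmul σ.1 s.1, 0) else (σ.1, step (lam i) s σ.2)

/-- The end of the walk on a line. -/
noncomputable def lwalk (f : ℕ → ℕ) (j : ℕ) (u : List Gen) : ℕ :=
  u.foldl (fun j s => step f s j) j

/-- The end of the walk in the graph of germs of `ξ_i`. -/
noncomputable def mwalk (i : ℕ) (σ : Kind × ℕ) (u : List Gen) : Kind × ℕ :=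
  u.foldl (fun σ s => mstep i s σ) σ

/-- The word `u` crosses the central part of level `n` from the branch `1` to the branch `h`. -/
def Crosses (n : ℕ) (h : Kind) (u : List Gen) : Prop :=
  (∀ k, 0 < k → k < u.length → (mwalk (n % 3) (.a, len n) (u.take k)).2 < len n) ∧
    mwalk (n % 3) (.a, len n) u = (h, len n)

theorem foldl_take_succ {α β : Type*} (g : β → α → β) (x : β) (u : List α) {k : ℕ}
    (hk : k < u.length) :
    (u.take (k + 1)).foldl g x = g ((u.take k).foldl g x) u[k] := by
  rw [← List.take_append_getElem hk, List.foldl_append]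
  rfl

theorem lwalk_take_succ (f : ℕ → ℕ) (j : ℕ) (u : List Gen) {k : ℕ} (hk : k < u.length) :
    lwalk f j (u.take (k + 1)) = step f u[k] (lwalk f j (u.take k)) :=
  foldl_take_succ _ _ _ hk

theorem mwalk_take_succ (i : ℕ) (σ : Kind × ℕ) (u : List Gen) {k : ℕ} (hk : k < u.length) :
    mwalk i σ (u.take (k + 1)) = mstep i u[k] (mwalk i σ (u.take k)) :=
  foldl_take_succ _ _ _ hk

theorem lwalk_append (f : ℕ → ℕ) (j : ℕ) (u v : List Gen) :
    lwalk f j (u ++ v) = lwalk f (lwalk f j u) v := List.foldl_append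

theorem mwalk_append (i : ℕ) (σ : Kind × ℕ) (u v : List Gen) :
    mwalk i σ (u ++ v) = mwalk i (mwalk i σ u) v := List.foldl_append

theorem step_le (f : ℕ → ℕ) (s : Gen) (j : ℕ) : step f s j ≤ j + 1 ∧ j ≤ step f s j + 1 := by
  rw [step]
  split_ifs <;> omega

/-- Adjacent edges belong to different classes, so no generator labels both. This makes walks
reversible. -/
theorem step_step {f : ℕ → ℕ} (hf : ∀ j, f j % 3 ≠ f (j + 1) % 3) (s : Gen) (j : ℕ) :
    step f s (step f s j) = j := by
  by_cases h1 : IsLabel (f j) s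
  · have h2 : ¬IsLabel (f (j + 1)) s := fun h => hf j (h1.1.symm.trans h.1)
    have h3 : step f s j = j + 1 := by rw [step, if_pos h1]
    rw [h3, step, if_neg h2, if_pos ⟨by omega, by simpa using h1⟩, Nat.add_sub_cancel]
  · by_cases h2 : 0 < j ∧ IsLabel (f (j - 1)) s
    · have h3 : step f s j = j - 1 := by rw [step, if_neg h1, if_pos h2]
      rw [h3, step, if_pos h2.2]
      omega
    · have h3 : step f s j = j := by rw [step, if_neg h1, if_neg h2]
      rw [h3, h3]

theorem mstep_of_pos {i : ℕ} {s : Gen} {σ : Kind × ℕ} (h : 0 < σ.2) :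
    mstep i s σ = (σ.1, step (lam i) s σ.2) := by
  rw [mstep, if_neg (by omega)]

theorem mstep_mstep (n : ℕ) (s : Gen) (σ : Kind × ℕ) :
    mstep (n % 3) s (mstep (n % 3) s σ) = σ := by
  obtain ⟨h, j⟩ := σ
  by_cases h0 : j = 0 ∧ s.2.val = n % 3
  · have : mstep (n % 3) s (h, j) = (kmul h s.1, 0) := by rw [mstep, if_pos h0]
    rw [this, mstep, if_pos ⟨rfl, h0.2⟩, kmul_assoc, kmul_self, kmul_a, h0.1]
  · have : mstep (n % 3) s (h, j) = (h, step (lam (n % 3)) s j) := by rw [mstep, if_neg h0]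
    rw [this, mstep, if_neg, step_step (lam_succ_ne n)]
    rintro ⟨h1, h2⟩
    simp only at h1
    have hz := lam_zero_ne n
    rw [step] at h1
    split_ifs at h1 with h3 h4
    · obtain rfl : j = 1 := by omega
      rw [Nat.sub_self] at h4
      exact hz (h4.2.1.symm.trans h2)
    · exact h0 ⟨h1, h2⟩

theorem mwalk_injective (n : ℕ) (u : List Gen) {σ τ : Kind × ℕ}
    (h : mwalk (n % 3) σ u = mwalk (n % 3) τ u) : σ = τ := by
  induction u generalizing σ τ with
  | nil => exact h
  | cons s u ih =>
    have := ih (σ := mstep (n % 3) s σ) (τ := mstep (n % 3) s τ) h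
    rw [← mstep_mstep n s σ, this, mstep_mstep]

/-- Generators multiply the branch on the right, so left multiplication is an automorphism of the
labelled graph. Crossings can therefore be translated to start in the branch `1`. -/
theorem mwalk_kmul (i : ℕ) (g h : Kind) (j : ℕ) (u : List Gen) :
    mwalk i (kmul g h, j) u = (kmul g (mwalk i (h, j) u).1, (mwalk i (h, j) u).2) := by
  induction u generalizing h j with
  | nil => rfl
  | cons s u ih =>
    change mwalk i (mstep i s (kmul g h, j)) u = _
    have : mstep i s (kmul g h, j) = (kmul g (mstep i s (h, j)).1, (mstep i s (h, j)).2) := by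
      simp only [mstep]
      split_ifs
      · rw [kmul_assoc]
      · rfl
    rw [this, ih]
    rfl

theorem act_step {f : ℕ → ℕ} {q : ℕ → (ℕ → Bool)} {j : ℕ} (hj : 0 < j)
    (e1 : Edge (f (j - 1)) (q (j - 1)) (q j)) (e2 : Edge (f j) (q j) (q (j + 1)))
    (hne : f (j - 1) % 3 ≠ f j % 3) (s : Gen) : act s (q j) = q (step f s j) := by
  rw [step]
  split_ifs with h1 h2
  · exact e2.act_of_isLabel h1
  · exact e1.symm.act_of_isLabel h2.2
  · have h2' : ¬IsLabel (f (j - 1)) s := fun h => h2 ⟨hj, h⟩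
    by_cases c1 : s.2.val = f (j - 1) % 3
    · exact e1.symm.act_of_not_isLabel c1 h2'
    by_cases c2 : s.2.val = f j % 3
    · exact e2.act_of_not_isLabel c2 h1
    exact act_of_inClass_of_ne e1.symm.inClass e2.inClass hne (Nat.mod_lt _ (by norm_num))
      (Nat.mod_lt _ (by norm_num)) c1 c2

/-! ### Crossings of an interval -/

/-- Take the first time `q` at or below `a`, then the last earlier time `p` at or above `b`; unit
steps force equality. Integer values allow reflection for upward crossings. The last clause is what
later keeps a walk on its branch up to time `q`. -/
theorem exists_crossing_int {y : ℕ → ℤ} {t₁ : ℕ} (hy : ∀ k < t₁, |y (k + 1) - y k| ≤ 1)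
    {a b : ℤ} (hab : a < b) (h0 : b ≤ y 0) (h1 : y t₁ ≤ a) :
    ∃ p q, p < q ∧ q ≤ t₁ ∧ y p = b ∧ y q = a ∧ (∀ k, p < k → k < q → a < y k ∧ y k < b) ∧
      ∀ k < q, a < y k := by
  classical
  have hex : ∃ k, y k ≤ a := ⟨t₁, h1⟩
  set q := Nat.find hex with hq
  have hqa : y q ≤ a := Nat.find_spec hex
  have hqt : q ≤ t₁ := Nat.find_min' hex h1
  have hlt : ∀ k < q, a < y k := fun k hk => not_le.1 (Nat.find_min hex hk)
  have hq0 : 0 < q := by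
    rcases Nat.eq_zero_or_pos q with h | h
    · rw [h] at hqa
      omega
    · exact h
  set p := Nat.findGreatest (fun k => b ≤ y k) (q - 1) with hp
  have hpb : b ≤ y p := Nat.findGreatest_spec (P := fun k => b ≤ y k) (Nat.zero_le _) h0
  have hpq : p ≤ q - 1 := Nat.findGreatest_le _
  have hgt : ∀ k, p < k → k < q → y k < b := fun k h h' =>
    not_le.1 (Nat.findGreatest_is_greatest (P := fun k => b ≤ y k) h (by omega))
  have hs1 := hy p (by omega)
  have hs2 := hy (q - 1) (by omega)
  rw [abs_le] at hs1 hs2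
  rw [Nat.sub_add_cancel hq0] at hs2
  have hqlt := hlt (q - 1) (by omega)
  refine ⟨p, q, by omega, hqt, ?_, by omega, fun k h h' => ⟨hlt k h', hgt k h h'⟩, hlt⟩
  rcases Nat.lt_or_ge (p + 1) q with h | h
  · have := hgt (p + 1) (by omega) h
    omega
  · have : p + 1 = q := by omega
    rw [this] at hs1
    omega

theorem exists_crossing_down {y : ℕ → ℕ} {t₁ : ℕ}
    (hy : ∀ k < t₁, y (k + 1) ≤ y k + 1 ∧ y k ≤ y (k + 1) + 1)
    {a b : ℕ} (hab : a < b) (h0 : b ≤ y 0) (h1 : y t₁ ≤ a) :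
    ∃ p q, p < q ∧ q ≤ t₁ ∧ y p = b ∧ y q = a ∧ (∀ k, p < k → k < q → a < y k ∧ y k < b) ∧
      ∀ k < q, a < y k := by
  have := exists_crossing_int (y := fun k => (y k : ℤ)) (t₁ := t₁) (a := a) (b := b)
    (fun k hk => by
      have := hy k hk
      rw [abs_le]
      omega) (by exact_mod_cast hab) (by exact_mod_cast h0) (by exact_mod_cast h1)
  exact_mod_cast this

theorem exists_crossing_up {y : ℕ → ℕ} {t₁ : ℕ}
    (hy : ∀ k < t₁, y (k + 1) ≤ y k + 1 ∧ y k ≤ y (k + 1) + 1)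
    {a b : ℕ} (hab : a < b) (h0 : y 0 ≤ a) (h1 : b ≤ y t₁) :
    ∃ p q, p < q ∧ q ≤ t₁ ∧ y p = a ∧ y q = b ∧ ∀ k, p < k → k < q → a < y k ∧ y k < b := by
  obtain ⟨p, q, hpq, hq, hp1, hq1, h, -⟩ :=
    exists_crossing_int (y := fun k => -(y k : ℤ)) (t₁ := t₁) (a := -b) (b := -a)
    (fun k hk => by
      have := hy k hk
      rw [abs_le]
      omega) (by omega) (by omega) (by omega)
  refine ⟨p, q, hpq, hq, by omega, by omega, fun k h1 h2 => ?_⟩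
  have := h k h1 h2
  omega

theorem lwalk_take_le (f : ℕ → ℕ) (j : ℕ) (u : List Gen) (k : ℕ) (hk : k < u.length) :
    lwalk f j (u.take (k + 1)) ≤ lwalk f j (u.take k) + 1 ∧
      lwalk f j (u.take k) ≤ lwalk f j (u.take (k + 1)) + 1 := by
  rw [lwalk_take_succ f j u hk]
  exact step_le _ _ _

/-! ### Lifting crossings of the segments `I_n⁻¹ e_m I_n` to the graphs of germs -/

/-- The line `f` contains the segment `I_n⁻¹ e_m I_n`, with `e_m` as its edge number `c`. -/
structure Bubble (f : ℕ → ℕ) (c n m : ℕ) : Prop where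
  three_le : 3 ≤ m
  mod_eq : m % 3 = n % 3
  len_pos : 0 < len n
  len_le : len n ≤ c
  center : f c = m
  right : ∀ k < len n, f (c + 1 + k) = lam (n % 3) k
  left : ∀ k < len n, f (c - 1 - k) = lam (n % 3) k

/-- The projection of the central part of the graph of germs to the line. -/
def proj (c m : ℕ) (σ : Kind × ℕ) : ℕ :=
  if lab (m / 3 % 3) σ.1 = true then c - σ.2 else c + 1 + σ.2

/-- At the centre a generator of class `n` changes the side exactly when it labels `e_m`, because
`lab` is a homomorphism. Away from the centre both sides are copies of the ray, as long as the
position stays below `len n`. -/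
theorem Bubble.step_proj {f : ℕ → ℕ} {c n m : ℕ} (B : Bubble f c n m) {σ : Kind × ℕ}
    (hσ : σ.2 < len n) (s : Gen) :
    step f s (proj c m σ) = proj c m (mstep (n % 3) s σ) := by
  obtain ⟨h, j⟩ := σ
  simp only at hσ
  have hB := B.len_le
  have hz := lam_zero_ne n
  have hr := B.right
  have hl := B.left
  have hlab := isLabel_iff B.three_le s
  rw [B.mod_eq] at hlab
  rcases Nat.eq_zero_or_pos j with rfl | hj
  · have h0 : f (c + 1) = lam (n % 3) 0 := hr 0 hσ
    have h0' : f (c - 1) = lam (n % 3) 0 := hl 0 hσ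
    by_cases hs : s.2.val = n % 3
    · have hs0 : ¬IsLabel (lam (n % 3) 0) s := fun h => hz (h.1.symm.trans hs)
      rw [mstep, if_pos ⟨rfl, hs⟩]
      simp only [proj, lab_kmul (show m / 3 % 3 < 3 by omega)]
      simp only [hs, true_and] at hlab
      cases hh : lab (m / 3 % 3) h <;> cases hs1 : lab (m / 3 % 3) s.1 <;>
        simp [step, h0, h0', hs0, B.center, hlab, hs1]
    · have hs0 : ¬IsLabel m s := fun h => hs (hlab.1 h).1
      rw [mstep, if_neg (by simp [hs])]
      simp only [proj]
      cases hh : lab (m / 3 % 3) h <;>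
        by_cases h3 : IsLabel (lam (n % 3) 0) s <;>
        simp [step, h0, h0', hs0, B.center, h3]
      omega
  · have hne := lam_succ_ne n (j - 1)
    rw [Nat.sub_add_cancel hj] at hne
    have hnot : IsLabel (lam (n % 3) (j - 1)) s → ¬IsLabel (lam (n % 3) j) s :=
      fun h h' => hne (h.1.symm.trans h'.1)
    rw [mstep_of_pos hj]
    simp only [proj]
    split_ifs with h1
    · have e1 := hl (j - 1) (by omega)
      have e2 := hl j hσ
      rw [show c - 1 - (j - 1) = c - j by omega] at e1
      rw [show c - 1 - j = c - j - 1 by omega] at e2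
      have hcj : 0 < c - j := by omega
      rw [step, step, e1, e2]
      by_cases h3 : IsLabel (lam (n % 3) j) s
      · have h4 : ¬IsLabel (lam (n % 3) (j - 1)) s := fun h => hnot h h3
        rw [if_neg h4, if_pos h3, if_pos ⟨hcj, h3⟩]
        omega
      · by_cases h4 : IsLabel (lam (n % 3) (j - 1)) s
        · rw [if_pos h4, if_neg h3, if_pos ⟨hj, h4⟩]
          omega
        · rw [if_neg h4, if_neg h3, if_neg (fun h => h3 h.2), if_neg (fun h => h4 h.2)]
    · have e1 := hr (j - 1) (by omega)
      have e2 := hr j hσ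
      rw [show c + 1 + (j - 1) = c + 1 + j - 1 by omega] at e1
      rw [step, step, e1, e2]
      by_cases h3 : IsLabel (lam (n % 3) j) s
      · rw [if_pos h3, if_pos h3]
        rfl
      · by_cases h4 : IsLabel (lam (n % 3) (j - 1)) s
        · rw [if_neg h3, if_pos ⟨by omega, h4⟩, if_neg h3, if_pos ⟨hj, h4⟩]
          omega
        · rw [if_neg h3, if_neg (fun h => h4 h.2), if_neg h3, if_neg (fun h => h4 h.2)]

theorem mstep_snd_le (i : ℕ) (s : Gen) (σ : Kind × ℕ) : (mstep i s σ).2 ≤ σ.2 + 1 := by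
  rw [mstep]
  split_ifs
  · omega
  · exact (step_le _ _ _).1

/-- The walk lifts letter by letter through the folding. As it ends on the side opposite to its
start, the ratio of exit and entrance is outside the kernel; translation by `h₀` yields a crossing
from the branch `1`. -/
theorem Bubble.exists_crosses {f : ℕ → ℕ} {c n m : ℕ} (B : Bubble f c n m) {h₀ : Kind}
    {u : List Gen} (hint : ∀ k, 0 < k → k < u.length →
      c - len n < lwalk f (proj c m (h₀, len n)) (u.take k) ∧
        lwalk f (proj c m (h₀, len n)) (u.take k) < c + 1 + len n)
    (hend : lwalk f (proj c m (h₀, len n)) u = c - len n ∨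
      lwalk f (proj c m (h₀, len n)) u = c + 1 + len n)
    (hne : lwalk f (proj c m (h₀, len n)) u ≠ proj c m (h₀, len n)) :
    ∃ h, lab (m / 3 % 3) h = true ∧ Crosses n h u := by
  set y₀ := proj c m (h₀, len n) with hy₀
  have hB := B.len_le
  have hL := B.len_pos
  have hin (σ : Kind × ℕ) (h1 : c - len n < proj c m σ) (h2 : proj c m σ < c + 1 + len n) :
      σ.2 < len n := by
    simp only [proj] at h1 h2
    split_ifs at h1 h2 <;> omega
  have key : ∀ k ≤ u.length,
      lwalk f y₀ (u.take k) = proj c m (mwalk (n % 3) (h₀, len n) (u.take k)) ∧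
        (mwalk (n % 3) (h₀, len n) (u.take k)).2 ≤ len n := by
    intro k
    induction k with
    | zero => exact fun _ => ⟨rfl, le_rfl⟩
    | succ k ih =>
      intro hk
      have ih := (ih (by omega)).1
      rw [lwalk_take_succ _ _ _ (by omega), mwalk_take_succ _ _ _ (by omega), ih]
      -- The starting position is on the boundary, where `step_proj` does not apply. The first
      -- letter has to move inward, so it labels the last edge of the segment and moves inward in
      -- the lift as well.
      rcases Nat.eq_zero_or_pos k with rfl | hk0
      · have hy1 : c - len n ≤ lwalk f y₀ (u.take (0 + 1)) ∧
            lwalk f y₀ (u.take (0 + 1)) ≤ c + 1 + len n ∧ lwalk f y₀ (u.take (0 + 1)) ≠ y₀ := by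
          rcases Nat.lt_or_ge 1 u.length with h | h
          · have := hint 1 one_pos h
            have hy : y₀ = c - len n ∨ y₀ = c + 1 + len n := by
              rw [hy₀, proj]
              split_ifs <;> simp
            rw [zero_add]
            omega
          · have : u.take (0 + 1) = u := List.take_of_length_le (by omega)
            rw [this]
            omega
        rw [lwalk_take_succ _ _ _ (by omega)] at hy1
        change c - len n ≤ step f u[0] y₀ ∧ step f u[0] y₀ ≤ c + 1 + len n ∧
          step f u[0] y₀ ≠ y₀ at hy1
        change step f u[0] y₀ = proj c m (mstep (n % 3) u[0] (h₀, len n)) ∧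
          (mstep (n % 3) u[0] (h₀, len n)).2 ≤ len n
        generalize u[0] = s at hy1
        have hne := lam_succ_ne n (len n - 1)
        rw [Nat.sub_add_cancel hL] at hne
        have hlast : IsLabel (lam (n % 3) (len n - 1)) s ∧
            step f s y₀ = if lab (m / 3 % 3) h₀ = true then c - len n + 1 else c + len n := by
          have e1 := B.right (len n - 1) (by omega)
          have e2 := B.left (len n - 1) (by omega)
          rw [show c + 1 + (len n - 1) = c + len n by omega] at e1
          rw [show c - 1 - (len n - 1) = c - len n by omega] at e2
          by_cases h1 : lab (m / 3 % 3) h₀ = true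
          · have hy : y₀ = c - len n := by rw [hy₀, proj, if_pos h1]
            rw [hy, step, e2] at hy1
            rw [hy, step, e2, if_pos h1]
            split_ifs at hy1 ⊢ with h2 h3
            · exact ⟨h2, rfl⟩
            · omega
            · omega
          · have hy : y₀ = c + 1 + len n := by rw [hy₀, proj, if_neg h1]
            have hy' : c + 1 + len n - 1 = c + len n := by omega
            rw [hy, step, hy', e1] at hy1
            rw [hy, step, hy', e1, if_neg h1]
            split_ifs at hy1 ⊢ with h2 h3
            · omega
            · exact ⟨h3.2, rfl⟩
            · omega
        have h4 : ¬IsLabel (lam (n % 3) (len n)) s := fun h => hne (hlast.1.1.symm.trans h.1)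
        have hms : mstep (n % 3) s (h₀, len n) = (h₀, len n - 1) := by
          rw [mstep_of_pos hL, step, if_neg h4, if_pos ⟨hL, hlast.1⟩]
        rw [hlast.2, hms]
        refine ⟨?_, Nat.sub_le _ _⟩
        simp only [proj]
        split_ifs <;> omega
      · have := hint k hk0 (by omega)
        rw [ih] at this
        have hlt := hin _ this.1 this.2
        exact ⟨B.step_proj hlt _, (mstep_snd_le _ _ _).trans hlt⟩
  have hend' : lwalk f y₀ u = proj c m (mwalk (n % 3) (h₀, len n) u) ∧
      (mwalk (n % 3) (h₀, len n) u).2 ≤ len n := by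
    have := key u.length le_rfl
    rwa [List.take_length] at this
  have hmul (v : List Gen) := mwalk_kmul (n % 3) h₀ .a (len n) v
  simp only [kmul_a] at hmul
  obtain ⟨hend', hle⟩ := hend'
  rw [hend'] at hend hne
  have hlab := lab_kmul (show m / 3 % 3 < 3 by omega) h₀ (mwalk (n % 3) (.a, len n) u).1
  refine ⟨(mwalk (n % 3) (.a, len n) u).1, ?_, fun k h1 h2 => ?_, ?_⟩
  · rw [hmul, hy₀] at hne
    rw [hmul] at hend
    simp only [proj, hlab] at hne hend
    generalize lab (m / 3 % 3) (mwalk (n % 3) (.a, len n) u).1 = B1 at *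
    generalize lab (m / 3 % 3) h₀ = B2 at *
    cases B1 <;> cases B2 <;> simp at * <;> omega
  · have := hint k h1 h2
    rw [(key k h2.le).1, hmul] at this
    have := hin _ this.1 this.2
    exact this
  · rw [hmul] at hend hle
    simp only [proj] at hend
    ext
    · rfl
    · simp only
      split_ifs at hend <;> omega

/-! ### The topology of the shift -/

theorem eventually_agree (x : Shift) (K : ℕ) : ∀ᶠ y : Shift in 𝓝 x, ∀ k < K, y.1 k = x.1 k := by
  have h (k : ℕ) : ∀ᶠ y : Shift in 𝓝 x, y.1 k = x.1 k :=
    ((continuous_apply k).comp continuous_subtype_val).tendsto x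
      ((isOpen_discrete {x.1 k}).mem_nhds rfl)
  have := (Finset.range K).eventually_all.2 fun k _ => h k
  filter_upwards [this] with y hy k hk
  exact hy k (Finset.mem_range.2 hk)

theorem eventually_nhds_iff_agree {x : Shift} {p : Shift → Prop} :
    (∀ᶠ y in 𝓝 x, p y) ↔ ∃ K, ∀ y : Shift, (∀ k < K, y.1 k = x.1 k) → p y := by
  constructor
  · intro h
    rw [nhds_subtype_eq_comap, eventually_comap] at h
    obtain ⟨_, ⟨z, K, rfl⟩, hxt, ht⟩ :=
      (PiNat.isTopologicalBasis_cylinders fun _ : ℕ => Bool).mem_nhds_iff.1 h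
    refine ⟨K, fun y hy => ht ?_ y rfl⟩
    rw [← PiNat.mem_cylinder_iff_eq.1 hxt]
    exact PiNat.mem_cylinder_iff.2 hy
  · rintro ⟨K, hK⟩
    filter_upwards [eventually_agree x K] with y hy
    exact hK y hy

/-! ### The vertices of the graphs of germs -/

/-- The germ at `ξ_i` of the word `u` is the vertex number `j` of the branch `h`, for segments of
level `n`. -/
def At (i : Fin 3) (n : ℕ) (u : List Gen) (σ : Kind × ℕ) : Prop :=
  ∀ᶠ y : Shift in 𝓝 (xi i),
    (wordPerm u y).1 = vert n σ.2 (vact (rot^[n / 3] σ.1) (dropFirst n y.1))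

theorem eventually_eq_lpre {i : Fin 3} {n : ℕ} (hn : n % 3 = i) :
    ∀ᶠ y : Shift in 𝓝 (xi i), y.1 = lpre n (dropFirst n y.1) := by
  filter_upwards [eventually_agree (xi i) n] with y hy
  apply eq_lpre_of_agree
  intro k hk
  rw [hy k hk, hn]
  rfl

theorem rot_iterate_a (k : ℕ) : rot^[k] .a = .a := by
  induction k with
  | zero => rfl
  | succ k ih => exact ih

theorem at_nil {i : Fin 3} {n : ℕ} (hn : n % 3 = i) : At i n [] (.a, 0) := by
  filter_upwards [eventually_eq_lpre hn] with y hy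
  rw [vert_zero, rot_iterate_a]
  exact hy

theorem act_vert {n j : ℕ} (hn : 3 ≤ n) (hj : j < len n) {w : ℕ → Bool} (hw : Admissible w)
    (h : Kind) (s : Gen) :
    act s (vert n j (vact (rot^[n / 3] h) w)) =
      vert n (mstep (n % 3) s (h, j)).2 (vact (rot^[n / 3] (mstep (n % 3) s (h, j)).1) w) := by
  rcases Nat.eq_zero_or_pos j with rfl | hj0
  · by_cases hs : s.2.val = n % 3
    · rw [mstep, if_pos ⟨rfl, hs⟩]
      simp only [vert_zero]
      rw [act_lpre s hn hs, vact_vact _ _ hw, rot_iterate_kmul]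
    · rw [mstep, if_neg (by simp [hs])]
      simp only
      have e := edge_vert hj (vact (rot^[n / 3] h) w)
      rw [step, lam_mod hj]
      have hz := lam_zero_ne n
      rw [lam_mod hj] at hz
      by_cases h1 : IsLabel (sg n 0) s
      · rw [if_pos h1, e.act_of_isLabel h1]
      · rw [if_neg h1, if_neg (by simp)]
        by_cases h2 : s.2.val = sg n 0 % 3
        · exact e.act_of_not_isLabel h2 h1
        · have hc := inClass_lpre n (vact (rot^[n / 3] h) w)
          rw [← vert_zero] at hc
          exact act_of_inClass_of_ne e.inClass hc hz (Nat.mod_lt _ (by norm_num))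
            (Nat.mod_lt _ (by norm_num)) h2 hs
  · rw [mstep_of_pos hj0]
    have e1 := edge_vert (n := n) (j := j - 1) (by omega) (vact (rot^[n / 3] h) w)
    have e2 := edge_vert hj (vact (rot^[n / 3] h) w)
    have hne := lam_succ_ne n (j - 1)
    rw [Nat.sub_add_cancel hj0] at hne e1
    rw [← lam_mod (by omega)] at e1 e2
    exact act_step (q := fun j => vert n j (vact (rot^[n / 3] h) w)) hj0 e1 e2 hne s

theorem At.snoc {i : Fin 3} {n : ℕ} {u : List Gen} {σ : Kind × ℕ} (H : At i n u σ) (hn : 3 ≤ n)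
    (hj : σ.2 < len n) (s : Gen) : At i n (u ++ [s]) (mstep (n % 3) s σ) := by
  filter_upwards [H] with y hy
  rw [wordPerm_apply, wact_append, ← wordPerm_apply, hy]
  exact act_vert hn hj (y.2.dropFirst n) σ.1 s

theorem exists_lab_ne {g h : Kind} (hgh : g ≠ h) : ∃ r < 3, lab r g ≠ lab r h := by
  cases g <;> cases h <;> first | exact absurd rfl hgh | exact ⟨0, by decide, by decide⟩ |
    exact ⟨1, by decide, by decide⟩

theorem walk_germ {i : Fin 3} (u v : List Gen) : walk (germ i u) v = germ i (u ++ v) := by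
  rw [walk, germ, germ, wordPerm_append, Germ.map_coe]
  rfl

theorem At.congr {i : Fin 3} {n : ℕ} {u u' : List Gen} {σ : Kind × ℕ} (H : At i n u σ)
    (h : germ i u = germ i u') : At i n u' σ := by
  filter_upwards [H, Germ.coe_eq.1 h] with y hy hy'
  rw [← hy']
  exact hy

theorem At.germ_eq {i : Fin 3} {n : ℕ} {u u' : List Gen} {σ : Kind × ℕ} (H : At i n u σ)
    (H' : At i n u' σ) : germ i u = germ i u' := by
  apply Germ.coe_eq.2
  filter_upwards [H, H'] with y hy hy'
  exact Subtype.ext (hy.trans hy'.symm)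

theorem admissible_zeros : Admissible fun _ => false := by
  intro n
  simp

/-- The four-group fixes `ξ_i`, so evaluation there determines the position. Branches are separated
at nearby points that leave the pattern of `ξ_i` at a depth where a homomorphism distinguishes the
two elements. -/
theorem At.unique {i : Fin 3} {n : ℕ} (hn : n % 3 = i) {u : List Gen} {σ τ : Kind × ℕ}
    (H : At i n u σ) (H' : At i n u τ) (hσ : σ.2 ≤ len n) (hτ : τ.2 ≤ len n) : σ = τ := by
  have hx1 := Eventually.self_of_nhds H
  have hx2 := Eventually.self_of_nhds H'
  have hxi := hx1.symm.trans hx2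
  rw [dropFirst_xi i n hn, vact_xi, vact_xi] at hxi
  have hj := vert_left_injective hσ hτ hxi
  refine Prod.ext ?_ hj
  by_contra hne
  have hne' : rot^[n / 3] σ.1 ≠ rot^[n / 3] τ.1 := fun h => hne (rot_injective.iterate _ h)
  obtain ⟨r, hr, hlab⟩ := exists_lab_ne hne'
  obtain ⟨K, hK⟩ := eventually_nhds_iff_agree.1 (H.and H')
  set z : ℕ → Bool := cons false (cons false fun _ => false) with hz
  have hzadm : Admissible z := admissible_cons (admissible_cons admissible_zeros (by simp)) (by simp)
  -- At least `K` letters agree with `ξ_i`, and the number of blocks is `r` modulo 3, so that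
  -- toggling is governed by `lab r`.
  set w := lpre (3 * (3 * K + r)) z with hw
  have hyadm : Admissible (lpre n w) := admissible_lpre _ (admissible_lpre _ hzadm)
  obtain ⟨h1, h2⟩ := hK ⟨lpre n w, hyadm⟩ (by
    intro k hk
    simp only
    rw [hw, ← lpre_add_mul, lpre_apply_lt _ _ _ (by omega), xi, Nat.add_mul_mod_self_left, hn])
  have h3 := h1.symm.trans h2
  simp only [dropFirst_lpre, hj] at h3
  have h4 : vact (rot^[n / 3] σ.1) w = vact (rot^[n / 3] τ.1) w := by
    funext k
    have h5 := congrFun h3 (k + n)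
    rwa [vert_apply_add, vert_apply_add] at h5
  rw [hw, vact_lpre, vact_lpre] at h4
  have h5 := lpre_injective h4
  rw [hz, vact_cons_false, vact_cons_false] at h5
  simp only [rot_iterate_toggles] at h5
  rw [show (3 * K + r) % 3 = r by omega] at h5
  have h6 := congrFun h5 0
  generalize lab r (rot^[n / 3] σ.1) = B1 at *
  generalize lab r (rot^[n / 3] τ.1) = B2 at *
  cases B1 <;> cases B2 <;> simp_all [cons]

/-- The element of the four-group that labels a branch. -/
def Branch.kind : Branch → Kind
  | .one => .a
  | .b => .b
  | .c => .c
  | .d => .d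

theorem at_branch {i : Fin 3} {n : ℕ} (hn : n % 3 = i) (hn3 : 3 ≤ n) (h : Branch) :
    At i n (h.word i) (h.kind, 0) := by
  have h0 := at_nil hn
  have hl := le_len_add_one n
  have key (s : Kind) : At i n [(s, i)] (s, 0) := by
    have := h0.snoc hn3 (show 0 < len n by omega) (s, i)
    rwa [mstep, if_pos ⟨rfl, hn.symm⟩, a_kmul] at this
  cases h
  · exact h0
  · exact key .b
  · exact key .c
  · exact key .d

/-- Coordinates of level `n + 3` are used for `I_n`: its far endpoint is then interior, so a further
letter can be followed there, and the level is at least 3 even for small `n`. -/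
theorem at_along {n : ℕ} (h : Branch) {p : List ℕ} (hp : p <+: segment n) {u : List Gen}
    (hu : List.Forall₂ IsLabel p u) :
    At (residue n) (n + 3) (h.word (residue n) ++ u) (h.kind, p.length) := by
  have hpl := hp.length_le
  have hl : len n ≤ len (n + 3) := len_mono (by omega)
  have key : ∀ k ≤ u.length,
      At (residue n) (n + 3) (h.word (residue n) ++ u.take k) (h.kind, k) := by
    intro k
    induction k with
    | zero =>
      intro _
      rw [List.take_zero, List.append_nil]
      exact at_branch (by simp [residue]) (by omega) h
    | succ k ih =>
      intro hk
      have hk' : k < p.length := by rw [hu.length_eq]; omega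
      have hkn : k < len n := lt_of_lt_of_le hk' hpl
      have := (ih (by omega)).snoc (by omega) (show k < len (n + 3) by omega) (u[k])
      rw [List.append_assoc, List.take_append_getElem] at this
      have hlabel : IsLabel (lam (n % 3) k) u[k] := by
        have h1 := hu.get hk' (by omega)
        have h2 : sg n k = p[k] := by
          rw [hp.getElem hk']
          exact List.getD_eq_getElem _ _ hkn
        rw [lam_mod hkn, h2]
        simpa using h1
      have e : mstep ((n + 3) % 3) u[k] (h.kind, k) = (h.kind, k + 1) := by
        rw [Nat.add_mod_right, mstep, if_neg, step, if_pos hlabel]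
        rintro ⟨h1, h2⟩
        simp only at h1
        subst h1
        exact lam_zero_ne n (hlabel.1.symm.trans h2)
      rwa [e] at this
  have := key u.length le_rfl
  rwa [List.take_length, ← hu.length_eq] at this

/-! ### The central part of the graph of germs in coordinates -/

theorem exists_isLabel (m : ℕ) : ∃ s, IsLabel m s := by
  by_cases h : m / 3 % 3 = 2
  · exact ⟨(.c, ⟨m % 3, Nat.mod_lt _ (by norm_num)⟩), rfl, by simp [h]⟩
  · exact ⟨(.b, ⟨m % 3, Nat.mod_lt _ (by norm_num)⟩), rfl, h⟩

theorem exists_forall₂_isLabel (p : List ℕ) : ∃ u, List.Forall₂ IsLabel p u := by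
  induction p with
  | nil => exact ⟨[], .nil⟩
  | cons m p ih =>
    obtain ⟨s, hs⟩ := exists_isLabel m
    obtain ⟨u, hu⟩ := ih
    exact ⟨s :: u, .cons hs hu⟩

theorem germ_mem_along_iff {n : ℕ} {h : Branch} {p : List ℕ} (hp : p <+: segment n)
    {u : List Gen} : germ (residue n) u ∈ along n h p ↔
      At (residue n) (n + 3) u (h.kind, p.length) := by
  constructor
  · rintro ⟨v, hv, hu⟩
    rw [walk_germ] at hu
    exact (at_along h hp hv).congr hu.symm
  · intro H
    obtain ⟨v, hv⟩ := exists_forall₂_isLabel p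
    exact ⟨v, hv, by rw [walk_germ]; exact H.germ_eq (at_along h hp hv)⟩

theorem germ_mem_copyEnd_iff {n : ℕ} {h : Branch} {u : List Gen} :
    germ (residue n) u ∈ copyEnd n h ↔ At (residue n) (n + 3) u (h.kind, len n) :=
  germ_mem_along_iff List.prefix_rfl

theorem germ_mem_copyVertices_iff {n : ℕ} {h : Branch} {u : List Gen} :
    germ (residue n) u ∈ copyVertices n h ↔
      ∃ j ≤ len n, At (residue n) (n + 3) u (h.kind, j) := by
  constructor
  · rintro ⟨p, hp, hu⟩
    exact ⟨p.length, hp.length_le, (germ_mem_along_iff hp).1 hu⟩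
  · rintro ⟨j, hj, H⟩
    refine ⟨(segment n).take j, List.take_prefix _ _, (germ_mem_along_iff (List.take_prefix _ _)).2 ?_⟩
    have : ((segment n).take j).length = j := by
      rw [List.length_take]
      exact min_eq_left hj
    rwa [this]

theorem Branch.exists_kind (h : Kind) : ∃ g : Branch, g.kind = h := by
  cases h
  exacts [⟨.one, rfl⟩, ⟨.b, rfl⟩, ⟨.c, rfl⟩, ⟨.d, rfl⟩]

theorem len_lt_len_add_three (n : ℕ) : len n < len (n + 3) := by
  have := len_add_two (n + 1)
  have := len_le_succ n
  rw [show n + 3 = n + 1 + 2 by ring]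
  omega

theorem germ_mem_internal_iff {n : ℕ} {u : List Gen} :
    germ (residue n) u ∈ internal n ↔
      ∃ h, ∃ j < len n, At (residue n) (n + 3) u (h, j) := by
  have hl := len_lt_len_add_three n
  simp only [internal, Set.mem_sdiff, Set.mem_iUnion, not_exists, germ_mem_copyVertices_iff,
    germ_mem_copyEnd_iff]
  constructor
  · rintro ⟨⟨h, j, hj, H⟩, H'⟩
    refine ⟨h.kind, j, lt_of_le_of_ne hj ?_, H⟩
    rintro rfl
    exact H' h H
  · rintro ⟨h, j, hj, H⟩
    obtain ⟨g, rfl⟩ := Branch.exists_kind h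
    refine ⟨⟨g, j, hj.le, H⟩, fun g' H' => ?_⟩
    have := H.unique (by simp [residue]) H' (by simp only; omega) (by simp only; omega)
    simp only [Prod.mk.injEq] at this
    omega

/-- Coordinates of germs exist, follow `mstep` and are unique, so a path of germs and a path in the
model determine each other. -/
theorem isTraverse_iff {n : ℕ} {h : Branch} {u : List Gen} :
    IsTraverse n h u ↔ Crosses n h.kind u := by
  have hl := len_lt_len_add_three n
  have hres : (n + 3) % 3 = (residue n : ℕ) := by simp [residue]
  have snoc {v : List Gen} {σ : Kind × ℕ} (H : At (residue n) (n + 3) v σ) (hσ : σ.2 ≤ len n)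
      (s : Gen) : At (residue n) (n + 3) (v ++ [s]) (mstep (n % 3) s σ) := by
    have := H.snoc (by omega) (by omega) s
    rwa [Nat.add_mod_right] at this
  constructor
  · rintro ⟨_, ⟨v₀, hv₀, rfl⟩, hint, hend⟩
    rw [walk_germ] at hint hend
    have H₀ := at_along .one List.prefix_rfl hv₀
    set v := Branch.word (residue n) .one ++ v₀
    -- After the last letter only the weaker bound `len (n + 3)` is known at first. It suffices for
    -- uniqueness of coordinates, which then places the end of the path.
    have key : ∀ k ≤ u.length,
        At (residue n) (n + 3) (v ++ u.take k) (mwalk (n % 3) (.a, len n) (u.take k)) ∧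
        (mwalk (n % 3) (.a, len n) (u.take k)).2 ≤ len (n + 3) ∧
        (k < u.length → (mwalk (n % 3) (.a, len n) (u.take k)).2 ≤ len n) ∧
        (0 < k → k < u.length → (mwalk (n % 3) (.a, len n) (u.take k)).2 < len n) := by
      intro k
      induction k with
      | zero =>
        intro _
        rw [List.take_zero, List.append_nil]
        exact ⟨H₀, hl.le, fun _ => le_rfl, by simp⟩
      | succ k ih =>
        intro hk
        obtain ⟨h1, h2, h3, h4⟩ := ih (by omega)
        have hA := snoc h1 (h3 (by omega)) u[k]
        rw [List.append_assoc, List.take_append_getElem, ← mwalk_take_succ _ _ _ (by omega)] at hA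
        have hle : (mwalk (n % 3) (.a, len n) (u.take (k + 1))).2 ≤ len (n + 3) := by
          rw [mwalk_take_succ _ _ _ (by omega)]
          have := mstep_snd_le (n % 3) u[k] (mwalk (n % 3) (.a, len n) (u.take k))
          have := h3 (by omega)
          omega
        have hlt : k + 1 < u.length →
            (mwalk (n % 3) (.a, len n) (u.take (k + 1))).2 < len n := by
          intro hk1
          have := hint (u.take (k + 1)) (List.take_prefix _ _)
            (by intro h; have := congrArg List.length h; simp at this; simp [this] at hk)
            (by intro h; have := congrArg List.length h; simp at this; omega)
          rw [walk_germ, germ_mem_internal_iff] at this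
          obtain ⟨h, j, hj, H⟩ := this
          have := hA.unique hres H hle (by simp only; omega)
          rw [this]
          exact hj
        exact ⟨hA, hle, fun h => (hlt h).le, fun _ => hlt⟩
    refine ⟨fun k h1 h2 => (key k h2.le).2.2.2 h1 h2, ?_⟩
    obtain ⟨h1, h2, -⟩ := key u.length le_rfl
    rw [List.take_length] at h1 h2
    rw [walk_germ, germ_mem_copyEnd_iff] at hend
    exact h1.unique hres hend h2 hl.le
  · rintro ⟨hint, hend⟩
    obtain ⟨v₀, hv₀⟩ := exists_forall₂_isLabel (segment n)
    have H₀ := at_along .one List.prefix_rfl hv₀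
    set v := Branch.word (residue n) .one ++ v₀
    have key : ∀ k ≤ u.length,
        At (residue n) (n + 3) (v ++ u.take k) (mwalk (n % 3) (.a, len n) (u.take k)) := by
      intro k
      induction k with
      | zero =>
        intro _
        rw [List.take_zero, List.append_nil]
        exact H₀
      | succ k ih =>
        intro hk
        have hle : (mwalk (n % 3) (.a, len n) (u.take k)).2 ≤ len n := by
          rcases Nat.eq_zero_or_pos k with rfl | h0
          · exact le_rfl
          · exact (hint k h0 (by omega)).le
        have hA := snoc (ih (by omega)) hle u[k]
        rwa [List.append_assoc, List.take_append_getElem,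
          ← mwalk_take_succ _ _ _ (by omega)] at hA
    refine ⟨germ (residue n) v, germ_mem_copyEnd_iff.2 H₀, ?_, ?_⟩
    · intro q hq hq0 hqu
      rw [List.prefix_iff_eq_take.1 hq]
      have hq1 := hq.length_le
      have hlt : q.length < u.length := by
        refine lt_of_le_of_ne hq1 fun h => hqu (hq.eq_of_length h)
      rw [walk_germ, germ_mem_internal_iff]
      exact ⟨_, _, hint _ (List.length_pos_iff.2 hq0) hlt, key q.length hq1⟩
    · have := key u.length le_rfl
      rw [List.take_length, hend] at this
      rw [walk_germ]
      exact germ_mem_copyEnd_iff.2 this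

/-! ### Counting crossings -/

/-- The part of the word `w` between the positions `p` and `q`. -/
def slice (w : List Gen) (p q : ℕ) : List Gen := (w.drop p).take (q - p)

theorem slice_append {w : List Gen} {p q r : ℕ} (h1 : p ≤ q) (h2 : q ≤ r) :
    slice w p q ++ slice w q r = slice w p r := by
  have : w.drop q = (w.drop p).drop (q - p) := by
    rw [List.drop_drop]
    congr 1
    omega
  rw [slice, slice, slice, this, show r - p = (q - p) + (r - q) by omega, List.take_add]

theorem slice_take {w : List Gen} {p q k : ℕ} (hk : p + k ≤ q) :
    (slice w p q).take k = slice w p (p + k) := by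
  rw [slice, slice, List.take_take, Nat.add_sub_cancel_left, min_eq_left (by omega)]

theorem length_slice {w : List Gen} {p q : ℕ} (hq : q ≤ w.length) :
    (slice w p q).length = q - p := by
  rw [slice, List.length_take, List.length_drop]
  omega

/-- The subwords of `w` that cross the central part of level `n` to a branch in the set `S`. -/
def crossSet (n : ℕ) (S : Set Kind) (w : List Gen) : Set (ℕ × ℕ) :=
  {p | p.1 < p.2 ∧ p.2 ≤ w.length ∧ ∃ h ∈ S, Crosses n h (slice w p.1 p.2)}

theorem crossSet_finite (n : ℕ) (S : Set Kind) (w : List Gen) : (crossSet n S w).Finite := by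
  apply ((Set.finite_Iic w.length).prod (Set.finite_Iic w.length)).subset
  rintro ⟨p, q⟩ ⟨h1, h2, -⟩
  exact ⟨h1.le.trans h2, h2⟩

theorem T_eq (n : ℕ) (h : Branch) (w : List Gen) : T n h w = (crossSet n {h.kind} w).ncard := by
  rw [T]
  congr 1
  ext p
  simp only [crossSet, Set.mem_ofPred_eq, isTraverse_iff, Set.mem_singleton_iff, exists_eq_left,
    slice]

theorem crossSet_union (n : ℕ) (S S' : Set Kind) (w : List Gen) :
    crossSet n (S ∪ S') w = crossSet n S w ∪ crossSet n S' w := by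
  ext p
  simp only [crossSet, Set.mem_ofPred_eq, Set.mem_union]
  constructor
  · rintro ⟨h1, h2, h, h3 | h3, h4⟩
    · exact Or.inl ⟨h1, h2, h, h3, h4⟩
    · exact Or.inr ⟨h1, h2, h, h3, h4⟩
  · rintro (⟨h1, h2, h, h3, h4⟩ | ⟨h1, h2, h, h3, h4⟩)
    · exact ⟨h1, h2, h, Or.inl h3, h4⟩
    · exact ⟨h1, h2, h, Or.inr h3, h4⟩

theorem ncard_crossSet_union (n : ℕ) {S S' : Set Kind} (hS : Disjoint S S') (w : List Gen) :
    (crossSet n (S ∪ S') w).ncard = (crossSet n S w).ncard + (crossSet n S' w).ncard := by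
  rw [crossSet_union, Set.ncard_union_eq _ (crossSet_finite _ _ _) (crossSet_finite _ _ _)]
  rw [Set.disjoint_left]
  rintro p ⟨-, -, h, h1, h2⟩ ⟨-, -, h', h1', h2'⟩
  obtain rfl : h = h' := congrArg Prod.fst (h2.2.symm.trans h2'.2)
  exact Set.disjoint_left.1 hS h1 h1'

theorem Ttotal_eq (n : ℕ) (w : List Gen) :
    Ttotal n w = (crossSet n {h | h ≠ .a} w).ncard := by
  have : {h : Kind | h ≠ .a} = ({.b} ∪ {.c}) ∪ {.d} := by
    ext h
    cases h <;> simp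
  rw [this, ncard_crossSet_union _ (by simp), ncard_crossSet_union _ (by simp), Ttotal, T_eq, T_eq,
    T_eq]
  rfl

/-- Every element of the four-group but the identity is in the complement of exactly two of the
three kernels. -/
theorem sum_ncard_crossSet_lab (n : ℕ) (w : List Gen) :
    (crossSet n {h | lab 0 h = true} w).ncard + (crossSet n {h | lab 1 h = true} w).ncard +
      (crossSet n {h | lab 2 h = true} w).ncard = 2 * Ttotal n w := by
  have h0 : {h : Kind | lab 0 h = true} = {.b} ∪ {.c} := by
    ext h
    cases h <;> simp [lab]
  have h1 : {h : Kind | lab 1 h = true} = {.b} ∪ {.d} := by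
    ext h
    cases h <;> simp [lab]
  have h2 : {h : Kind | lab 2 h = true} = {.c} ∪ {.d} := by
    ext h
    cases h <;> simp [lab]
  rw [h0, h1, h2, ncard_crossSet_union _ (by simp), ncard_crossSet_union _ (by simp),
    ncard_crossSet_union _ (by simp), Ttotal, T_eq, T_eq, T_eq]
  simp only [Branch.kind]
  ring

theorem mwalk_snd_le (i : ℕ) (σ : Kind × ℕ) (u : List Gen) (k : ℕ) (hk : k < u.length) :
    (mwalk i σ (u.take (k + 1))).2 ≤ (mwalk i σ (u.take k)).2 + 1 ∧
      (mwalk i σ (u.take k)).2 ≤ (mwalk i σ (u.take (k + 1))).2 + 1 := by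
  rw [mwalk_take_succ i σ u hk]
  generalize mwalk i σ (u.take k) = σ
  rw [mstep]
  split_ifs with h
  · simp only [h.1]
    omega
  · exact step_le _ _ _

theorem mwalk_fst_of_pos {i : ℕ} {σ : Kind × ℕ} {u : List Gen} {k : ℕ} (hk : k ≤ u.length)
    (h : ∀ j < k, 0 < (mwalk i σ (u.take j)).2) : (mwalk i σ (u.take k)).1 = σ.1 := by
  induction k with
  | zero => rfl
  | succ k ih =>
    rw [mwalk_take_succ _ _ _ (by omega), mstep_of_pos (h k (by omega))]
    exact ih (by omega) fun j hj => h j (by omega)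

/-- The branch can change only at position 0. -/
theorem Crosses.exists_eq_zero {n : ℕ} {h : Kind} {u : List Gen} (H : Crosses n h u) (hh : h ≠ .a) :
    ∃ t < u.length, (mwalk (n % 3) (.a, len n) (u.take t)).2 = 0 := by
  by_contra hcon
  push Not at hcon
  have := mwalk_fst_of_pos le_rfl fun j hj => Nat.pos_of_ne_zero (hcon j hj)
  rw [List.take_length, H.2] at this
  exact hh this

theorem Crosses.len_le {n : ℕ} {h : Kind} {u : List Gen} (H : Crosses n h u) (hh : h ≠ .a) :
    len n ≤ u.length := by
  obtain ⟨t, ht, h0⟩ := H.exists_eq_zero hh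
  have : ∀ k ≤ u.length, len n ≤ (mwalk (n % 3) (.a, len n) (u.take k)).2 + k := by
    intro k
    induction k with
    | zero => intro _; exact le_rfl
    | succ k ih =>
      intro hk
      have h1 := ih (by omega)
      have h2 := (mwalk_snd_le (n % 3) (.a, len n) u k (by omega)).2
      omega
  have := this t ht.le
  omega

theorem Ttotal_eq_zero {n : ℕ} {w : List Gen} (h : w.length + 1 < n) : Ttotal n w = 0 := by
  rw [Ttotal_eq, Set.ncard_eq_zero (crossSet_finite _ _ _), Set.eq_empty_iff_forall_notMem]
  rintro ⟨p, q⟩ ⟨h1, h2, g, hg, H⟩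
  have h3 := H.len_le hg
  have h4 := le_len_add_one n
  rw [length_slice h2] at h3
  simp only at h1 h2 h3
  omega

/-- A crossing is strictly inside until it ends, so its start determines its end. -/
theorem Crosses.end_le {n p q q' : ℕ} {w : List Gen} {h h' : Kind} (hq' : q' ≤ w.length)
    (hpq : p < q) (H : Crosses n h (slice w p q)) (H' : Crosses n h' (slice w p q')) :
    q' ≤ q := by
  by_contra hlt
  have := H'.1 (q - p) (by omega) (by rw [length_slice hq']; omega)
  rw [slice_take (by omega), show p + (q - p) = q by omega, H.2] at this
  exact lt_irrefl _ this

theorem Ttotal_le_length (n : ℕ) (w : List Gen) : Ttotal n w ≤ w.length := by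
  rw [Ttotal_eq]
  have := Set.ncard_le_ncard_of_injOn (s := crossSet n {h | h ≠ .a} w) (t := Finset.range w.length)
    Prod.fst (fun p hp => by simpa using lt_of_lt_of_le hp.1 hp.2.1) ?_ (Finset.finite_toSet _)
  · rwa [Set.ncard_coe_finset, Finset.card_range] at this
  · rintro ⟨p, q⟩ ⟨h1, h2, h, hh, H⟩ ⟨p', q'⟩ ⟨h1', h2', h', hh', H'⟩ (rfl : p = p')
    exact Prod.ext rfl (le_antisymm (H'.end_le h2 h1' H) (H.end_le h2' h1 H'))

/-! ### From crossings of level `m + 2` to crossings of level `n` -/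

theorem bubble_lam {n m : ℕ} (hn : 3 ≤ n) (hnm : n ≤ m) (h : m % 3 = n % 3) :
    Bubble (lam ((m + 2) % 3)) (len m) n m := by
  have hl := le_len_add_one n
  have h1 := len_add_two m
  have h2 := len_le_succ m
  have h3 := len_mono hnm
  refine ⟨by omega, h, by omega, h3, ?_, fun k hk => ?_, fun k hk => ?_⟩
  · rw [lam_mod (by omega), sg_add_two_len]
  · rw [lam_mod (by omega), sg_bubble_right (by omega) hnm h hk]
  · rw [lam_mod (by omega), sg_bubble_left hnm h hk]

/-- Before its first visit to 0 the walk stays on the branch `1` and has to cross `I_n⁻¹ e_m I_n`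
downward. The state at the start of the first such crossing is recorded, since it makes the choice
injective. -/
theorem Crosses.exists_sub {n m p q : ℕ} {w : List Gen} {g : Kind} (hn : 3 ≤ n) (hnm : n ≤ m)
    (hm : m % 3 = n % 3) (hpq : p < q) (hq : q ≤ w.length) (hg : g ≠ .a)
    (H : Crosses (m + 2) g (slice w p q)) :
    ∃ p' q', p ≤ p' ∧ p' < q' ∧ q' ≤ q ∧
      mwalk ((m + 2) % 3) (.a, len (m + 2)) (slice w p p') = (.a, len m + 1 + len n) ∧
      ∃ h, lab (m / 3 % 3) h = true ∧ Crosses n h (slice w p' q') := by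
  have B := bubble_lam hn hnm hm
  obtain ⟨t, ht, h0⟩ := H.exists_eq_zero hg
  have h1 := len_add_two m
  have h2 := len_le_succ m
  have h3 := len_mono hnm
  have hlen := length_slice (p := p) hq
  obtain ⟨p₀, q₀, hpq₀, hq₀, ho, hι, hbet, hpos⟩ := exists_crossing_down
    (y := fun k => (mwalk ((m + 2) % 3) (.a, len (m + 2)) ((slice w p q).take k)).2) (t₁ := t)
    (fun k hk => mwalk_snd_le _ _ _ k (by omega)) (a := len m - len n) (b := len m + 1 + len n)
    (by omega) (by simp only [List.take_zero, mwalk, List.foldl_nil]; omega)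
    (by rw [h0]; omega)
  have hst : ∀ k ≤ q₀, (mwalk ((m + 2) % 3) (.a, len (m + 2)) ((slice w p q).take k)).1 = .a :=
    fun k hk => mwalk_fst_of_pos (σ := (.a, len (m + 2))) (by omega)
      fun j hj => by have := hpos j (by omega); omega
  set σ := fun k => mwalk ((m + 2) % 3) (.a, len (m + 2)) ((slice w p q).take k) with hσ
  have hl : ∀ k, p₀ + k ≤ q₀ →
      lwalk (lam ((m + 2) % 3)) (len m + 1 + len n) ((slice w (p + p₀) (p + q₀)).take k) =
        (σ (p₀ + k)).2 := by
    intro k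
    induction k with
    | zero => intro _; exact ho.symm
    | succ k ih =>
      intro hk
      have hl1 := length_slice (w := w) (p := p + p₀) (q := p + q₀) (by omega)
      have e : (slice w (p + p₀) (p + q₀))[k]'(by omega) =
          (slice w p q)[p₀ + k]'(by omega) := by
        simp only [slice, List.getElem_take, List.getElem_drop]
        congr 1
        omega
      have hp0 := hpos (p₀ + k) (by omega)
      rw [lwalk_take_succ _ _ _ (by omega), ih (by omega), e, hσ, ← add_assoc]
      simp only
      rw [mwalk_take_succ _ _ _ (by omega), mstep_of_pos (by omega)]
  have hproj : proj (len m) m (.a, len n) = len m + 1 + len n := by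
    simp [proj, lab]
  have hlast := hl (q₀ - p₀) (by omega)
  rw [List.take_of_length_le (by rw [length_slice (by omega)]; omega),
    show p₀ + (q₀ - p₀) = q₀ by omega] at hlast
  have hι' : (σ q₀).2 = len m - len n := hι
  refine ⟨p + p₀, p + q₀, by omega, by omega, by omega, ?_,
    B.exists_crosses (h₀ := .a) ?_ ?_ ?_⟩
  · have := slice_take (w := w) (p := p) (q := q) (k := p₀) (by omega)
    rw [← this]
    exact Prod.ext (hst p₀ hpq₀.le) ho
  · intro k hk hk'
    rw [length_slice (by omega)] at hk'
    rw [hproj, hl k (by omega)]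
    exact hbet (p₀ + k) (by omega) (by omega)
  · rw [hproj, hlast]
    exact Or.inl hι'
  · rw [hproj, hlast, hι']
    omega

/-- By invertibility, equal states at `p'` force equal states earlier. If `p₁ < p₂`, the first
crossing would be at the far endpoint at time `p₂`, in its interior. -/
theorem Crosses.start_le {N p₁ p₂ q₁ p' : ℕ} {w : List Gen} {h₁ : Kind} {o : Kind × ℕ}
    (hq₁ : q₁ ≤ w.length) (H₁ : Crosses N h₁ (slice w p₁ q₁)) (hp1 : p₁ ≤ p') (hp2 : p₂ ≤ p')
    (hp' : p' < q₁) (e₁ : mwalk (N % 3) (.a, len N) (slice w p₁ p') = o)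
    (e₂ : mwalk (N % 3) (.a, len N) (slice w p₂ p') = o) : p₂ ≤ p₁ := by
  by_contra hlt
  rw [← slice_append (show p₁ ≤ p₂ by omega) hp2, mwalk_append, ← e₂] at e₁
  have h1 := mwalk_injective N _ e₁
  have := H₁.1 (p₂ - p₁) (by omega) (by rw [length_slice hq₁]; omega)
  rw [slice_take (by omega), show p₁ + (p₂ - p₁) = p₂ by omega, h1] at this
  exact lt_irrefl _ this

theorem Ttotal_add_two_le {n m : ℕ} (hn : 3 ≤ n) (hnm : n ≤ m) (hm : m % 3 = n % 3)
    (w : List Gen) :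
    Ttotal (m + 2) w ≤ (crossSet n {h | lab (m / 3 % 3) h = true} w).ncard := by
  classical
  rw [Ttotal_eq]
  have hex : ∀ x ∈ crossSet (m + 2) {h | h ≠ .a} w, ∃ y : ℕ × ℕ,
      x.1 ≤ y.1 ∧ y.1 < y.2 ∧ y.2 ≤ x.2 ∧
      mwalk ((m + 2) % 3) (.a, len (m + 2)) (slice w x.1 y.1) = (.a, len m + 1 + len n) ∧
      ∃ h, lab (m / 3 % 3) h = true ∧ Crosses n h (slice w y.1 y.2) := by
    rintro ⟨p, q⟩ ⟨h1, h2, g, hg, H⟩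
    obtain ⟨p', q', h⟩ := H.exists_sub hn hnm hm h1 h2 hg
    exact ⟨(p', q'), h⟩
  choose! f hf using hex
  refine Set.ncard_le_ncard_of_injOn f ?_ ?_ (crossSet_finite _ _ _)
  · intro x hx
    obtain ⟨h1, h2, h3, -, h, h4, h5⟩ := hf x hx
    exact ⟨h2, h3.trans hx.2.1, h, h4, h5⟩
  · rintro ⟨p₁, q₁⟩ hx ⟨p₂, q₂⟩ hy hxy
    obtain ⟨a1, a2, a3, a4, -⟩ := hf _ hx
    obtain ⟨b1, b2, b3, b4, -⟩ := hf _ hy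
    obtain ⟨hx1, hx2, g, -, G⟩ := hx
    obtain ⟨hy1, hy2, g', -, G'⟩ := hy
    rw [← hxy] at b1 b2 b3 b4
    simp only at *
    obtain rfl : p₁ = p₂ := le_antisymm
      (G'.start_le hy2 b1 a1 (by omega) b4 a4) (G.start_le hx2 a1 b1 (by omega) a4 b4)
    exact Prod.ext rfl (le_antisymm (G'.end_le hx2 hy1 G) (G.end_le hy2 hx1 G'))

/-- Increasing `m` by 3 shifts the homomorphism of `e_m` cyclically. The levels `n, n + 3, n + 6`
thus use the three homomorphisms once each, and their contributions add up to `2 * Ttotal n w`. -/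
theorem Ttotal_add_le {n : ℕ} (hn : 3 ≤ n) (w : List Gen) :
    Ttotal (n + 2) w + Ttotal (n + 5) w + Ttotal (n + 8) w ≤ 2 * Ttotal n w := by
  rw [← sum_ncard_crossSet_lab]
  have h0 := Ttotal_add_two_le hn (m := n) le_rfl rfl w
  have h1 : Ttotal (n + 5) w ≤ _ := Ttotal_add_two_le hn (m := n + 3) (by omega) (by omega) w
  have h2 : Ttotal (n + 8) w ≤ _ := Ttotal_add_two_le hn (m := n + 6) (by omega) (by omega) w
  rw [show (n + 3) / 3 = n / 3 + 1 by omega] at h1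
  rw [show (n + 6) / 3 = n / 3 + 2 by omega] at h2
  generalize n / 3 = k at *
  have : k % 3 = 0 ∧ (k + 1) % 3 = 1 ∧ (k + 2) % 3 = 2 ∨
      k % 3 = 1 ∧ (k + 1) % 3 = 2 ∧ (k + 2) % 3 = 0 ∨
      k % 3 = 2 ∧ (k + 1) % 3 = 0 ∧ (k + 2) % 3 = 1 := by omega
  rcases this with ⟨e0, e1, e2⟩ | ⟨e0, e1, e2⟩ | ⟨e0, e1, e2⟩ <;>
    rw [e0] at h0 <;> rw [e1] at h1 <;> rw [e2] at h2 <;> omega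

/-! ### The inequality for the generating functions -/

theorem F_eq_sum (w : List Gen) (i : Fin 3) (t : ℝ) {K : ℕ} (hK : w.length + 2 ≤ 3 * K) :
    F w i t = ∑ k ∈ Finset.range K, (Ttotal (3 * k + i.val) w : ℝ) * t ^ (3 * k + i.val) := by
  rw [F]
  apply finsum_eq_sum_of_support_subset
  intro k hk
  rw [Function.mem_support] at hk
  rw [Finset.coe_range, Set.mem_Iio]
  by_contra hlt
  exact hk (by rw [Ttotal_eq_zero (by omega)]; simp)

/-- The polynomials in the inequality for the generating functions. -/
noncomputable def correction (i : Fin 3) : Polynomial ℝ :=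
  ∑ k ∈ Finset.range 4, Polynomial.X ^ (3 * k + i.val)

theorem correction_eval (i : Fin 3) (t : ℝ) :
    (correction i).eval t = ∑ k ∈ Finset.range 4, t ^ (3 * k + i.val) := by
  simp [correction, Polynomial.eval_finsetSum]

theorem sum_range_le_add_sum_shift {c : ℕ → ℝ} (hc : ∀ k, 0 ≤ c k) (K : ℕ) {s : ℕ} (hs : s ≤ 3) :
    ∑ k ∈ Finset.range K, c k ≤
      ∑ k ∈ Finset.range 4, c k + ∑ j ∈ Finset.range K, c (1 + s + j) := by
  calc ∑ k ∈ Finset.range K, c k ≤ ∑ k ∈ Finset.range (1 + s + K), c k :=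
        Finset.sum_le_sum_of_subset_of_nonneg (Finset.range_mono (by omega)) fun k _ _ => hc k
    _ = ∑ k ∈ Finset.range (1 + s), c k + ∑ j ∈ Finset.range K, c (1 + s + j) :=
        Finset.sum_range_add _ _ _
    _ ≤ _ := by
        have := Finset.sum_le_sum_of_subset_of_nonneg
          (Finset.range_mono (show 1 + s ≤ 4 by omega)) fun k _ _ => hc k
        linarith

/-- The number `e` records the wrap-around of `i - 2` modulo 3. Comparison starts at level `3 + i'`,
as `Ttotal_add_le` needs level 3. The three shifted sums omit at most four initial terms, which is
the number of terms of `correction`. -/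
theorem F_inequality_aux (w : List Gen) {t : ℝ} (ht : 0 < t) (i i' : Fin 3) (e : ℕ) (he : e ≤ 1)
    (hi : 3 * e + i.val = i'.val + 2) :
    (t ^ (-8 : ℤ) + t ^ (-5 : ℤ) + t ^ (-2 : ℤ)) * (F w i t - (correction i).eval t * w.length) ≤
      2 * F w i' t := by
  obtain ⟨K, hK⟩ : ∃ K, K = w.length + 2 := ⟨_, rfl⟩
  set c : ℕ → ℝ := fun k => (Ttotal (3 * k + i.val) w : ℝ) * t ^ (3 * k + i.val) with hc
  set d : ℕ → ℝ := fun k => (Ttotal (3 * k + i'.val) w : ℝ) * t ^ (3 * k + i'.val) with hd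
  have hc0 : ∀ k, 0 ≤ c k := fun k => by positivity
  have hd0 : ∀ k, 0 ≤ d k := fun k => by positivity
  have hF : F w i t = ∑ k ∈ Finset.range K, c k := F_eq_sum w i t (by omega)
  have hF' : F w i' t = ∑ k ∈ Finset.range (1 + K), d k := F_eq_sum w i' t (by omega)
  have h4 : ∑ k ∈ Finset.range 4, c k ≤ (correction i).eval t * w.length := by
    rw [correction_eval, Finset.sum_mul]
    refine Finset.sum_le_sum fun k _ => ?_
    have : (Ttotal (3 * k + i.val) w : ℝ) ≤ w.length := by
      exact_mod_cast Ttotal_le_length _ w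
    rw [mul_comm]
    exact mul_le_mul_of_nonneg_right this (by positivity)
  have hshift : ∀ s ≤ 3, F w i t - (correction i).eval t * w.length ≤
      ∑ j ∈ Finset.range K, c (1 + s + j) := by
    intro s hs
    have := sum_range_le_add_sum_shift hc0 K hs
    rw [hF]
    linarith
  have hterm : ∀ j, t ^ (-8 : ℤ) * c (1 + (e + 2) + j) + t ^ (-5 : ℤ) * c (1 + (e + 1) + j) +
      t ^ (-2 : ℤ) * c (1 + e + j) ≤ 2 * d (1 + j) := by
    intro j
    set n := 3 * (1 + j) + i'.val with hn
    have e8 : 3 * (1 + (e + 2) + j) + i.val = n + 8 := by omega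
    have e5 : 3 * (1 + (e + 1) + j) + i.val = n + 5 := by omega
    have e2 : 3 * (1 + e + j) + i.val = n + 2 := by omega
    simp only [hc, hd, e8, e5, e2]
    have hz : ∀ r : ℕ, t ^ (-(r : ℤ)) * t ^ (n + r) = t ^ n := by
      intro r
      rw [zpow_neg, zpow_natCast, pow_add]
      field_simp
    have hz8 := hz 8
    have hz5 := hz 5
    have hz2 := hz 2
    push_cast at hz8 hz5 hz2
    have hT := Ttotal_add_le (n := n) (by omega) w
    have hT' : (Ttotal (n + 2) w : ℝ) + Ttotal (n + 5) w + Ttotal (n + 8) w ≤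
        2 * Ttotal n w := by exact_mod_cast hT
    have htn : 0 < t ^ n := by positivity
    calc _ = Ttotal (n + 8) w * (t ^ (-8 : ℤ) * t ^ (n + 8)) +
          Ttotal (n + 5) w * (t ^ (-5 : ℤ) * t ^ (n + 5)) +
          Ttotal (n + 2) w * (t ^ (-2 : ℤ) * t ^ (n + 2)) := by ring
      _ = ((Ttotal (n + 2) w : ℝ) + Ttotal (n + 5) w + Ttotal (n + 8) w) * t ^ n := by
          rw [hz8, hz5, hz2]
          ring
      _ ≤ 2 * Ttotal n w * t ^ n := by gcongr
      _ = _ := by ring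
  have h8 : 0 ≤ t ^ (-8 : ℤ) := by positivity
  have h5 : 0 ≤ t ^ (-5 : ℤ) := by positivity
  have h2 : 0 ≤ t ^ (-2 : ℤ) := by positivity
  calc _ = t ^ (-8 : ℤ) * (F w i t - (correction i).eval t * w.length) +
        t ^ (-5 : ℤ) * (F w i t - (correction i).eval t * w.length) +
        t ^ (-2 : ℤ) * (F w i t - (correction i).eval t * w.length) := by ring
    _ ≤ t ^ (-8 : ℤ) * ∑ j ∈ Finset.range K, c (1 + (e + 2) + j) +
        t ^ (-5 : ℤ) * ∑ j ∈ Finset.range K, c (1 + (e + 1) + j) +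
        t ^ (-2 : ℤ) * ∑ j ∈ Finset.range K, c (1 + e + j) := by
        gcongr
        · exact hshift _ (by omega)
        · exact hshift _ (by omega)
        · exact hshift _ (by omega)
    _ = ∑ j ∈ Finset.range K, (t ^ (-8 : ℤ) * c (1 + (e + 2) + j) +
        t ^ (-5 : ℤ) * c (1 + (e + 1) + j) + t ^ (-2 : ℤ) * c (1 + e + j)) := by
        simp only [Finset.mul_sum, Finset.sum_add_distrib]
    _ ≤ ∑ j ∈ Finset.range K, 2 * d (1 + j) := Finset.sum_le_sum fun j _ => hterm j
    _ ≤ 2 * F w i' t := by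
        rw [hF', Finset.sum_range_add, ← Finset.mul_sum, mul_add]
        have : 0 ≤ ∑ k ∈ Finset.range 1, d k := Finset.sum_nonneg fun k _ => hd0 k
        linarith

theorem F_inequality (w : List Gen) {t : ℝ} (ht : 0 < t) (i : Fin 3) :
    (t ^ (-8 : ℤ) + t ^ (-5 : ℤ) + t ^ (-2 : ℤ)) * (F w i t - (correction i).eval t * w.length) ≤
      2 * F w (i - 2) t := by
  fin_cases i
  · exact F_inequality_aux w ht 0 (0 - 2) 1 le_rfl (by decide)
  · exact F_inequality_aux w ht 1 (1 - 2) 1 le_rfl (by decide)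
  · exact F_inequality_aux w ht 2 (2 - 2) 0 (by norm_num) (by decide)

theorem F_sum_inequality (w : List Gen) {t : ℝ} (ht : 0 < t) :
    (t ^ (-8 : ℤ) + t ^ (-5 : ℤ) + t ^ (-2 : ℤ)) *
        ((∑ i : Fin 3, F w i t) - (∑ i : Fin 3, (correction i).eval t) * w.length) ≤
      2 * ∑ i : Fin 3, F w i t := by
  have h := Finset.sum_le_sum fun i (_ : i ∈ Finset.univ) => F_inequality w ht i
  rw [← Finset.mul_sum, Finset.sum_sub_distrib, ← Finset.sum_mul, ← Finset.mul_sum] at h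
  have e : ∑ i : Fin 3, F w (i - 2) t = ∑ i : Fin 3, F w i t :=
    (Equiv.subRight (2 : Fin 3)).sum_comp fun i => F w i t
  rwa [e] at h

/-- At `t = 1.08` the factor on the left is at least 2.05, so the inequality for `F` turns into an
upper bound linear in the length. -/
theorem exists_Ttotal_le :
    ∃ C : ℝ, 0 ≤ C ∧ ∀ (n : ℕ) (w : List Gen), (Ttotal n w : ℝ) * 1.08 ^ n ≤ C * w.length := by
  set D : ℝ := ∑ i : Fin 3, (correction i).eval 1.08 with hD
  have hD0 : 0 ≤ D := Finset.sum_nonneg fun i _ => by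
    rw [correction_eval]
    positivity
  -- From `2.05 (S - A) ≤ 2 S` follows `S ≤ 41 A`; the constant 100 is generous.
  refine ⟨100 * D, by positivity, fun n w => ?_⟩
  have h := F_sum_inequality w (t := 1.08) (by norm_num)
  have hn : ∀ i, 0 ≤ F w i 1.08 := fun i => by
    rw [F_eq_sum w i 1.08 (K := w.length + 2) (by omega)]
    positivity
  have hle : (Ttotal n w : ℝ) * 1.08 ^ n ≤ ∑ i : Fin 3, F w i 1.08 := by
    set i : Fin 3 := ⟨n % 3, Nat.mod_lt _ (by norm_num)⟩
    refine le_trans ?_ (Finset.single_le_sum (fun i _ => hn i) (Finset.mem_univ i))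
    rw [F_eq_sum w i 1.08 (K := w.length + 2 + n) (by omega)]
    have := Finset.single_le_sum (s := Finset.range (w.length + 2 + n))
      (f := fun k => (Ttotal (3 * k + i.val) w : ℝ) * 1.08 ^ (3 * k + i.val))
      (fun k _ => by positivity) (Finset.mem_range.2 (show n / 3 < w.length + 2 + n by omega))
    refine le_trans (le_of_eq ?_) this
    rw [show 3 * (n / 3) + i.val = n from Nat.div_add_mod n 3]
  refine hle.trans ?_
  rw [← hD] at h
  set S : ℝ := ∑ i : Fin 3, F w i 1.08
  have hz : (2.05 : ℝ) ≤ (1.08 : ℝ) ^ (-8 : ℤ) + 1.08 ^ (-5 : ℤ) + 1.08 ^ (-2 : ℤ) := by norm_num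
  have hz' : (1.08 : ℝ) ^ (-8 : ℤ) + 1.08 ^ (-5 : ℤ) + 1.08 ^ (-2 : ℤ) ≤ 3 := by norm_num
  set z : ℝ := (1.08 : ℝ) ^ (-8 : ℤ) + 1.08 ^ (-5 : ℤ) + 1.08 ^ (-2 : ℤ)
  have hS : 0 ≤ S := Finset.sum_nonneg fun i _ => hn i
  have hDw : 0 ≤ D * w.length := by positivity
  rw [mul_assoc]
  generalize D * (w.length : ℝ) = A at *
  rcases le_or_gt S A with h1 | h1
  · linarith
  · have := mul_le_mul_of_nonneg_right hz (sub_nonneg.2 h1.le)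
    have := this.trans h
    linarith

/-! ### Continuity -/

theorem act₀_congr {x y : ℕ → Bool} (s : Kind) {k : ℕ} (h : ∀ j ≤ k + 1, x j = y j) :
    act₀ s x k = act₀ s y k := by
  induction k using Nat.strong_induction_on generalizing s x y with
  | _ k ih =>
    have h0 := h 0 (by omega)
    have h1 := h 1 (by omega)
    rcases k with _ | _ | _ | k
    · cases s <;> simp [act₀, h0, h1]
    · cases s <;> simp [act₀, h1]
    · have h2 := h 2 (by omega)
      cases s <;> simp [act₀, h2]
    · have h3 := h (k + 3) (by omega)
      have hd (s : Kind) := ih k (by omega) s (x := dropFirst 3 x) (y := dropFirst 3 y)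
        fun j hj => h (j + 3) (by omega)
      cases s <;> simp [act₀, h0, h1, h3, hd]

theorem act_congr {x y : ℕ → Bool} (g : Gen) {k : ℕ} (h : ∀ j ≤ k + 1, x j = y j) :
    act g x k = act g y k := by
  obtain ⟨s, i⟩ := g
  have h0 := h 0 (by omega)
  have h1 := h 1 (by omega)
  have hk := h k (by omega)
  fin_cases i
  · exact act₀_congr s h
  · change act (s, 1) x k = act (s, 1) y k
    simp only [act, h0]
    split_ifs
    · rcases k with _ | k
      · rfl
      · exact act₀_congr s fun j hj => h (j + 1) (by omega)
    · exact hk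
  · change act (s, 2) x k = act (s, 2) y k
    simp only [act, h0]
    split_ifs
    · exact hk
    · rcases k with _ | _ | k
      · rfl
      · exact h1
      · exact act₀_congr s fun j hj => h (j + 2) (by omega)

theorem continuous_gen (g : Gen) : Continuous (gen g) := by
  refine Continuous.subtype_mk (continuous_pi fun k => IsLocallyConstant.continuous ?_) _
  rw [IsLocallyConstant.iff_eventually_eq]
  intro x
  filter_upwards [eventually_agree x (k + 2)] with y hy
  exact act_congr g fun j hj => hy j (by omega)

theorem continuous_wordPerm (u : List Gen) : Continuous (wordPerm u) := by
  induction u with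
  | nil => exact continuous_id
  | cons s u ih => exact ih.comp (continuous_gen s)

/-! ### Singular points -/

theorem exists_eq_lpre_cons {x : ℕ → Bool} (hx : Admissible x) {i : Fin 3} (hi : InClass i.val x)
    (hne : x ≠ (xi i).1) :
    ∃ m t w, m % 3 = i.val ∧ x = lpre m (cons t (cons false w)) := by
  have hxi : x = lpre i.val (dropFirst i.val x) := by
    apply eq_lpre_of_agree
    intro k hk
    have h0 := hx 0
    fin_cases i
    · simp at hk
    · obtain rfl : k = 0 := by simp at hk; exact hk
      simpa using hi.1 rfl
    · have h2 : x 0 = true := hi.2 rfl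
      obtain rfl | rfl : k = 0 ∨ k = 1 := by simp at hk; omega
      · simpa using h2
      · simp [h2] at h0
        simpa using h0
  rcases exists_eq_lpre_or_eq_xi (hx.dropFirst i.val) with ⟨k, t, w, h⟩ | h
  · refine ⟨i.val + 3 * k, t, w, by omega, ?_⟩
    rw [lpre_add_mul, ← h, ← hxi]
  · rw [h, lpre_xi_zero i i.val (by omega)] at hxi
    exact absurd hxi hne

theorem act_lpre_cons_apply (s : Gen) {m : ℕ} (hs : s.2.val = m % 3) (t : Bool) (w : ℕ → Bool)
    {k : ℕ} (hk : m + 1 ≤ k) :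
    act s (lpre m (cons t (cons false w))) k = lpre m (cons t (cons false w)) k := by
  rw [act_lpre_cons s hs]
  split_ifs
  · obtain ⟨j, rfl⟩ : ∃ j, k = j + 1 + m := ⟨k - m - 1, by omega⟩
    rw [lpre_apply_add, lpre_apply_add]
    rfl
  · rfl

/-- In the support and away from `ξ_i`, the generator can change only the letter `m`, and the prefix
that determines `m` is constant near `x`. -/
theorem eventually_gen_apply {s : Gen} {x : Shift} (hx : x ≠ xi s.2) :
    ∃ N, ∀ᶠ y : Shift in 𝓝 x, ∀ k ≥ N, (gen s y).1 k = y.1 k := by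
  by_cases hs : InClass s.2.val x.1
  · obtain ⟨m, t, w, hm, hxm⟩ := exists_eq_lpre_cons x.2 hs fun h => hx (Subtype.ext h)
    refine ⟨m + 1, ?_⟩
    filter_upwards [eventually_agree x (m + 2)] with y hy k hk
    have hyl : y.1 = lpre m (cons t (cons false (dropFirst (m + 2) y.1))) := by
      funext j
      rcases Nat.lt_or_ge j (m + 2) with hj | hj
      · rw [hy j hj, hxm]
        rcases Nat.lt_or_ge j m with hjm | hjm
        · rw [lpre_apply_lt _ _ _ hjm, lpre_apply_lt _ _ _ hjm]
        · obtain ⟨r, rfl⟩ : ∃ r, j = r + m := ⟨j - m, by omega⟩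
          rw [lpre_apply_add, lpre_apply_add]
          obtain rfl | rfl : r = 0 ∨ r = 1 := by omega
          · rfl
          · rfl
      · obtain ⟨r, rfl⟩ : ∃ r, j = r + 2 + m := ⟨j - m - 2, by omega⟩
        rw [lpre_apply_add]
        exact congrArg y.1 (show r + 2 + m = r + (m + 2) by omega)
    change act s y.1 k = y.1 k
    rw [hyl]
    exact act_lpre_cons_apply s hm.symm _ _ hk
  · refine ⟨0, ?_⟩
    filter_upwards [eventually_agree x 1] with y hy k _
    have h0 := hy 0 one_pos
    change act s y.1 k = y.1 k
    rw [act_of_not_inClass]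
    rwa [InClass, h0]

theorem eventually_wordPerm_apply {x : Shift} (hx : ∀ i, ¬SameOrbit (xi i) x) (u : List Gen) :
    ∃ N, ∀ᶠ y : Shift in 𝓝 x, ∀ k ≥ N, (wordPerm u y).1 k = y.1 k := by
  induction u using List.reverseRecOn with
  | nil => exact ⟨0, Eventually.of_forall fun y k _ => rfl⟩
  | append_singleton u s ih =>
    obtain ⟨N, hN⟩ := ih
    have hne : wordPerm u x ≠ xi s.2 := by
      intro h
      refine hx s.2 ⟨(wordPerm u)⁻¹, inv_mem ((mem_G_iff _).2 ⟨u, rfl⟩), ?_⟩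
      rw [← h]
      exact (wordPerm u).symm_apply_apply x
    obtain ⟨N', hN'⟩ := eventually_gen_apply hne
    refine ⟨max N N', ?_⟩
    filter_upwards [hN, (continuous_wordPerm u).continuousAt.eventually hN'] with y h1 h2 k hk
    rw [wordPerm_append]
    exact (h2 k (le_of_max_le_right hk)).trans (h1 k (le_of_max_le_left hk))

theorem gen_b_xi (i : Fin 3) : gen (.b, i) (xi i) = xi i := by
  have hn : (i.val + 3) % 3 = i.val := by omega
  have h := Eventually.self_of_nhds (at_branch hn (by omega) .b)
  rw [dropFirst_xi i _ hn, vact_xi, vert_zero, lpre_xi_zero i _ hn] at h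
  exact Subtype.ext h

theorem not_eventually_gen_b (i : Fin 3) : ¬∀ᶠ y in 𝓝 (xi i), gen (.b, i) y = y := by
  intro h
  have hn : (i.val + 3) % 3 = i.val := by omega
  have h1 := at_branch hn (by omega) .b
  have h2 := (at_nil hn).congr (u' := [(.b, i)]) (Germ.coe_eq.2 (by
    filter_upwards [h] with y hy
    exact hy.symm))
  have := h1.unique hn h2 (Nat.zero_le _) (Nat.zero_le _)
  simp [Branch.kind] at this

/-- Off the three orbits, a word fixing `x` preserves the late letters nearby by the uniform bound
`N`, and the early ones by continuity. On the orbits, a conjugate of `b_i` shows singularity. -/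
theorem isSingular_iff (x : Shift) : IsSingular x ↔ ∃ i : Fin 3, SameOrbit (xi i) x := by
  constructor
  · rintro ⟨g, hg, hgx, hne⟩
    by_contra hcon
    push Not at hcon
    obtain ⟨u, rfl⟩ := (mem_G_iff g).1 hg
    obtain ⟨N, hN⟩ := eventually_wordPerm_apply hcon u
    apply hne
    filter_upwards [hN, eventually_agree x N,
      (continuous_wordPerm u).continuousAt.eventually (eventually_agree _ N)] with y h1 h2 h3
    apply Subtype.ext
    funext k
    rcases Nat.lt_or_ge k N with hk | hk
    · rw [h3 k hk, h2 k hk, hgx]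
    · exact h1 k hk
  · rintro ⟨i, g, hg, rfl⟩
    have hgen : gen (.b, i) ∈ G := Subgroup.subset_closure ⟨_, rfl⟩
    refine ⟨g * gen (.b, i) * g⁻¹, mul_mem (mul_mem hg hgen) (inv_mem hg), ?_, fun h => ?_⟩
    · simp [gen_b_xi]
    · obtain ⟨u, rfl⟩ := (mem_G_iff g).1 hg
      apply not_eventually_gen_b i
      filter_upwards [(continuous_wordPerm u).continuousAt.eventually h] with y hy
      simpa using hy

/-- Unlike the uniform version, this holds at every point, because a generator with index `i` fixes
`ξ_i`. Orbits therefore consist of sequences with a common tail. -/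
theorem exists_wordPerm_apply (u : List Gen) (x : Shift) :
    ∃ N, ∀ k ≥ N, (wordPerm u x).1 k = x.1 k := by
  induction u generalizing x with
  | nil => exact ⟨0, fun k _ => rfl⟩
  | cons s u ih =>
    obtain ⟨N, hN⟩ := ih (gen s x)
    by_cases hx : x = xi s.2
    · refine ⟨N, fun k hk => (hN k hk).trans ?_⟩
      have hn : (s.2.val + 3) % 3 = s.2.val := by omega
      change act s x.1 k = x.1 k
      rw [hx, ← lpre_xi_zero s.2 _ hn, act_lpre s (by omega) hn.symm, vact_xi]
    · obtain ⟨N', hN'⟩ := eventually_gen_apply hx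
      refine ⟨max N N', fun k hk => (hN k (le_of_max_le_left hk)).trans ?_⟩
      exact Eventually.self_of_nhds hN' k (le_of_max_le_right hk)

theorem eq_of_sameOrbit_xi {i j : Fin 3} (h : SameOrbit (xi i) (xi j)) : i = j := by
  obtain ⟨g, hg, hgx⟩ := h
  obtain ⟨u, rfl⟩ := (mem_G_iff g).1 hg
  obtain ⟨N, hN⟩ := exists_wordPerm_apply u (xi i)
  have := hN (3 * N + (i.val + 1) % 3) (by omega)
  rw [hgx] at this
  simp only [xi] at this
  rw [decide_eq_decide] at this
  apply Fin.ext
  omega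

/-! ### Paths in the orbital graphs -/

/-- The function that is `f` on `[0, l)` and continues with `g`. -/
def cat {α : Type*} (l : ℕ) (f g : ℕ → α) (j : ℕ) : α := if j < l then f j else g (j - l)

/-- The labels `f 0, …, f (l - 1)` in the reverse order. -/
def rev (l : ℕ) (f : ℕ → ℕ) (j : ℕ) : ℕ := f (l - 1 - j)

theorem cat_of_lt {α : Type*} {l : ℕ} {f g : ℕ → α} {j : ℕ} (h : j < l) : cat l f g j = f j :=
  if_pos h

theorem cat_add {α : Type*} (l : ℕ) (f g : ℕ → α) (j : ℕ) : cat l f g (l + j) = g j := by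
  rw [cat, if_neg (by omega), Nat.add_sub_cancel_left]

/-- `q 0, …, q l` is a path with labels `f 0, …, f (l - 1)`. -/
def IsPath (f : ℕ → ℕ) (q : ℕ → (ℕ → Bool)) (l : ℕ) : Prop :=
  ∀ j < l, Edge (f j) (q j) (q (j + 1))

theorem IsPath.cat {f f' : ℕ → ℕ} {q q' : ℕ → (ℕ → Bool)} {l l' : ℕ} (h : IsPath f q l)
    (h' : IsPath f' q' l') (hq : q l = q' 0) :
    IsPath (cat l f f') (cat l q q') (l + l') := by
  intro j hj
  rcases Nat.lt_or_ge j l with hl | hl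
  · rw [cat_of_lt hl, cat_of_lt hl]
    rcases Nat.lt_or_ge (j + 1) l with hl' | hl'
    · rw [cat_of_lt hl']
      exact h j hl
    · obtain rfl : l = j + 1 := by omega
      have := cat_add (j + 1) q q' 0
      rw [add_zero] at this
      rw [this, ← hq]
      exact h j hl
  · obtain ⟨i, rfl⟩ : ∃ i, j = l + i := ⟨j - l, by omega⟩
    rw [cat_add, cat_add, add_assoc, cat_add]
    exact h' i (by omega)

theorem IsPath.rev {f : ℕ → ℕ} {q : ℕ → (ℕ → Bool)} {l : ℕ} (h : IsPath f q l) :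
    IsPath (rev l f) (fun j => q (l - j)) l := by
  intro j hj
  have := (h (l - 1 - j) (by omega)).symm
  rw [show l - 1 - j + 1 = l - j by omega, show l - 1 - j = l - (j + 1) by omega] at this
  rwa [GoldenMean.rev, show l - 1 - j = l - (j + 1) by omega]

theorem isPath_edge {m : ℕ} {x y : ℕ → Bool} (h : Edge m x y) :
    IsPath (fun _ => m) (GoldenMean.cat 1 (fun _ => x) (fun _ => y)) 1 := by
  intro j hj
  obtain rfl : j = 0 := by omega
  exact h

theorem isPath_vert (n : ℕ) (w : ℕ → Bool) : IsPath (sg n) (fun j => vert n j w) (len n) :=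
  fun _ hj => edge_vert hj w

/-- Consecutive labels have different residues modulo `3`. -/
def Alternating (f : ℕ → ℕ) (l : ℕ) : Prop := ∀ j, j + 1 < l → f j % 3 ≠ f (j + 1) % 3

theorem Alternating.cat {f f' : ℕ → ℕ} {l l' : ℕ} (h : Alternating f l) (h' : Alternating f' l')
    (hj : 0 < l → 0 < l' → f (l - 1) % 3 ≠ f' 0 % 3) : Alternating (cat l f f') (l + l') := by
  intro j hj'
  rcases Nat.lt_or_ge j l with hl | hl
  · rw [cat_of_lt hl]
    rcases Nat.lt_or_ge (j + 1) l with hl' | hl'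
    · rw [cat_of_lt hl']
      exact h j hl'
    · obtain rfl : l = j + 1 := by omega
      have := cat_add (j + 1) f f' 0
      rw [add_zero] at this
      rw [this]
      exact hj (by omega) (by omega)
  · obtain ⟨i, rfl⟩ : ∃ i, j = l + i := ⟨j - l, by omega⟩
    rw [cat_add, add_assoc, cat_add]
    exact h' i (by omega)

theorem Alternating.rev {f : ℕ → ℕ} {l : ℕ} (h : Alternating f l) : Alternating (rev l f) l := by
  intro j hj
  have := (h (l - 1 - (j + 1)) (by omega)).symm
  rwa [show l - 1 - (j + 1) + 1 = l - 1 - j by omega] at this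

theorem alternating_one (f : ℕ → ℕ) : Alternating f 1 := fun j hj => by omega

theorem alternating_sg (n : ℕ) : Alternating (sg n) (len n) := fun _ hj => sg_succ_ne hj

theorem cat_zero_index {α : Type*} {l : ℕ} (f g : ℕ → α) (hl : 0 < l) : cat l f g 0 = f 0 :=
  cat_of_lt hl

theorem cat_last {α : Type*} {l l' : ℕ} (f g : ℕ → α) (hl : 0 < l') :
    cat l f g (l + l' - 1) = g (l' - 1) := by
  rw [show l + l' - 1 = l + (l' - 1) by omega, cat_add]

/-! ### Regions around the ends of the segments -/

/-- The labels of the segment `I_n⁻¹ e_m I_n`. -/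
def bubbleLab (n m : ℕ) : ℕ → ℕ :=
  cat (len n) (rev (len n) (sg n)) (cat 1 (fun _ => m) (sg n))

/-- The length of the segment `I_n⁻¹ e_m I_n`. -/
def bubbleLen (n : ℕ) : ℕ := len n + (1 + len n)

/-- The labels between two consecutive segments of the form `I_{n+1}⁻¹ e I_{n+1}`: one edge `e_m`
or `e_n I_n e_m I_n⁻¹ e_n`. -/
def gapLab (n : ℕ) (g : Bool) (m : ℕ) : ℕ → ℕ :=
  if g then fun _ => m
  else cat 1 (fun _ => n) (cat (len n) (sg n)
    (cat 1 (fun _ => m) (cat (len n) (rev (len n) (sg n)) fun _ => n)))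

/-- The number of edges between two consecutive segments `I_{n+1}⁻¹ e I_{n+1}`. -/
def gapLen (n : ℕ) (g : Bool) : ℕ :=
  if g then 1 else 1 + (len n + (1 + (len n + 1)))

/-- The labels of two consecutive segments `I_{n+1}⁻¹ e I_{n+1}` and of the gap between them. -/
def regionLab (n : ℕ) (g : Bool) (m m' m'' : ℕ) : ℕ → ℕ :=
  cat (bubbleLen (n + 1)) (bubbleLab (n + 1) m)
    (cat (gapLen n g) (gapLab n g m'') (bubbleLab (n + 1) m'))

/-- The number of edges of a region. -/
def regionLen (n : ℕ) (g : Bool) : ℕ := bubbleLen (n + 1) + (gapLen n g + bubbleLen (n + 1))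

theorem bubbleLab_ends {n m : ℕ} (hL : 0 < len n) :
    bubbleLab n m 0 % 3 ≠ (n + 2) % 3 ∧ bubbleLab n m (bubbleLen n - 1) % 3 ≠ (n + 2) % 3 := by
  have h := sg_ends n hL
  constructor
  · rw [bubbleLab, cat_zero_index _ _ hL, rev]
    exact h.2
  · rw [bubbleLab, bubbleLen, cat_last _ _ (by omega), cat_last _ _ hL]
    exact h.2

theorem alternating_bubbleLab {n m : ℕ} (hL : 0 < len n) (hm : m % 3 = n % 3) :
    Alternating (bubbleLab n m) (bubbleLen n) := by
  have h := sg_ends n hL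
  refine (alternating_sg n).rev.cat ((alternating_one _).cat (alternating_sg n) ?_) ?_
  · intro _ _
    rw [hm]
    exact h.1.symm
  · intro _ _
    rw [cat_zero_index _ _ one_pos, hm, rev, Nat.sub_self]
    exact h.1

theorem gapLen_pos (n : ℕ) (g : Bool) : 0 < gapLen n g := by
  rw [gapLen]
  split_ifs <;> omega

theorem gapLab_props {n m : ℕ} {g : Bool} (hL : 0 < len n)
    (hm : m % 3 = if g then n % 3 else (n + 2) % 3) :
    Alternating (gapLab n g m) (gapLen n g) ∧ gapLab n g m 0 % 3 = n % 3 ∧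
      gapLab n g m (gapLen n g - 1) % 3 = n % 3 := by
  have h := sg_ends n hL
  cases g
  · simp only [Bool.false_eq_true, if_false] at hm
    simp only [gapLab, gapLen, Bool.false_eq_true, if_false]
    refine ⟨(alternating_one _).cat ((alternating_sg n).cat ((alternating_one _).cat
      ((alternating_sg n).rev.cat (alternating_one _) ?_) ?_) ?_) ?_, ?_, ?_⟩
    · intro _ _
      rw [rev, show len n - 1 - (len n - 1) = 0 by omega]
      exact h.1
    · intro _ _
      rw [cat_zero_index _ _ hL, rev, hm]
      exact h.2.symm
    · intro _ _
      rw [cat_zero_index _ _ one_pos, hm]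
      exact h.2
    · intro _ _
      rw [cat_zero_index _ _ hL]
      exact h.1.symm
    · rw [cat_zero_index _ _ one_pos]
    · rw [cat_last _ _ (by omega), cat_last _ _ (by omega), cat_last _ _ (by omega),
        cat_last _ _ (by omega)]
  · simp only [if_true] at hm
    simp only [gapLab, gapLen, if_true]
    exact ⟨alternating_one _, hm, hm⟩

theorem bubbleLen_pos (n : ℕ) : 0 < bubbleLen n := by
  rw [bubbleLen]
  omega

theorem alternating_regionLab {n m m' m'' : ℕ} {g : Bool} (hL : 0 < len n)
    (hm : m % 3 = (n + 1) % 3) (hm' : m' % 3 = (n + 1) % 3)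
    (hm'' : m'' % 3 = if g then n % 3 else (n + 2) % 3) :
    Alternating (regionLab n g m m' m'') (regionLen n g) := by
  have hL1 : 0 < len (n + 1) := hL.trans_le (len_le_succ n)
  obtain ⟨h1, h2, h3⟩ := gapLab_props hL hm''
  refine (alternating_bubbleLab hL1 hm).cat (h1.cat (alternating_bubbleLab hL1 hm') ?_) ?_
  · intro _ _
    rw [h3]
    have := (bubbleLab_ends (m := m') hL1).1
    omega
  · intro _ _
    rw [cat_zero_index _ _ (gapLen_pos n g), h2]
    have := (bubbleLab_ends (m := m) hL1).2
    omega

theorem bubble_bubbleLab {f : ℕ → ℕ} {n m c : ℕ} (hL : 0 < len n) (hm3 : 3 ≤ m)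
    (hm : m % 3 = n % 3) (h : ∀ j < bubbleLen n, f (c + j) = bubbleLab n m j) :
    Bubble f (c + len n) n m := by
  rw [bubbleLen] at h
  refine ⟨hm3, hm, hL, by omega, ?_, fun k hk => ?_, fun k hk => ?_⟩
  · rw [h _ (by omega), bubbleLab]
    exact cat_add (len n) _ _ 0
  · rw [show c + len n + 1 + k = c + (len n + (1 + k)) by omega, h _ (by omega), bubbleLab,
      cat_add, cat_add, lam_mod hk]
  · rw [show c + len n - 1 - k = c + (len n - 1 - k) by omega, h _ (by omega), bubbleLab,
      cat_of_lt (by omega), rev, show len n - 1 - (len n - 1 - k) = k by omega, lam_mod hk]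

theorem regionLab_left {n m m' m'' : ℕ} {g : Bool} {j : ℕ} (hj : j < bubbleLen (n + 1)) :
    regionLab n g m m' m'' (0 + j) = bubbleLab (n + 1) m j := by
  rw [zero_add]
  exact cat_of_lt hj

theorem regionLab_right {n m m' m'' : ℕ} {g : Bool} (j : ℕ) :
    regionLab n g m m' m'' (bubbleLen (n + 1) + gapLen n g + j) = bubbleLab (n + 1) m' j := by
  rw [regionLab, add_assoc, cat_add, cat_add]

/-- Only `m` modulo 9 matters for `m ≥ 3`. Region types can thus store residues, and adding 9 to a
residue gives a representative that is large enough. -/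
theorem isLabel_congr {m m' : ℕ} (h : 3 ≤ m) (h' : 3 ≤ m') (hmm : m % 9 = m' % 9) (s : Gen) :
    IsLabel m s ↔ IsLabel m' s := by
  rw [isLabel_iff h, isLabel_iff h', show m % 3 = m' % 3 by omega,
    show m / 3 % 3 = m' / 3 % 3 by omega]

theorem isLabel_regionLab_congr {n : ℕ} {g : Bool} {m₁ m₂ m₃ k₁ k₂ k₃ : ℕ} {s : Gen}
    (h₁ : IsLabel m₁ s ↔ IsLabel k₁ s) (h₂ : IsLabel m₂ s ↔ IsLabel k₂ s)
    (h₃ : IsLabel m₃ s ↔ IsLabel k₃ s) (j : ℕ) :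
    IsLabel (regionLab n g m₁ m₂ m₃ j) s ↔ IsLabel (regionLab n g k₁ k₂ k₃ j) s := by
  cases g <;> simp only [regionLab, bubbleLab, gapLab, cat, Bool.false_eq_true, if_false, if_true]
    <;> split_ifs <;> first | rfl | assumption

theorem step_congr {f f' : ℕ → ℕ} {s : Gen} (h : ∀ j, IsLabel (f j) s ↔ IsLabel (f' j) s) (j : ℕ) :
    step f s j = step f' s j := by
  have h0 := h j
  have h1 := h (j - 1)
  rw [step, step]
  split_ifs <;> first | rfl | (exfalso; tauto)

theorem IsPath.act_step {f : ℕ → ℕ} {q : ℕ → (ℕ → Bool)} {l : ℕ} (h : IsPath f q l)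
    (hf : Alternating f l) {j : ℕ} (hj : 0 < j) (hjl : j < l) (s : Gen) :
    act s (q j) = q (step f s j) := by
  have h1 := h (j - 1) (by omega)
  have h2 := hf (j - 1) (by omega)
  rw [Nat.sub_add_cancel hj] at h1 h2
  exact GoldenMean.act_step hj h1 (h j hjl) h2 s

/-! ### Points with finitely many ones -/

/-- An admissible sequence with finitely many ones. -/
def Finitary (x : ℕ → Bool) : Prop := Admissible x ∧ ∃ N, ∀ k ≥ N, x k = false

theorem Finitary.cons_false {x : ℕ → Bool} (hx : Finitary x) (t : Bool) :
    Finitary (cons t (cons false x)) ∧ Finitary (cons false x) := by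
  obtain ⟨hx, N, hN⟩ := hx
  have h1 : Finitary (cons false x) := by
    refine ⟨admissible_cons hx (by simp), N + 1, fun k hk => ?_⟩
    obtain ⟨j, rfl⟩ : ∃ j, k = j + 1 := ⟨k - 1, by omega⟩
    exact hN j (by omega)
  refine ⟨⟨admissible_cons h1.1 (by simp [cons]), N + 2, fun k hk => ?_⟩, h1⟩
  obtain ⟨j, rfl⟩ : ∃ j, k = j + 2 := ⟨k - 2, by omega⟩
  exact hN j (by omega)

theorem Finitary.dropFirst {x : ℕ → Bool} (hx : Finitary x) (n : ℕ) : Finitary (dropFirst n x) := by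
  obtain ⟨hx, N, hN⟩ := hx
  exact ⟨hx.dropFirst n, N, fun k hk => hN _ (by omega)⟩

theorem Finitary.lpre {x : ℕ → Bool} (hx : Finitary x) (n : ℕ) : Finitary (lpre n x) := by
  obtain ⟨hx, N, hN⟩ := hx
  refine ⟨admissible_lpre n hx, N + n, fun k hk => ?_⟩
  obtain ⟨j, rfl⟩ : ∃ j, k = j + n := ⟨k - n, by omega⟩
  rw [lpre_apply_add]
  exact hN j (by omega)

/-- Infinitely many ones exclude `ξ_0`, so an edge is always available and lines through finitary
points do not end. -/
theorem Finitary.exists_eq_lpre {x : ℕ → Bool} (hx : Finitary x) :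
    ∃ k t w, Finitary w ∧ x = GoldenMean.lpre (3 * k) (cons t (cons false w)) := by
  rcases exists_eq_lpre_or_eq_xi hx.1 with ⟨k, t, w, h⟩ | h
  · refine ⟨k, t, w, ?_, h⟩
    have : GoldenMean.dropFirst 2 (GoldenMean.dropFirst (3 * k) x) = w := by
      rw [h, dropFirst_lpre]
      rfl
    rw [← this]
    exact (hx.dropFirst _).dropFirst _
  · obtain ⟨N, hN⟩ := hx.2
    have := hN (3 * N + 1) (by omega)
    rw [h] at this
    simp [xi, Nat.add_mod] at this

theorem edge_lpre_lpre (n k : ℕ) (t : Bool) (w : ℕ → Bool) :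
    Edge (n + 3 * k) (lpre n (lpre (3 * k) (cons t (cons false w))))
      (lpre n (lpre (3 * k) (cons (!t) (cons false w)))) :=
  ⟨t, w, (lpre_add_mul _ _ _).symm, (lpre_add_mul _ _ _).symm⟩

theorem Finitary.exists_edge {x : ℕ → Bool} (hx : Finitary x) :
    ∃ k y, Finitary y ∧ ∀ n, Edge (n + 3 * k) (GoldenMean.lpre n x) (GoldenMean.lpre n y) := by
  obtain ⟨k, t, w, hw, rfl⟩ := hx.exists_eq_lpre
  exact ⟨k, _, (hw.cons_false (!t)).1.lpre (3 * k), fun n => edge_lpre_lpre n k t w⟩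

/-- The common end of two segments of level `n + 1` or of level `n`. -/
def IsStation (n : ℕ) (x : ℕ → Bool) : Prop := ∃ z, Finitary z ∧ x = lpre n (cons false z)

/-- The region around the station `x`, up to the neglect of the precise values of large labels. -/
structure IsRegion (n : ℕ) (τ : Bool × Fin 9 × Fin 9 × Fin 9) (q : ℕ → (ℕ → Bool)) : Prop where
  act_eq : ∀ j, 0 < j → j < regionLen n τ.1 → ∀ s, act s (q j) =
    q (step (regionLab n τ.1 (τ.2.1 + 9) (τ.2.2.1 + 9) (τ.2.2.2 + 9)) s j)
  left : IsStation n (q 0)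
  right : IsStation n (q (regionLen n τ.1))
  mod_left : (τ.2.1 + 9 : ℕ) % 3 = (n + 1) % 3
  mod_right : (τ.2.2.1 + 9 : ℕ) % 3 = (n + 1) % 3

/-- If `z` starts with 1, the station sees a block `01…` and a single edge of class `n` leads to
another station. If `z = 0w`, the edge `e_n` leads to `lpre n (10w)`, then `I_n` to `lpre (n + 2)
w`, and after one edge the same way is travelled back. The last clause locates the first copy of
`I_n` in the second case. -/
theorem exists_gap {n : ℕ} (hn : 3 ≤ n) {z : ℕ → Bool} (hz : Finitary z) :
    ∃ (g : Bool) (m : ℕ) (q : ℕ → (ℕ → Bool)) (z' : ℕ → Bool), 3 ≤ m ∧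
      (m % 3 = if g then n % 3 else (n + 2) % 3) ∧
      IsPath (gapLab n g m) q (gapLen n g) ∧ q 0 = lpre n (cons false z) ∧
      q (gapLen n g) = lpre n (cons false z') ∧ Finitary z' ∧
      ∀ w, z = cons false w → ∀ j ≤ len n, 1 + j < gapLen n g ∧
        q (1 + j) = vert n j (cons true (cons false w)) := by
  obtain ⟨ν, rfl⟩ : ∃ ν, n = ν + 1 := ⟨n - 1, by omega⟩
  rcases hz0 : z 0
  · have hzw : z = cons false (dropFirst 1 z) := by
      funext k
      rcases k with _ | k
      · exact hz0
      · rfl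
    set w := dropFirst 1 z with hw
    have hwf : Finitary w := hz.dropFirst 1
    obtain ⟨k, w', hwf', he⟩ := hwf.exists_edge
    have hend (v : ℕ → Bool) : vert (ν + 1) (len (ν + 1)) (cons true (cons false v)) =
        lpre (ν + 3) v := vert_len ν _
    have e1 : Edge (ν + 1) (lpre (ν + 1) (cons false (cons false w)))
      (lpre (ν + 1) (cons true (cons false w))) := ⟨false, w, rfl, rfl⟩
    have e3 : Edge (ν + 1) (lpre (ν + 1) (cons true (cons false w')))
      (lpre (ν + 1) (cons false (cons false w'))) := ⟨true, w', rfl, rfl⟩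
    have p := (isPath_edge e1).cat ((isPath_vert (ν + 1) (cons true (cons false w))).cat
      ((isPath_edge (he (ν + 3))).cat ((isPath_vert (ν + 1) (cons true (cons false w'))).rev.cat
        (isPath_edge e3) ?_) ?_) ?_) ?_
    · refine ⟨false, ν + 3 + 3 * k, _, cons false w', by omega, ?_, p, ?_, ?_,
        (hwf'.cons_false false).2, ?_⟩
      · simp only [Bool.false_eq_true, if_false]
        omega
      · rw [cat_zero_index _ _ one_pos, cat_zero_index _ _ one_pos, hzw]
      · simp only [gapLen, Bool.false_eq_true, if_false]
        rw [cat_add, cat_add, cat_add, cat_add]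
        rfl
      · intro v hv j hj
        obtain rfl : w = v := by
          funext k
          exact (congrFun hzw (k + 1)).symm.trans (congrFun hv (k + 1))
        refine ⟨by simp only [gapLen, Bool.false_eq_true, if_false]; omega, ?_⟩
        rw [cat_add]
        rcases hj.lt_or_eq with hj | rfl
        · rw [cat_of_lt hj]
        · have := cat_add (len (ν + 1)) (fun j => vert (ν + 1) j (cons true (cons false w)))
            (cat 1 (cat 1 (fun _ => lpre (ν + 3) w) (fun _ => lpre (ν + 3) w'))
              (cat (len (ν + 1)) (fun j => vert (ν + 1) (len (ν + 1) - j)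
                (cons true (cons false w'))) (cat 1 (fun _ => lpre (ν + 1)
                  (cons true (cons false w'))) fun _ => lpre (ν + 1)
                    (cons false (cons false w'))))) 0
          rw [add_zero] at this
          rw [this, hend]
          rfl
    · simp only [Nat.sub_self, vert_zero]
      rfl
    · rw [cat_zero_index _ _ (by have := le_len_add_one (ν + 1); omega), Nat.sub_zero, hend]
      rfl
    · rw [hend]
      rfl
    · rw [cat_zero_index _ _ (by have := le_len_add_one (ν + 1); omega), vert_zero]
      rfl
  · have hzf := (hz.cons_false false).2
    obtain ⟨k, t, w, hwf, he⟩ := hzf.exists_eq_lpre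
    obtain ⟨k, rfl⟩ : ∃ j, k = j + 1 := by
      refine Nat.exists_eq_succ_of_ne_zero ?_
      rintro rfl
      have := congrFun he 1
      rw [cons_succ, hz0] at this
      exact absurd this (by simp [lpre, cons])
    have hE := edge_lpre_lpre (ν + 1) (k + 1) t w
    rw [← he, lpre_three_mul_succ] at hE
    set v := lpre (3 * k) (cons (!t) (cons false w)) with hv
    have hvf : Finitary v := (hwf.cons_false (!t)).1.lpre _
    refine ⟨true, ν + 1 + 3 * (k + 1), _, cons true (cons false v), by omega, ?_, isPath_edge hE,
      rfl, rfl, (hvf.cons_false true).1, ?_⟩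
    · simp only [if_true]
      omega
    · rintro w' rfl
      exact absurd hz0 (by simp [cons])

/-- The vertices of the segment `I_n⁻¹ e I_n` whose middle vertices are given by `z` and `z'`. -/
def bubbleVert (n : ℕ) (z z' : ℕ → Bool) : ℕ → (ℕ → Bool) :=
  cat (len n) (fun j => vert n (len n - j) z)
    (cat 1 (cat 1 (fun _ => lpre n z) (fun _ => lpre n z')) (fun j => vert n j z'))

theorem isPath_bubble {n m : ℕ} {z z' : ℕ → Bool} (h : Edge m (lpre n z) (lpre n z')) :
    IsPath (bubbleLab n m) (bubbleVert n z z') (bubbleLen n) := by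
  refine (isPath_vert n z).rev.cat ((isPath_edge h).cat (isPath_vert n z') ?_) ?_
  · simp only [vert_zero]
    rfl
  · simp only [Nat.sub_self, vert_zero]
    rw [cat_zero_index _ _ one_pos, cat_zero_index _ _ one_pos]

theorem bubbleVert_add (n : ℕ) (z z' : ℕ → Bool) (j : ℕ) :
    bubbleVert n z z' (len n + (1 + j)) = vert n j z' := by
  rw [bubbleVert, cat_add, cat_add]

theorem bubbleVert_bubbleLen (n : ℕ) (z z' : ℕ → Bool) :
    bubbleVert (n + 1) z z' (bubbleLen (n + 1)) = lpre n (cons false z') := by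
  rw [bubbleLen, bubbleVert_add, vert_len]

theorem bubbleVert_zero {n : ℕ} (hL : 0 < len (n + 1)) (z z' : ℕ → Bool) :
    bubbleVert (n + 1) z z' 0 = lpre n (cons false z) := by
  rw [bubbleVert, cat_zero_index _ _ hL, Nat.sub_zero, vert_len]

theorem exists_region {n : ℕ} (hn : 3 ≤ n) {z : ℕ → Bool} (hz : Finitary z) :
    ∃ τ q, IsRegion n τ q ∧ q (bubbleLen (n + 1)) = lpre n (cons false z) ∧
      (∀ j ≤ len (n + 1), ∃ i, 0 < i ∧ i < regionLen n τ.1 ∧ q i = vert (n + 1) j z) ∧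
      ∀ w, z = cons false w → ∀ j ≤ len n, ∃ i, 0 < i ∧ i < regionLen n τ.1 ∧
        q i = vert n j (cons true (cons false w)) := by
  have hL : 0 < len n := by have := le_len_add_one n; omega
  have hL1 : 0 < len (n + 1) := hL.trans_le (len_le_succ n)
  have hgp := gapLen_pos n
  have hbp := bubbleLen_pos (n + 1)
  obtain ⟨k, y, hy, he⟩ := hz.exists_edge
  obtain ⟨g, m, q, z', hm3, hm, hq, hq0, hql, hz', hcov⟩ := exists_gap hn hz
  obtain ⟨k', y', hy', he'⟩ := hz'.exists_edge
  have p : IsPath _ (cat (bubbleLen (n + 1)) (bubbleVert (n + 1) y z)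
      (cat (gapLen n g) q (bubbleVert (n + 1) z' y'))) _ :=
    (isPath_bubble (he (n + 1)).symm).cat
      (hq.cat (isPath_bubble (he' (n + 1))) (hql.trans (bubbleVert_zero hL1 _ _).symm))
      ((bubbleVert_bubbleLen _ _ _).trans
        (hq0.symm.trans (cat_zero_index _ _ (hgp g)).symm))
  have hc : cat (bubbleLen (n + 1)) (bubbleVert (n + 1) y z)
      (cat (gapLen n g) q (bubbleVert (n + 1) z' y')) (bubbleLen (n + 1)) =
        lpre n (cons false z) := by
    have := cat_add (bubbleLen (n + 1)) (bubbleVert (n + 1) y z)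
      (cat (gapLen n g) q (bubbleVert (n + 1) z' y')) 0
    rw [add_zero] at this
    rw [this, cat_zero_index _ _ (hgp g), hq0]
  have hreg : regionLen n g = bubbleLen (n + 1) + (gapLen n g + bubbleLen (n + 1)) := rfl
  have halt := alternating_regionLab hL (show (n + 1 + 3 * k) % 3 = (n + 1) % 3 by omega)
    (show (n + 1 + 3 * k') % 3 = (n + 1) % 3 by omega) hm
  refine ⟨(g, ⟨(n + 1 + 3 * k) % 9, Nat.mod_lt _ (by norm_num)⟩,
    ⟨(n + 1 + 3 * k') % 9, Nat.mod_lt _ (by norm_num)⟩, ⟨m % 9, Nat.mod_lt _ (by norm_num)⟩),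
    _, ⟨fun j hj hjl s => (p.act_step halt hj hjl s).trans ?_, ⟨y, hy, ?_⟩, ⟨y', hy', ?_⟩, ?_, ?_⟩,
    hc, ?_, ?_⟩
  · refine congrArg _ (step_congr (fun j => isLabel_regionLab_congr
      (isLabel_congr (by omega) (by omega) ?_ s) (isLabel_congr (by omega) (by omega) ?_ s)
      (isLabel_congr (by omega) (by omega) ?_ s) j) j)
    all_goals simp
  · rw [cat_zero_index _ _ hbp, bubbleVert_zero hL1]
  · simp only
    rw [hreg, cat_add, cat_add, bubbleVert_bubbleLen]
  · simp only
    omega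
  · simp only
    omega
  · intro j hj
    refine ⟨len (n + 1) + (1 + j), by omega, by simp only [hreg, bubbleLen]; omega, ?_⟩
    rcases hj.lt_or_eq with hj | rfl
    · rw [cat_of_lt (by rw [bubbleLen]; omega), bubbleVert_add]
    · rw [← bubbleLen, hc, vert_len]
  · intro w hw j hj
    obtain ⟨h1, h2⟩ := hcov w hw j hj
    refine ⟨bubbleLen (n + 1) + (1 + j), by omega, by simp only [hreg]; omega, ?_⟩
    rw [cat_add, cat_of_lt h1, h2]

/-- The letter number `n` decides: a point with `0` there lies on some `I_{n+1}` of a region, and a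
point with `1` lies on a copy of `I_n` in a gap. -/
theorem exists_region_of_finitary {n : ℕ} (hn : 3 ≤ n) {x : ℕ → Bool} (hx : Finitary x) :
    ∃ τ q i, IsRegion n τ q ∧ 0 < i ∧ i < regionLen n τ.1 ∧ q i = x := by
  rcases h : x n
  · obtain ⟨j, hj, hxj⟩ := exists_vert hx.1 h
    obtain ⟨τ, q, hq, -, h1, -⟩ := exists_region hn (hx.dropFirst (n + 1))
    obtain ⟨i, h2, h3, h4⟩ := h1 j hj
    exact ⟨τ, q, i, hq, h2, h3, h4.trans hxj.symm⟩
  · obtain ⟨ν, rfl⟩ : ∃ ν, n = ν + 1 := ⟨n - 1, by omega⟩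
    have hν : x ν = false := by
      have := hx.1 ν
      grind
    have hν2 : x (ν + 2) = false := by
      have := hx.1 (ν + 1)
      grind
    obtain ⟨j, hj, hxj⟩ := exists_vert hx.1 hν
    obtain ⟨τ, q, hq, -, -, h1⟩ := exists_region hn ((hx.dropFirst (ν + 3)).cons_false false).2
    obtain ⟨i, h2, h3, h4⟩ := h1 _ rfl j hj
    refine ⟨τ, q, i, hq, h2, h3, h4.trans ?_⟩
    have e : cons true (cons false (dropFirst (ν + 3) x)) = dropFirst (ν + 1) x := by
      funext k
      rcases k with _ | _ | k
      · simp [cons, dropFirst, h]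
      · simp only [cons, dropFirst]
        rw [show 0 + 1 + (ν + 1) = ν + 2 by omega, hν2]
      · simp only [cons, dropFirst]
        congr 1
        omega
    rw [e]
    exact hxj.symm

/-! ### Runs of a word in a region -/

/-- The run of the word `v` from the position `j` until it leaves the open interval `(0, l)`:
the number of letters that have been read and the last position. -/
noncomputable def run (f : ℕ → ℕ) (l : ℕ) : List Gen → ℕ → ℕ × ℕ
  | [], j => (0, j)
  | s :: v, j => if 0 < j ∧ j < l then ((run f l v (step f s j)).1 + 1, (run f l v (step f s j)).2)
      else (0, j)

theorem run_fst_le (f : ℕ → ℕ) (l : ℕ) (v : List Gen) (j : ℕ) :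
    (run f l v j).1 ≤ v.length := by
  induction v generalizing j with
  | nil => exact le_rfl
  | cons s v ih =>
    rw [run]
    split_ifs
    · exact Nat.succ_le_succ (ih _)
    · exact Nat.zero_le _

theorem run_snd_eq (f : ℕ → ℕ) (l : ℕ) (v : List Gen) (j : ℕ) :
    (run f l v j).2 = lwalk f j (v.take (run f l v j).1) := by
  induction v generalizing j with
  | nil => rfl
  | cons s v ih =>
    rw [run]
    split_ifs
    · simp only [List.take_succ_cons]
      exact ih _
    · rfl

theorem run_snd_le (f : ℕ → ℕ) {l : ℕ} (v : List Gen) {j : ℕ} (hj : j ≤ l) :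
    (run f l v j).2 ≤ l := by
  induction v generalizing j with
  | nil => exact hj
  | cons s v ih =>
    rw [run]
    split_ifs with h
    · exact ih (by have := (step_le f s j).1; omega)
    · exact hj

theorem run_snd_of_lt (f : ℕ → ℕ) {l : ℕ} (v : List Gen) {j : ℕ} (hj : j ≤ l)
    (h : (run f l v j).1 < v.length) : (run f l v j).2 = 0 ∨ (run f l v j).2 = l := by
  induction v generalizing j with
  | nil => exact absurd h (lt_irrefl _)
  | cons s v ih =>
    rw [run] at h ⊢
    split_ifs at h ⊢ with h'
    · exact ih (by have := (step_le f s j).1; omega) (Nat.lt_of_succ_lt_succ h)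
    · simp only
      omega

theorem lwalk_take_of_lt_run (f : ℕ → ℕ) {l : ℕ} (v : List Gen) {j k : ℕ}
    (hk : k < (run f l v j).1) :
    0 < lwalk f j (v.take k) ∧ lwalk f j (v.take k) < l := by
  induction v generalizing j k with
  | nil => exact absurd hk (Nat.not_lt_zero _)
  | cons s v ih =>
    rw [run] at hk
    split_ifs at hk with h
    · rcases k with _ | k
      · exact h
      · exact ih (Nat.lt_of_succ_lt_succ hk)
    · exact absurd hk (Nat.not_lt_zero _)

theorem run_fst_pos (f : ℕ → ℕ) {l : ℕ} {v : List Gen} {j : ℕ} (hj : 0 < j) (hjl : j < l)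
    (hv : v ≠ []) : 0 < (run f l v j).1 := by
  obtain ⟨s, v, rfl⟩ := List.exists_cons_of_ne_nil hv
  rw [run, if_pos ⟨hj, hjl⟩]
  exact Nat.succ_pos _

theorem wact_take_run {f : ℕ → ℕ} {l : ℕ} {q : ℕ → (ℕ → Bool)}
    (h : ∀ j, 0 < j → j < l → ∀ s, act s (q j) = q (step f s j)) (v : List Gen) (j : ℕ) :
    wact (v.take (run f l v j).1) (q j) = q (run f l v j).2 := by
  induction v generalizing j with
  | nil => rfl
  | cons s v ih =>
    rw [run]
    split_ifs with h'
    · simp only [List.take_succ_cons]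
      rw [← ih, ← h j h'.1 h'.2 s]
      rfl
    · rfl

/-! ### The data that determine an element of the group -/

/-- The combinatorial types of the regions of a given level. -/
abbrev RegionType : Type := Bool × Fin 9 × Fin 9 × Fin 9

/-- The run of a word in a region of the given level and type. -/
noncomputable def regionRun (n : ℕ) (τ : RegionType) (v : List Gen) (j : ℕ) : ℕ × ℕ :=
  run (regionLab n τ.1 (τ.2.1 + 9) (τ.2.2.1 + 9) (τ.2.2.2 + 9)) (regionLen n τ.1) v j

/-- The first points in time at which the word `w`, started inside of a region, leaves it. -/
def firstExits (n : ℕ) (w : List Gen) : Set ℕ :=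
  {r | ∃ τ j, 0 < j ∧ j < regionLen n τ.1 ∧ (regionRun n τ w j).1 = r}

/-- The points in time at which the word `w` can be in a station. -/
def stationTimes (n : ℕ) (w : List Gen) : Set ℕ :=
  firstExits n w ∪ Prod.snd '' crossSet (n + 1) {h | h ≠ .a} w

/-- The arguments of the runs from which the action of the word `w` is reconstructed. -/
def runKeys (n : ℕ) (w : List Gen) : Set (ℕ × RegionType × ℕ) :=
  {k | k.1 = 0 ∧ 0 < k.2.2 ∧ k.2.2 < regionLen n k.2.1.1 ∨
    k.1 ∈ stationTimes n w ∧ k.2.2 = bubbleLen (n + 1)}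

/-- The table of the runs from which the action of the word `w` is reconstructed. -/
noncomputable def runTable (n : ℕ) (w : List Gen) : Set ((ℕ × RegionType × ℕ) × ℕ × ℕ) :=
  (fun k => (k, regionRun n k.2.1 (w.drop k.1) k.2.2)) '' runKeys n w

theorem regionRun_eq_of_runTable_eq {n : ℕ} {w w' : List Gen} (h : runTable n w = runTable n w')
    {k : ℕ × RegionType × ℕ} (hk : k ∈ runKeys n w) :
    regionRun n k.2.1 (w.drop k.1) k.2.2 = regionRun n k.2.1 (w'.drop k.1) k.2.2 := by
  have : (k, regionRun n k.2.1 (w.drop k.1) k.2.2) ∈ runTable n w' := h ▸ ⟨k, hk, rfl⟩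
  obtain ⟨k', -, he⟩ := this
  obtain ⟨rfl, he⟩ := Prod.mk.inj he
  exact he.symm

theorem bubbleLen_lt_regionLen (n : ℕ) (g : Bool) : bubbleLen (n + 1) < regionLen n g := by
  have := gapLen_pos n g
  rw [regionLen]
  omega

/-- The run starts at the station between the first bubble and the gap. Leaving on the left crosses
the first bubble, leaving on the right crosses the second; either crossing lifts to a traverse of
level `n + 1` that ends at the exit time. -/
theorem mem_stationTimes_of_run {n : ℕ} (hn : 3 ≤ n) {τ : RegionType}
    (hl : (τ.2.1 + 9 : ℕ) % 3 = (n + 1) % 3) (hr : (τ.2.2.1 + 9 : ℕ) % 3 = (n + 1) % 3)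
    {w : List Gen} {t : ℕ} (ht : t ≤ w.length)
    (hlt : t + (regionRun n τ (w.drop t) (bubbleLen (n + 1))).1 < w.length) :
    t + (regionRun n τ (w.drop t) (bubbleLen (n + 1))).1 ∈ stationTimes n w := by
  set f := regionLab n τ.1 (τ.2.1 + 9) (τ.2.2.1 + 9) (τ.2.2.2 + 9) with hf
  set l := regionLen n τ.1 with hl'
  set β := bubbleLen (n + 1) with hβ
  set α := β + gapLen n τ.1 with hα
  have hlα : l = α + β := by rw [hα, hl', regionLen]; omega
  have hL : 0 < len (n + 1) := by have := le_len_add_one (n + 1); omega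
  have hβL : β = len (n + 1) + (1 + len (n + 1)) := rfl
  have hβl : β < l := bubbleLen_lt_regionLen n _
  set v := w.drop t with hv
  set r := (regionRun n τ v β).1 with hrr
  have hrw : r < v.length := by rw [hv, List.length_drop]; omega
  have hend : lwalk f β (v.take r) = 0 ∨ lwalk f β (v.take r) = l := by
    have e : (regionRun n τ v β).2 = lwalk f β (v.take r) := run_snd_eq _ _ _ _
    rw [← e]
    exact run_snd_of_lt f v hβl.le hrw
  have hin (k : ℕ) (hk : k < r) := lwalk_take_of_lt_run f v (j := β) (l := l) hk
  have hst (k : ℕ) (hk : k < r) := lwalk_take_le f β v k (hk.trans hrw)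
  have hsl (k : ℕ) : v.take k = slice w t (t + k) := by
    rw [slice, Nat.add_sub_cancel_left]
  have hsub (p q k : ℕ) (hk : p + k ≤ q) :
      lwalk f (lwalk f β (v.take p)) ((slice w (t + p) (t + q)).take k) =
        lwalk f β (v.take (p + k)) := by
    rw [slice_take (by omega), ← lwalk_append, hsl, hsl, slice_append (by omega) (by omega),
      add_assoc]
  have hlen (p q : ℕ) (hq : q ≤ r) : (slice w (t + p) (t + q)).length = q - p := by
    rw [length_slice (by omega)]
    omega
  have hsubl (p q : ℕ) (hpq : p < q) (hq : q ≤ r) :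
      lwalk f (lwalk f β (v.take p)) (slice w (t + p) (t + q)) = lwalk f β (v.take q) := by
    have := hsub p q (q - p) (by omega)
    rwa [List.take_of_length_le (hlen p q hq).le, show p + (q - p) = q by omega] at this
  right
  rcases hend with hend | hend
  · have B : Bubble f (0 + len (n + 1)) (n + 1) (τ.2.1 + 9) :=
      bubble_bubbleLab hL (by omega) hl fun j hj => regionLab_left hj
    obtain ⟨p, q, hpq, hq, hp1, hq1, hbet, -⟩ := exists_crossing_down
      (y := fun k => lwalk f β (v.take k)) hst (a := 0) (b := β) (by omega) le_rfl hend.le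
    -- An earlier end of the crossing would be an earlier exit from the region.
    have hqr : q = r := by
      by_contra hne
      have := (hin q (by omega)).1
      omega
    subst hqr
    have hproj : proj (0 + len (n + 1)) (τ.2.1 + 9) (.a, len (n + 1)) = β := by
      simp only [proj, lab, Bool.false_eq_true, if_false]
      omega
    obtain ⟨h, hh, H⟩ := B.exists_crosses (h₀ := .a) (u := slice w (t + p) (t + r)) (by
        intro k hk hk'
        rw [hlen p r le_rfl] at hk'
        rw [hproj]
        have e := hsub p r k (by omega)
        rw [hp1] at e
        rw [e]
        have := hbet (p + k) (by omega) (by omega)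
        omega) (by
        left
        have e := hsubl p r hpq le_rfl
        rw [hp1] at e
        rw [hproj, e, hq1]
        omega) (by
        have e := hsubl p r hpq le_rfl
        rw [hp1] at e
        rw [hproj, e, hq1]
        omega)
    refine ⟨(t + p, t + r), ⟨by simp only; omega, by simp only; omega, h, ?_, H⟩, rfl⟩
    rintro rfl
    simp [lab] at hh
  · have B : Bubble f (α + len (n + 1)) (n + 1) (τ.2.2.1 + 9) :=
      bubble_bubbleLab hL (by omega) hr fun j _ => regionLab_right j
    obtain ⟨p, q, hpq, hq, hp1, hq1, hbet⟩ := exists_crossing_up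
      (y := fun k => lwalk f β (v.take k)) hst (a := α) (b := l) (by omega)
      (by change β ≤ α; omega) hend.ge
    have hqr : q = r := by
      by_contra hne
      have := (hin q (by omega)).2
      omega
    subst hqr
    -- The second bubble is entered from its left end, so the lift has to start in a branch outside
    -- the kernel.
    obtain ⟨h₀, h₀l⟩ : ∃ h₀, lab (((τ.2.2.1 : ℕ) + 9) / 3 % 3) h₀ = true := by
      have : ((τ.2.2.1 : ℕ) + 9) / 3 % 3 < 3 := Nat.mod_lt _ (by norm_num)
      interval_cases ((τ.2.2.1 : ℕ) + 9) / 3 % 3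
      · exact ⟨.b, rfl⟩
      · exact ⟨.b, rfl⟩
      · exact ⟨.c, rfl⟩
    have hproj : proj (α + len (n + 1)) (τ.2.2.1 + 9) (h₀, len (n + 1)) = α := by
      simp only [proj, h₀l, if_true]
      omega
    obtain ⟨h, hh, H⟩ := B.exists_crosses (h₀ := h₀) (u := slice w (t + p) (t + r)) (by
        intro k hk hk'
        rw [hlen p r le_rfl] at hk'
        rw [hproj]
        have e := hsub p r k (by omega)
        rw [hp1] at e
        rw [e]
        have := hbet (p + k) (by omega) (by omega)
        omega) (by
        right
        have e := hsubl p r hpq le_rfl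
        rw [hp1] at e
        rw [hproj, e, hq1]
        omega) (by
        have e := hsubl p r hpq le_rfl
        rw [hp1] at e
        rw [hproj, e, hq1]
        omega)
    refine ⟨(t + p, t + r), ⟨by simp only; omega, by simp only; omega, h, ?_, H⟩, rfl⟩
    rintro rfl
    simp [lab] at hh

/-- Equal runs consume equally many letters and lead to the same point. Either both words are
exhausted or this point is a station, where the comparison continues. -/
theorem IsRegion.wact_eq {n : ℕ} {τ : RegionType} {q : ℕ → (ℕ → Bool)} (hq : IsRegion n τ q)
    {w w' : List Gen} (hw : w.length = w'.length) {t j : ℕ} (hj : j ≤ regionLen n τ.1)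
    (ht : t ≤ w.length) (he : regionRun n τ (w.drop t) j = regionRun n τ (w'.drop t) j)
    (h : ∀ t', t' = t + (regionRun n τ (w.drop t) j).1 → t' < w.length → ∀ x, IsStation n x →
      wact (w.drop t') x = wact (w'.drop t') x) :
    wact (w.drop t) (q j) = wact (w'.drop t) (q j) := by
  have e1 : wact ((w.drop t).take (regionRun n τ (w.drop t) j).1) (q j) =
    q (regionRun n τ (w.drop t) j).2 := wact_take_run hq.act_eq _ _
  have e2 : wact ((w'.drop t).take (regionRun n τ (w'.drop t) j).1) (q j) =
    q (regionRun n τ (w'.drop t) j).2 := wact_take_run hq.act_eq _ _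
  rw [← he] at e2
  have hle : (regionRun n τ (w.drop t) j).1 ≤ (w.drop t).length := run_fst_le _ _ _ _
  have hend : (regionRun n τ (w.drop t) j).1 < (w.drop t).length →
      (regionRun n τ (w.drop t) j).2 = 0 ∨ (regionRun n τ (w.drop t) j).2 = regionLen n τ.1 :=
    run_snd_of_lt _ _ hj
  rw [List.length_drop] at hle hend
  set r := (regionRun n τ (w.drop t) j).1
  have e3 : wact (w.drop t) (q j) = wact (w.drop (t + r)) (q (regionRun n τ (w.drop t) j).2) := by
    rw [← e1, ← wact_append, ← List.drop_drop, List.take_append_drop]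
  have e4 : wact (w'.drop t) (q j) = wact (w'.drop (t + r)) (q (regionRun n τ (w.drop t) j).2) := by
    rw [← e2, ← wact_append, ← List.drop_drop, List.take_append_drop]
  rw [e3, e4]
  rcases Nat.lt_or_ge (t + r) w.length with hlt | hge
  · refine h _ rfl hlt _ ?_
    rcases hend (by omega) with h0 | h0 <;> rw [h0]
    · exact hq.left
    · exact hq.right
  · have d1 : w.drop (t + r) = [] := List.drop_of_length_le hge
    have d2 : w'.drop (t + r) = [] := List.drop_of_length_le (hw ▸ hge)
    rw [d1, d2]

/-- Induction on the number of remaining letters: each run from a station is nonempty, and the time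
of the next exit is again a key of the table. -/
theorem wact_eq_of_runTable_eq {n : ℕ} (hn : 3 ≤ n) {w w' : List Gen}
    (hw : w.length = w'.length) (h : runTable n w = runTable n w') {x : ℕ → Bool}
    (hx : Finitary x) : wact w x = wact w' x := by
  have key : ∀ d t, w.length - t = d → t < w.length → t ∈ stationTimes n w → ∀ x, IsStation n x →
      wact (w.drop t) x = wact (w'.drop t) x := by
    intro d
    induction d using Nat.strong_induction_on with
    | _ d ih =>
      rintro t hd ht hts _ ⟨z, hz, rfl⟩
      obtain ⟨τ, q, hq, hqz, -⟩ := exists_region hn hz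
      rw [← hqz]
      have hβ := bubbleLen_lt_regionLen n τ.1
      refine hq.wact_eq hw hβ.le ht.le
        (regionRun_eq_of_runTable_eq h (k := (t, τ, bubbleLen (n + 1))) (Or.inr ⟨hts, rfl⟩)) ?_
      rintro t' rfl ht'
      have hpos : 0 < (regionRun n τ (w.drop t) (bubbleLen (n + 1))).1 := by
        refine run_fst_pos _ (bubbleLen_pos _) hβ fun h0 => ?_
        rw [List.drop_eq_nil_iff] at h0
        omega
      exact ih _ (by omega) _ rfl ht'
        (mem_stationTimes_of_run hn hq.mod_left hq.mod_right ht.le ht')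
  obtain ⟨τ, q, i, hq, hi, hil, rfl⟩ := exists_region_of_finitary hn hx
  refine hq.wact_eq (t := 0) hw hil.le (Nat.zero_le _)
    (regionRun_eq_of_runTable_eq h (k := (0, τ, i)) (Or.inl ⟨rfl, hi, hil⟩)) ?_
  rintro t' rfl ht'
  refine key _ _ rfl ht' (Or.inl ⟨τ, i, hi, hil, ?_⟩)
  rw [zero_add, List.drop_zero]

/-! ### From finitary points to the whole shift by density -/

theorem exists_finitary_agree (x : Shift) (K : ℕ) :
    ∃ y : Shift, Finitary y.1 ∧ ∀ k < K, y.1 k = x.1 k := by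
  have hy : Admissible fun k => decide (k < K) && x.1 k := by
    intro k hk
    simp only [Bool.and_eq_true] at hk
    exact x.2 k ⟨hk.1.2, hk.2.2⟩
  refine ⟨⟨_, hy⟩, ⟨hy, K, fun k hk => ?_⟩, fun k hk => ?_⟩
  · simp [hk.not_gt]
  · simp [hk]

theorem wordPerm_eq_of_runTable_eq {n : ℕ} (hn : 3 ≤ n) {w w' : List Gen}
    (hw : w.length = w'.length) (h : runTable n w = runTable n w') : wordPerm w = wordPerm w' := by
  have hd : Dense {y : Shift | Finitary y.1} := by
    intro x
    rw [mem_closure_iff_frequently]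
    intro hev
    obtain ⟨K, hK⟩ := eventually_nhds_iff_agree.1 hev
    obtain ⟨y, hy, hyK⟩ := exists_finitary_agree x K
    exact hK y hyK hy
  refine Equiv.coe_fn_injective
    ((continuous_wordPerm w).ext_on hd (continuous_wordPerm w') fun y hy => Subtype.ext ?_)
  rw [wordPerm_apply, wordPerm_apply]
  exact wact_eq_of_runTable_eq hn hw h hy

/-! ### Counting the elements of the group -/

/-- A set with at most `κ` elements in a finite set `U` is coded by `κ` elements of `U ∪ {none}`. -/
theorem ncard_le_of_injOn_set {α β : Type*} {S : Set α} {f : α → Set β} (U : Finset β) {κ : ℕ}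
    (hf : Set.InjOn f S) (hU : ∀ a ∈ S, f a ⊆ U) (hκ : ∀ a ∈ S, (f a).ncard ≤ κ) :
    S.ncard ≤ (U.card + 1) ^ κ := by
  classical
  have hex : ∀ a ∈ S, ∃ c : Fin κ → Option β, (∀ i, c i ∈ Finset.insertNone U) ∧
      f a = {u | ∃ i, c i = some u} := by
    intro a ha
    obtain ⟨s, hs⟩ := (U.finite_toSet.subset (hU a ha)).exists_finset_coe
    have hsκ := hκ a ha
    rw [← hs, Set.ncard_coe_finset] at hsκ
    let e : s → Fin κ := fun x => Fin.castLE hsκ (s.equivFin x)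
    have he : Function.Injective e :=
      (Fin.castLE_injective hsκ).comp s.equivFin.injective
    have hp := he.isPartialInv
    refine ⟨fun i => (Function.partialInv e i).map Subtype.val, fun i => ?_, ?_⟩
    · rw [Finset.mem_insertNone]
      intro u hu
      obtain ⟨x, -, rfl⟩ := Option.map_eq_some_iff.1 hu
      exact hU a ha (hs ▸ x.2)
    · ext u
      rw [← hs]
      constructor
      · intro hu
        refine ⟨e ⟨u, hu⟩, ?_⟩
        simp only [(hp ⟨u, hu⟩ _).2 rfl, Option.map_some]
      · rintro ⟨i, hi⟩
        obtain ⟨x, -, rfl⟩ := Option.map_eq_some_iff.1 hi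
        exact x.2
  choose! c hc hcf using hex
  have := Set.ncard_le_ncard_of_injOn (s := S)
    (t := Fintype.piFinset fun _ : Fin κ => Finset.insertNone U) c
    (fun a ha => Finset.mem_coe.2 (Fintype.mem_piFinset.2 (hc a ha)))
    (fun a ha b hb h => hf ha hb (by rw [hcf a ha, hcf b hb, h])) (Finset.finite_toSet _)
  rwa [Set.ncard_coe_finset, Fintype.card_piFinset_const, Finset.card_insertNone] at this

/-! ### The size of the tables -/

theorem regionLen_le (n : ℕ) (g : Bool) : regionLen n g ≤ 2 ^ (n + 4) := by
  have h1 := len_lt_two_pow (n + 1)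
  have h2 := len_le_succ n
  have h3 : gapLen n g ≤ 3 + 2 * len n := by
    rw [gapLen]
    split_ifs <;> omega
  rw [regionLen, bubbleLen, pow_add]
  rw [pow_add] at h1
  omega

theorem card_regionType : Fintype.card RegionType = 1458 := by
  simp [RegionType]

theorem firstExits_subset (n : ℕ) (w : List Gen) :
    firstExits n w ⊆ (fun k : RegionType × ℕ => (regionRun n k.1 w k.2).1) ''
      ((Finset.univ ×ˢ Finset.range (2 ^ (n + 4)) : Finset (RegionType × ℕ)) :
        Set (RegionType × ℕ)) := by
  rintro r ⟨τ, j, -, hj, rfl⟩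
  exact ⟨(τ, j), by simpa using hj.trans_le (regionLen_le n _), rfl⟩

theorem stationTimes_finite (n : ℕ) (w : List Gen) : (stationTimes n w).Finite :=
  (((Finset.finite_toSet _).image _).subset (firstExits_subset n w)).union
    ((crossSet_finite _ _ _).image _)

theorem ncard_stationTimes_le (n : ℕ) (w : List Gen) :
    (stationTimes n w).ncard ≤ 1458 * 2 ^ (n + 4) + Ttotal (n + 1) w := by
  refine (Set.ncard_union_le _ _).trans (add_le_add ?_ ?_)
  · refine (Set.ncard_le_ncard (firstExits_subset n w) ((Finset.finite_toSet _).image _)).trans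
      ((Set.ncard_image_le (Finset.finite_toSet _)).trans ?_)
    rw [Set.ncard_coe_finset, Finset.card_product, Finset.card_univ, card_regionType,
      Finset.card_range]
  · rw [Ttotal_eq]
    exact Set.ncard_image_le (crossSet_finite _ _ _)

theorem runKeys_subset (n : ℕ) (w : List Gen) :
    runKeys n w ⊆ Prod.mk 0 '' ((Finset.univ ×ˢ Finset.range (2 ^ (n + 4)) :
        Finset (RegionType × ℕ)) : Set (RegionType × ℕ)) ∪
      (fun k : ℕ × RegionType => (k.1, k.2, bubbleLen (n + 1))) ''
        (((stationTimes_finite n w).toFinset ×ˢ Finset.univ : Finset (ℕ × RegionType)) :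
          Set (ℕ × RegionType)) := by
  rintro ⟨t, τ, j⟩ (⟨h1, -, h2⟩ | ⟨h1, h2⟩)
  · simp only at h1 h2
    subst h1
    exact Or.inl ⟨(τ, j), by simpa using h2.trans_le (regionLen_le n _), rfl⟩
  · simp only at h1 h2
    subst h2
    exact Or.inr ⟨(t, τ), by simpa using h1, rfl⟩

theorem ncard_runTable_le (n : ℕ) (w : List Gen) :
    (runTable n w).ncard ≤
      1458 * 2 ^ (n + 4) + (1458 * 2 ^ (n + 4) + Ttotal (n + 1) w) * 1458 := by
  have hfin := ((Finset.finite_toSet (Finset.univ ×ˢ Finset.range (2 ^ (n + 4)) :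
    Finset (RegionType × ℕ))).image (Prod.mk 0)).union ((Finset.finite_toSet
      ((stationTimes_finite n w).toFinset ×ˢ Finset.univ : Finset (ℕ × RegionType))).image
        fun k : ℕ × RegionType => (k.1, k.2, bubbleLen (n + 1)))
  refine (Set.ncard_image_le (hfin.subset (runKeys_subset n w))).trans
    ((Set.ncard_le_ncard (runKeys_subset n w) hfin).trans
      ((Set.ncard_union_le _ _).trans (add_le_add ?_ ?_)))
  · refine (Set.ncard_image_le (Finset.finite_toSet _)).trans ?_
    rw [Set.ncard_coe_finset, Finset.card_product, Finset.card_univ, card_regionType,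
      Finset.card_range]
  · refine (Set.ncard_image_le (Finset.finite_toSet _)).trans ?_
    rw [Set.ncard_coe_finset, Finset.card_product, Finset.card_univ, card_regionType,
      ← Set.ncard_eq_toFinset_card _ (stationTimes_finite n w)]
    exact Nat.mul_le_mul_right _ (ncard_stationTimes_le n w)

/-- A finite set that contains the tables of all words of length at most `ρ`. -/
def tableBound (n ρ : ℕ) : Finset ((ℕ × RegionType × ℕ) × ℕ × ℕ) :=
  (Finset.range (ρ + 1) ×ˢ Finset.univ ×ˢ Finset.range (2 ^ (n + 4) + 1)) ×ˢ
    Finset.range (ρ + 1) ×ˢ Finset.range (2 ^ (n + 4) + 1)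

theorem card_tableBound (n ρ : ℕ) :
    (tableBound n ρ).card = 1458 * ((ρ + 1) * (2 ^ (n + 4) + 1)) ^ 2 := by
  simp only [tableBound, Finset.card_product, Finset.card_range, Finset.card_univ,
    card_regionType]
  ring

theorem runTable_subset {n ρ : ℕ} {w : List Gen} (hw : w.length ≤ ρ) :
    runTable n w ⊆ tableBound n ρ := by
  rintro _ ⟨⟨t, τ, j⟩, hk, rfl⟩
  have hl := regionLen_le n τ.1
  have hj : t ≤ w.length ∧ j ≤ regionLen n τ.1 := by
    rcases hk with ⟨h1, -, h2⟩ | ⟨h1, h2⟩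
    · exact ⟨by simp only at h1; omega, h2.le⟩
    · refine ⟨?_, h2.trans_le (bubbleLen_lt_regionLen n τ.1).le⟩
      rcases h1 with ⟨τ', j', -, -, h⟩ | ⟨p, hp, h⟩
      · exact h.symm.trans_le (run_fst_le _ _ _ _)
      · exact h.symm.trans_le hp.2.1
  have h1 : (regionRun n τ (w.drop t) j).1 ≤ (w.drop t).length := run_fst_le _ _ _ _
  have h2 : (regionRun n τ (w.drop t) j).2 ≤ regionLen n τ.1 := run_snd_le _ _ hj.2
  rw [List.length_drop] at h1
  simp only [tableBound, Finset.coe_product, Finset.coe_range, Finset.coe_univ, Set.mem_prod,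
    Set.mem_Iio, Set.mem_univ, true_and]
  omega

theorem exists_word (g : G) : ∃ w : List Gen, w.length = wordLength g ∧ wordPerm w = g := by
  refine Nat.sInf_mem (s := {l | ∃ w : List Gen, w.length = l ∧ wordPerm w = g}) ?_
  obtain ⟨w, hw⟩ := (mem_G_iff _).1 g.2
  exact ⟨_, w, rfl, hw⟩

/-- Equality of tables implies equality of group elements only for words of the same length, so
spheres are counted first. -/
theorem ncard_sphere_le {n ρ ℓ κ : ℕ} (hn : 3 ≤ n) (hℓ : ℓ ≤ ρ)
    (hκ : ∀ w : List Gen, w.length = ℓ → (runTable n w).ncard ≤ κ) :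
    {g : G | wordLength g = ℓ}.ncard ≤ ((tableBound n ρ).card + 1) ^ κ := by
  choose word hlen hword using exists_word
  refine ncard_le_of_injOn_set (f := fun g => runTable n (word g)) _ ?_ ?_ ?_
  · intro g hg g' hg' h
    refine Subtype.ext ?_
    rw [← hword g, ← hword g']
    exact wordPerm_eq_of_runTable_eq hn (by rw [hlen, hlen, hg.out, hg'.out]) h
  · intro g hg
    exact runTable_subset (by rw [hlen, hg.out]; exact hℓ)
  · intro g hg
    exact hκ _ (by rw [hlen, hg.out])

theorem growth_le {n κ : ℕ} {R : ℝ} (hn : 3 ≤ n)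
    (hκ : ∀ w : List Gen, w.length ≤ ⌊R⌋₊ → (runTable n w).ncard ≤ κ) (hR : 0 ≤ R) :
    growth R ≤ (⌊R⌋₊ + 1) * ((tableBound n ⌊R⌋₊).card + 1) ^ κ := by
  have : {g : G | (wordLength g : ℝ) ≤ R} =
      ⋃ ℓ ∈ Finset.range (⌊R⌋₊ + 1), {g : G | wordLength g = ℓ} := by
    ext g
    simp [← Nat.le_floor_iff hR]
  rw [growth, this]
  refine (Finset.set_ncard_biUnion_le _ _).trans ((Finset.sum_le_card_nsmul _ _
    (((tableBound n ⌊R⌋₊).card + 1) ^ κ) fun ℓ hℓ => ?_).trans ?_)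
  · have := Nat.lt_succ_iff.1 (Finset.mem_range.1 hℓ)
    exact ncard_sphere_le hn this fun w hw => hκ w (hw.trans_le this)
  · rw [Finset.card_range, smul_eq_mul]

/-! ### The growth estimate -/

/-- Balancing `2^n` against `R / 1.08^n` leads to the base `2.16 = 2 · 1.08`. Since `log 2 / log
2.16` is about 0.9001, the exponent 0.91 is sufficient. -/
theorem two_le_rpow : (2 : ℝ) ≤ 2.16 ^ (0.91 : ℝ) := by
  have h : (2 : ℝ) ^ (100 : ℕ) ≤ (2.16 : ℝ) ^ (91 : ℕ) := by norm_num
  calc (2 : ℝ) = ((2 : ℝ) ^ (100 : ℕ)) ^ (0.01 : ℝ) := by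
        rw [← Real.rpow_natCast, ← Real.rpow_mul (by norm_num)]
        norm_num
    _ ≤ ((2.16 : ℝ) ^ (91 : ℕ)) ^ (0.01 : ℝ) :=
        Real.rpow_le_rpow (by norm_num) h (by norm_num)
    _ = 2.16 ^ (0.91 : ℝ) := by
        rw [← Real.rpow_natCast, ← Real.rpow_mul (by norm_num)]
        norm_num

theorem rpow_le_one_add : (2.16 : ℝ) ^ (0.09 : ℝ) ≤ 1.08 := by
  have h : (2.16 : ℝ) ^ (9 : ℕ) ≤ (1.08 : ℝ) ^ (100 : ℕ) := by norm_num
  calc (2.16 : ℝ) ^ (0.09 : ℝ) = ((2.16 : ℝ) ^ (9 : ℕ)) ^ (0.01 : ℝ) := by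
        rw [← Real.rpow_natCast, ← Real.rpow_mul (by norm_num)]
        norm_num
    _ ≤ ((1.08 : ℝ) ^ (100 : ℕ)) ^ (0.01 : ℝ) :=
        Real.rpow_le_rpow (by norm_num) h (by norm_num)
    _ = 1.08 := by
        rw [← Real.rpow_natCast, ← Real.rpow_mul (by norm_num)]
        norm_num

theorem exists_level {R : ℝ} (hR : 1 ≤ R) :
    ∃ n : ℕ, 3 ≤ n ∧ (2 : ℝ) ^ n ≤ 8 * R ^ (0.91 : ℝ) ∧ R ≤ R ^ (0.91 : ℝ) * 1.08 ^ (n + 1) := by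
  obtain ⟨n, h1, h2⟩ := exists_nat_pow_near hR (show (1 : ℝ) < 2.16 by norm_num)
  have hR0 : 0 < R := by linarith
  -- The shift by 3 ensures a level of at least 3 and costs the factor `8 = 2^3`.
  refine ⟨n + 3, by omega, ?_, ?_⟩
  · have : (2 : ℝ) ^ n ≤ R ^ (0.91 : ℝ) := by
      calc (2 : ℝ) ^ n ≤ (2.16 ^ (0.91 : ℝ)) ^ n := pow_le_pow_left₀ (by norm_num) two_le_rpow n
        _ = ((2.16 : ℝ) ^ n) ^ (0.91 : ℝ) := Real.rpow_pow_comm (by norm_num) _ _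
        _ ≤ R ^ (0.91 : ℝ) := Real.rpow_le_rpow (by positivity) h1 (by norm_num)
    rw [pow_add]
    linarith
  · have : R ^ (0.09 : ℝ) ≤ 1.08 ^ (n + 1) := by
      calc R ^ (0.09 : ℝ) ≤ ((2.16 : ℝ) ^ (n + 1)) ^ (0.09 : ℝ) :=
            Real.rpow_le_rpow hR0.le h2.le (by norm_num)
        _ = (2.16 ^ (0.09 : ℝ)) ^ (n + 1) := (Real.rpow_pow_comm (by norm_num) _ _).symm
        _ ≤ 1.08 ^ (n + 1) := pow_le_pow_left₀ (by positivity) rpow_le_one_add _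
    calc R = R ^ (0.91 : ℝ) * R ^ (0.09 : ℝ) := by
          rw [← Real.rpow_add hR0]
          norm_num
      _ ≤ R ^ (0.91 : ℝ) * 1.08 ^ (n + 3 + 1) := by
          gcongr
          exact this.trans (pow_le_pow_right₀ (by norm_num) (by omega))

theorem exists_log_growth_le : ∃ K : ℝ, 0 ≤ K ∧ ∀ R : ℝ, 1 ≤ R →
    (growth R : ℝ) ≤ Real.exp (K * R ^ (0.9181 : ℝ)) := by
  obtain ⟨C, hC, hT⟩ := exists_Ttotal_le
  -- The bound of the table size over `Q`: `1458 + 1458²` equals `1458 · 1459`, and `2^(n+4) ≤ 16 ·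
  -- 8 Q`.
  set A : ℝ := 1458 * 1459 * 128 + 1458 * C with hA
  -- Chosen to exceed `1458 · 512² + 1`, the coefficient in the bound of the number of table entries
  -- by `R^4`.
  set B : ℝ := 400000000 with hB
  -- The logarithm of `B R^4` is at most `D R^0.0081`, and `0.91 + 0.0081 = 0.9181`.
  set D : ℝ := Real.log B + 4 / 0.0081 with hD
  have hlogB : 0 ≤ Real.log B := Real.log_nonneg (by norm_num [hB])
  have hD0 : 0 ≤ D := by positivity
  refine ⟨(A + 1) * D, by positivity, fun R hR => ?_⟩
  have hR0 : 0 < R := by linarith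
  obtain ⟨n, hn, h2n, hRn⟩ := exists_level hR
  set ρ := ⌊R⌋₊ with hρ
  have hρR : (ρ : ℝ) ≤ R := Nat.floor_le hR0.le
  set Q := R ^ (0.91 : ℝ) with hQ
  have hQ1 : 1 ≤ Q := Real.one_le_rpow hR (by norm_num)
  have hQR : Q ≤ R := by
    calc Q ≤ R ^ (1 : ℝ) := Real.rpow_le_rpow_of_exponent_le hR (by norm_num)
      _ = R := Real.rpow_one R
  have hM : ((2 ^ (n + 4) : ℕ) : ℝ) ≤ 128 * Q := by
    push_cast
    rw [pow_add]
    linarith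
  have hκ (w : List Gen) (hw : w.length ≤ ρ) : (runTable n w).ncard ≤ ⌊A * Q⌋₊ := by
    refine Nat.le_floor ?_
    have h1 : ((runTable n w).ncard : ℝ) ≤ ((1458 * 2 ^ (n + 4) +
      (1458 * 2 ^ (n + 4) + Ttotal (n + 1) w) * 1458 : ℕ) : ℝ) := by
        exact_mod_cast ncard_runTable_le n w
    have h2 : (Ttotal (n + 1) w : ℝ) ≤ C * Q := by
      have hp : (0 : ℝ) < 1.08 ^ (n + 1) := by positivity
      refine le_of_mul_le_mul_right ((hT (n + 1) w).trans ?_) hp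
      calc C * (w.length : ℝ) ≤ C * R := by
            gcongr
            exact (Nat.cast_le.2 hw).trans hρR
        _ ≤ C * (Q * 1.08 ^ (n + 1)) := by gcongr
        _ = C * Q * 1.08 ^ (n + 1) := by ring
    push_cast at h1 hM
    rw [hA]
    linarith
  have hg := growth_le hn hκ hR0.le
  rw [card_tableBound] at hg
  have hg' : (growth R : ℝ) ≤ ((ρ : ℝ) + 1) *
      (1458 * (((ρ : ℝ) + 1) * (((2 ^ (n + 4) : ℕ) : ℝ) + 1)) ^ 2 + 1) ^ ⌊A * Q⌋₊ := by
    exact_mod_cast hg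
  have hR4 : R ≤ R ^ 4 := le_self_pow₀ hR (by norm_num)
  have hbase : 1458 * (((ρ : ℝ) + 1) * (((2 ^ (n + 4) : ℕ) : ℝ) + 1)) ^ 2 + 1 ≤ B * R ^ 4 := by
    have h1 : ((ρ : ℝ) + 1) * (((2 ^ (n + 4) : ℕ) : ℝ) + 1) ≤ (2 * R) * (256 * R) := by
      gcongr
      · linarith
      · linarith
    have h2 := pow_le_pow_left₀ (by positivity) h1 2
    have h3 : ((2 * R) * (256 * R)) ^ 2 = 262144 * R ^ 4 := by ring
    rw [hB]
    linarith
  have hfirst : (ρ : ℝ) + 1 ≤ B * R ^ 4 := by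
    rw [hB]
    linarith
  have hBR : 0 < B * R ^ 4 := by positivity
  have hlog : Real.log (B * R ^ 4) ≤ D * R ^ (0.0081 : ℝ) := by
    have h1 : Real.log R ≤ R ^ (0.0081 : ℝ) / 0.0081 := Real.log_le_rpow_div hR0.le (by norm_num)
    have h2 : (1 : ℝ) ≤ R ^ (0.0081 : ℝ) := Real.one_le_rpow hR (by norm_num)
    rw [Real.log_mul (by positivity) (by positivity), Real.log_pow, hD, add_mul]
    have h3 : Real.log B ≤ Real.log B * R ^ (0.0081 : ℝ) := le_mul_of_one_le_right hlogB h2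
    have h4 : 4 / 0.0081 * R ^ (0.0081 : ℝ) = 4 * (R ^ (0.0081 : ℝ) / 0.0081) := by ring
    push_cast
    linarith
  calc (growth R : ℝ) ≤ (B * R ^ 4) * (B * R ^ 4) ^ ⌊A * Q⌋₊ := hg'.trans (by gcongr)
    _ = Real.exp (((⌊A * Q⌋₊ : ℝ) + 1) * Real.log (B * R ^ 4)) := by
        rw [← pow_succ', ← Real.exp_log (pow_pos hBR _), Real.log_pow]
        push_cast
        rfl
    _ ≤ Real.exp ((A + 1) * D * R ^ (0.9181 : ℝ)) := by
        refine Real.exp_le_exp.2 ?_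
        have h1 : (⌊A * Q⌋₊ : ℝ) + 1 ≤ (A + 1) * Q := by
          have := Nat.floor_le (show 0 ≤ A * Q by positivity)
          linarith
        calc ((⌊A * Q⌋₊ : ℝ) + 1) * Real.log (B * R ^ 4)
            ≤ ((⌊A * Q⌋₊ : ℝ) + 1) * (D * R ^ (0.0081 : ℝ)) := by gcongr
          _ ≤ ((A + 1) * Q) * (D * R ^ (0.0081 : ℝ)) := by gcongr
          _ = (A + 1) * D * (Q * R ^ (0.0081 : ℝ)) := by ring
          _ = (A + 1) * D * R ^ (0.9181 : ℝ) := by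
              rw [hQ, ← Real.rpow_add hR0]
              norm_num

theorem growthLE_exp : GrowthLE (fun R => (growth R : ℝ))
    (fun R => Real.exp (R ^ (0.9181 : ℝ))) := by
  obtain ⟨K, hK, h⟩ := exists_log_growth_le
  -- The factor `K + 1` is moved into the argument by taking its root of order 0.9181; the summand 1
  -- makes the constant at least 1.
  refine ⟨(K + 1) ^ ((0.9181 : ℝ)⁻¹), Real.one_le_rpow (by linarith) (by norm_num),
    fun R hR => (h R hR).trans (Real.exp_le_exp.2 ?_)⟩
  rw [Real.mul_rpow (by positivity) (by linarith), ← Real.rpow_mul (by positivity),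
    inv_mul_cancel₀ (by norm_num), Real.rpow_one]
  gcongr
  linarith

end GoldenMean

/-! ### The main theorem -/

theorem mainTheorem4 :
    (∀ x : GoldenMean.Shift,
      GoldenMean.IsSingular x ↔ ∃ i : Fin 3, GoldenMean.SameOrbit (GoldenMean.xi i) x) ∧
    (∀ i j : Fin 3, GoldenMean.SameOrbit (GoldenMean.xi i) (GoldenMean.xi j) → i = j) ∧
    (∀ w : List GoldenMean.Gen, {n : ℕ | GoldenMean.Ttotal n w ≠ 0}.Finite) ∧
    (∃ C : Fin 3 → Polynomial ℝ, ∀ (w : List GoldenMean.Gen) (t : ℝ), 0 < t →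
      (∀ i : Fin 3,
        (t ^ (-8 : ℤ) + t ^ (-5 : ℤ) + t ^ (-2 : ℤ)) *
            (GoldenMean.F w i t - (C i).eval t * (w.length : ℝ)) ≤
          2 * GoldenMean.F w (i - 2) t) ∧
      (t ^ (-8 : ℤ) + t ^ (-5 : ℤ) + t ^ (-2 : ℤ)) *
          ((∑ i : Fin 3, GoldenMean.F w i t) - (∑ i : Fin 3, (C i).eval t) * (w.length : ℝ)) ≤
        2 * ∑ i : Fin 3, GoldenMean.F w i t) ∧
    GoldenMean.GrowthLE (fun R => (GoldenMean.growth R : ℝ))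
      (fun R => Real.exp (R ^ (0.9181 : ℝ))) := by
  refine ⟨GoldenMean.isSingular_iff, fun i j h => GoldenMean.eq_of_sameOrbit_xi h, fun w => ?_,
    ⟨GoldenMean.correction, fun w t ht => ⟨GoldenMean.F_inequality w ht,
      GoldenMean.F_sum_inequality w ht⟩⟩, GoldenMean.growthLE_exp⟩
  refine (Set.finite_Iic (w.length + 1)).subset fun n hn => ?_
  by_contra h
  exact hn (GoldenMean.Ttotal_eq_zero (not_le.1 h))
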